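/- All strings are over $\{0,1\}$. For an equivalence relation $R$ on $\{0,1\}^*$, a complete invariant is a function $f:\{0,1\}^*\to\{0,1\}^*$ with $x\sim_R y \iff f(x)=f(y)$; it is a canonical form if moreover $x\sim_R f(x)$ for all $x$. Canonical forms of equivalence relations on other sets are defined likewise. Let $\mathrm{Ker}$ (respectively $\mathrm{CF}$) be the class of equivalence relations on $\{0,1\}^*$ that have a complete invariant (respectively a canonical form) computable by a deterministic Turing machine in time polynomial in the length of the input. Proposition. (1) If $\mathrm{CF}=\mathrm{Ker}$, then integers can be factored in probabilistic polynomial time: there are a polynomial $p$ and a deterministic polynomial-time Turing machine $M$ such that for every integer $N\ge 1$ (written in binary, with length $|N|$), when $r$ is uniform in $\{0,1\}^{p(|N|)}$, the output $M(N,r)$ is, with probability at least $2/3$, a list of primes whose product is $N$. (2) Let $N>1$ be an odd integer that is not a prime power, and let $f$ be any canonical form of the kernel $\{(x,y): x^2=y^2\}$ of the squaring map on $\mathbb Z/N\mathbb Z$. If $x$ is uniformly random in $(\mathbb Z/N\mathbb Z)^\times$ and $y=f(x)$, then $y\not\equiv\pm x \pmod N$ with probability at least $1/2$. For every $x\in\mathbb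 Z/N\mathbb Z$ with $y=f(x)\not\equiv\pm x \pmod N$, the number $\gcd(N,x-y)$ is a nontrivial factor of $N$, that is, $1<\gcd(N,x-y)<N$. -/

import Mathlib

/-- The kernel `{(x, y) : f x = f y}` of `f` is the equivalence relation `R`. -/
def IsCompleteInvariant {α β : Type} (R : Setoid α) (f : α → β) : Prop :=
  R = Setoid.ker f

/-- A complete invariant that picks a member of each equivalence class. -/
def IsCanonicalForm {α : Type} (R : Setoid α) (f : α → α) : Prop :=
  IsCompleteInvariant R f ∧ ∀ x, R x (f x)

/-- Functions on binary strings computable by a (multi-tape) Turing machine whose number of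
steps is bounded by a polynomial in the length of the input. -/
def InFP (f : List Bool → List Bool) : Prop :=
  Nonempty (Turing.TM2ComputableInPolyTime (id : List Bool → List Bool)
    (id : List Bool → List Bool) f)

/-- Equivalence relations on binary strings with a polynomial-time complete invariant. -/
def ClassKer : Set (Setoid (List Bool)) :=
  {R | ∃ f : List Bool → List Bool, InFP f ∧ IsCompleteInvariant R f}

/-- Equivalence relations on binary strings with a polynomial-time canonical form. -/
def ClassCF : Set (Setoid (List Bool)) :=
  {R | ∃ f : List Bool → List Bool, InFP f ∧ IsCanonicalForm R f}

/-- Probability of `E` under the uniform distribution on a nonempty finite type. -/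
noncomputable def uniformProb {Ω : Type} (E : Ω → Prop) : ℚ :=
  (Nat.card {ω : Ω // E ω} : ℚ) / (Nat.card Ω : ℚ)

/-- An input followed by a string of coin tosses; the two parts use disjoint alphabets. -/
def encodeWithCoins {α A : Type} (ea : α → List A) (x : α × List Bool) : List (A ⊕ Bool) :=
  (ea x.1).map Sum.inl ++ x.2.map Sum.inr

/-- The search problem `S` (given `a`, find some `b` with `S a b`) is solvable in probabilistic
polynomial time with bounded error: a polynomial-time machine `M` reads `a` together with
`p (|a|)` fair coin tosses, and its output is a solution with probability at least `2/3`. -/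
def SolvableInProbPolyTime {α β A B : Type} (ea : α → List A) (eb : β → List B)
    (S : α → β → Prop) : Prop :=
  ∃ (p : Polynomial ℕ) (M : α × List Bool → β),
    Nonempty (Turing.TM2ComputableInPolyTime (encodeWithCoins ea) eb M) ∧
    ∀ a : α, 2 / 3 ≤ uniformProb
      (fun r : Fin (p.eval (ea a).length) → Bool => S a (M (a, List.ofFn r)))

/-- A positive integer in binary. -/
def encodePosNat (n : ℕ+) : List Bool :=
  Computability.encodeNat (n : ℕ)

/-- A list of natural numbers in binary, each one followed by the separator `none`. -/
def encodeNatList (l : List ℕ) : List (Option Bool) :=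
  l.flatMap (fun n => (Computability.encodeNat n).map some ++ [none])

/-- `l` lists the prime factors of `n`, with multiplicity, in any order. -/
def IsPrimeFactorization (n : ℕ+) (l : List ℕ) : Prop :=
  (∀ q ∈ l, q.Prime) ∧ l.prod = (n : ℕ)

/-- Integers can be factored (completely) in probabilistic polynomial time. -/
def FactoringInProbPolyTime : Prop :=
  SolvableInProbPolyTime encodePosNat encodeNatList IsPrimeFactorization

/-! Part (2). Write `N = a * b` with `a`, `b` coprime, odd and greater than 2. By the Chinese
remainder theorem there is a unit `u` with `u ^ 2 = 1` and `u ≠ 1, -1` (`exists_unit_sq_eq_one`). A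
canonical form `f` of the squaring kernel takes the same value at `x` and at `u * x`. If this value
is `x` or `-x`, it is neither `u * x` nor `-(u * x)`. Multiplication by `u` thus injects the useless
units into the useful ones (`card_trivial_roots_le`). For a useful `x`, the product of `x - f x` and
`x + f x` is 0 and neither factor is, which gives the divisor (`gcd_val_sub_nontrivial`).

Part (1). The map taking a pair `(m, x)` to `(m, x ^ 2 mod m)`, on strings, is polynomial-time, so
its kernel is in `ClassKer`. If this equals `ClassCF`, some polynomial-time `F` finds, for all `m`
at once, a square root of `x ^ 2` modulo `m` that depends on `x ^ 2` only (`IsRootFinder`). A list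
of factors of `N` is kept, starting with `N` itself. In each round a block of coins is read as a
number `x`, and every `m` on the list is tested for a proper gcd with `2`, `x`, `x ^ m - x` and `x -
y`, where `y` is the root found. These handle even `m`, non-units, prime powers, and, by part (2),
all other `m`. A composite `m` survives for at most 3/4 of its residues
(`four_mul_card_trySplit_le`), and a prime is never split, so no primality test is needed.

The number of splittings still missing, `splitDefect`, is at most `k = |N|` at the start and is at
least 1 while some factor is composite. Each round multiplies its mean by at most `1 - 1 / (8 * k)`,
so after `32 * k ^ 2` rounds the mean is at most 1/3, and Markov's inequality gives success with
probability at least 2/3 (`two_thirds_le_uniformProb_factorRun`).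

Most of the length goes into showing that this is a polynomial-time Turing machine. A language of
structured stack programs with calls to the machine for `F` is compiled to `TM2`. Over it,
`PolyTime` is the class of functions on tree-encoded data computed in polynomial time; it is closed
under composition, pairing, case distinction and size-bounded folds, from which binary arithmetic
and the algorithm are built. -/

open Turing

/-! ### Compiling structured stack programs with a subroutine to Turing machines. -/

/-- `f` leads from `a` to `b` in exactly `n` steps. -/
def ReachIn {α : Type} (f : α → Option α) (n : ℕ) (a b : α) : Prop :=
  (flip bind f)^[n] (some a) = some b

theorem ReachIn.trans {α : Type} {f : α → Option α} {m n : ℕ} {a b c : α}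
    (h₁ : ReachIn f m a b) (h₂ : ReachIn f n b c) : ReachIn f (m + n) a c := by
  unfold ReachIn at *
  rw [Nat.add_comm, Function.iterate_add_apply, h₁, h₂]

theorem ReachIn.single {α : Type} {f : α → Option α} {a b : α} (h : f a = some b) :
    ReachIn f 1 a b := h

theorem ReachIn.head {α : Type} {f : α → Option α} {n : ℕ} {a b c : α} (h : f a = some b)
    (h₂ : ReachIn f n b c) : ReachIn f (n + 1) a c := by
  rw [Nat.add_comm]
  exact (ReachIn.single h).trans h₂

theorem ReachIn.exists_of_succ {α : Type} {f : α → Option α} {n : ℕ} {a c : α}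
    (h : ReachIn f (n + 1) a c) : ∃ b, f a = some b ∧ ReachIn f n b c := by
  unfold ReachIn at *
  rw [Function.iterate_succ_apply] at h
  change (flip bind f)^[n] (f a) = some c at h
  cases hb : f a with
  | none =>
    rw [hb] at h
    exfalso
    have : ∀ n, (flip bind f)^[n] (none : Option α) = none := by
      intro n
      induction n with
      | zero => rfl
      | succ n ih => rw [Function.iterate_succ_apply]; exact ih
    rw [this] at h
    exact Option.some_ne_none _ h.symm
  | some b => exact ⟨b, rfl, by rw [hb] at h; exact h⟩

section Programs

variable {K₀ : Type} (Γ₀ : K₀ → Type) (M : FinTM2)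

/-- The stack alphabets of a program that uses stacks of its own, indexed by `K₀`, besides those
of the machine `M`. -/
abbrev Alph : K₀ ⊕ M.K → Type
  | .inl k => Γ₀ k
  | .inr k => M.Γ k

/-- The contents of the stacks of a program that uses stacks of its own, indexed by `K₀`,
besides those of the machine `M`. -/
abbrev Stacks : Type := ∀ k : K₀ ⊕ M.K, List (Alph Γ₀ M k)

/-- Structured programs acting on stacks, which may run the machine `M` as a subroutine. -/
inductive Prog : Type
  | push (k : K₀ ⊕ M.K) (a : Alph Γ₀ M k) : Prog
  | drop (k : K₀ ⊕ M.K) : Prog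
  | ite (k : K₀ ⊕ M.K) (c : Option (Alph Γ₀ M k) → Bool) (P Q : Prog) : Prog
  | loop (k : K₀ ⊕ M.K) (c : Option (Alph Γ₀ M k) → Bool) (P : Prog) : Prog
  | seq (P Q : Prog) : Prog
  | call : Prog

variable {Γ₀ M}

/-- The combined stacks, given those of the program proper and those of the machine. -/
def joinStacks (S : ∀ k, List (Γ₀ k)) (W : ∀ k, List (M.Γ k)) : Stacks Γ₀ M
  | Sum.inl k => S k
  | Sum.inr k => W k

variable [DecidableEq K₀]

/-- `Run P S t S'`: the program `P` turns the stacks `S` into `S'` in `t` steps. -/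
inductive Run : Prog Γ₀ M → Stacks Γ₀ M → ℕ → Stacks Γ₀ M → Prop
  | push (k a S) : Run (.push k a) S 1 (Function.update S k (a :: S k))
  | drop (k S) : Run (.drop k) S 1 (Function.update S k (S k).tail)
  | ite_true {k c P Q S t S'} (hc : c (S k).head? = true) (h : Run P S t S') :
      Run (.ite k c P Q) S (t + 1) S'
  | ite_false {k c P Q S t S'} (hc : c (S k).head? = false) (h : Run Q S t S') :
      Run (.ite k c P Q) S (t + 1) S'
  | loop_false {k c P S} (hc : c (S k).head? = false) : Run (.loop k c P) S 1 S
  | loop_true {k c P S t S' t' S''} (hc : c (S k).head? = true) (h : Run P S t S')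
      (h' : Run (.loop k c P) S' t' S'') : Run (.loop k c P) S (t + t' + 1) S''
  | seq {P Q S t S' t' S''} (h : Run P S t S') (h' : Run Q S' t' S'') :
      Run (.seq P Q) S (t + t') S''
  | call {S W W' t}
      (h : ReachIn M.step t ⟨some M.main, M.initialState, W⟩ ⟨none, M.initialState, W'⟩) :
      Run .call (joinStacks S W) t (joinStacks S W')

/-- The labels of the machine code of a program. -/
def Prog.Lbl : Prog Γ₀ M → Type
  | .push _ _ => Unit
  | .drop _ => Unit
  | .ite _ _ P Q => Option (P.Lbl ⊕ Q.Lbl)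
  | .loop _ _ P => Option P.Lbl
  | .seq P Q => P.Lbl ⊕ Q.Lbl
  | .call => M.Λ

/-- The label where the machine code of a program starts. -/
def Prog.entry : (P : Prog Γ₀ M) → P.Lbl
  | .push _ _ => ()
  | .drop _ => ()
  | .ite _ _ _ _ => none
  | .loop _ _ _ => none
  | .seq P _ => Sum.inl P.entry
  | .call => M.main

instance Prog.fintypeLbl : (P : Prog Γ₀ M) → Fintype P.Lbl
  | .push _ _ => inferInstanceAs (Fintype Unit)
  | .drop _ => inferInstanceAs (Fintype Unit)
  | .ite _ _ P Q =>
    have := P.fintypeLbl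
    have := Q.fintypeLbl
    inferInstanceAs (Fintype (Option (P.Lbl ⊕ Q.Lbl)))
  | .loop _ _ P =>
    have := P.fintypeLbl
    inferInstanceAs (Fintype (Option P.Lbl))
  | .seq P Q =>
    have := P.fintypeLbl
    have := Q.fintypeLbl
    inferInstanceAs (Fintype (P.Lbl ⊕ Q.Lbl))
  | .call => M.ΛFin

/-- The code of `M` as part of a larger machine, continuing at the label `exit`. -/
def embedStmt {Λ : Type} (e : M.Λ → Λ) (exit : Λ) :
    TM2.Stmt M.Γ M.Λ M.σ → TM2.Stmt (Alph Γ₀ M) Λ (Bool × M.σ)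
  | .push k f q => .push (Sum.inr k) (fun v => f v.2) (embedStmt e exit q)
  | .peek k f q => .peek (Sum.inr k) (fun v o => (v.1, f v.2 o)) (embedStmt e exit q)
  | .pop k f q => .pop (Sum.inr k) (fun v o => (v.1, f v.2 o)) (embedStmt e exit q)
  | .load f q => .load (fun v => (v.1, f v.2)) (embedStmt e exit q)
  | .branch f q q' => .branch (fun v => f v.2) (embedStmt e exit q) (embedStmt e exit q')
  | .goto f => .goto fun v => e (f v.2)
  | .halt => .goto fun _ => exit

/-- The machine code of a program, whose labels are embedded by `e`, continuing at `exit`. -/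
def Prog.code {Λ : Type} : (P : Prog Γ₀ M) → (P.Lbl → Λ) → Λ → P.Lbl →
    TM2.Stmt (Alph Γ₀ M) Λ (Bool × M.σ)
  | .push k a, _, exit, _ => .push k (fun _ => a) (.goto fun _ => exit)
  | .drop k, _, exit, _ => .pop k (fun v _ => v) (.goto fun _ => exit)
  | .ite k c P Q, e, exit, l =>
    match l with
    | none => .peek k (fun v o => (c o, v.2)) (.branch (fun v => v.1)
        (.goto fun _ => e (some (Sum.inl P.entry))) (.goto fun _ => e (some (Sum.inr Q.entry))))
    | some (Sum.inl l) => P.code (fun l => e (some (Sum.inl l))) exit l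
    | some (Sum.inr l) => Q.code (fun l => e (some (Sum.inr l))) exit l
  | .loop k c P, e, exit, l =>
    match l with
    | none => .peek k (fun v o => (c o, v.2)) (.branch (fun v => v.1)
        (.goto fun _ => e (some P.entry)) (.goto fun _ => exit))
    | some l => P.code (fun l => e (some l)) (e none) l
  | .seq P Q, e, exit, l =>
    match l with
    | Sum.inl l => P.code (fun l => e (Sum.inl l)) (e (Sum.inr Q.entry)) l
    | Sum.inr l => Q.code (fun l => e (Sum.inr l)) exit l
  | .call, e, exit, l => embedStmt e exit (M.m l)

theorem joinStacks_update_inr (S : ∀ k, List (Γ₀ k)) (W : ∀ k, List (M.Γ k)) (k : M.K)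
    (l : List (M.Γ k)) : Function.update (joinStacks S W) (Sum.inr k) l =
      joinStacks S (Function.update W k l) := by
  funext j
  rcases j with j | j
  · rfl
  · by_cases h : j = k
    · subst h
      simp [joinStacks]
    · rw [Function.update_of_ne (by simpa using h)]
      simp [joinStacks, h]

theorem stepAux_embedStmt {Λ : Type} (e : M.Λ → Λ) (exit : Λ) (S : ∀ k, List (Γ₀ k)) (b : Bool)
    (q : TM2.Stmt M.Γ M.Λ M.σ) (v : M.σ) (W : ∀ k, List (M.Γ k)) :
    TM2.stepAux (embedStmt e exit q) (b, v) (joinStacks S W) =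
      ⟨some (((TM2.stepAux q v W).l).elim exit e), (b, (TM2.stepAux q v W).var),
        joinStacks S (TM2.stepAux q v W).stk⟩ := by
  induction q generalizing v W with
  | push k f q ih =>
    simp only [embedStmt, TM2.stepAux]
    rw [joinStacks_update_inr, ← ih]
    rfl
  | peek k f q ih => exact ih _ _
  | pop k f q ih =>
    simp only [embedStmt, TM2.stepAux]
    rw [joinStacks_update_inr, ← ih]
    rfl
  | load f q ih => exact ih _ _
  | branch f q q' ih ih' =>
    simp only [embedStmt, TM2.stepAux]
    cases f v
    · exact ih' _ _
    · exact ih _ _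
  | goto f => rfl
  | halt => rfl

/-- `halt` becomes a jump to `exit`. Either one is only the end of a step, so the simulation takes
exactly as many steps as `M`. -/
theorem reachIn_embed {Λ : Type} (N : Λ → TM2.Stmt (Alph Γ₀ M) Λ (Bool × M.σ))
    (e : M.Λ → Λ) (exit : Λ) (hN : ∀ l, N (e l) = embedStmt e exit (M.m l))
    (S : ∀ k, List (Γ₀ k)) (b : Bool) (t : ℕ) (l : M.Λ) (v v' : M.σ)
    (W W' : ∀ k, List (M.Γ k))
    (h : ReachIn M.step t ⟨some l, v, W⟩ ⟨none, v', W'⟩) :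
    ReachIn (TM2.step N) t ⟨some (e l), (b, v), joinStacks S W⟩
      ⟨some exit, (b, v'), joinStacks S W'⟩ := by
  induction t generalizing l v W with
  | zero => exact absurd (congrArg TM2.Cfg.l (Option.some.inj h)) (by simp)
  | succ t ih =>
    obtain ⟨c, hc, h⟩ := h.exists_of_succ
    replace hc : TM2.stepAux (M.m l) v W = c := Option.some.inj hc
    refine ReachIn.head (b := TM2.stepAux (N (e l)) (b, v) (joinStacks S W)) rfl ?_
    rw [hN, stepAux_embedStmt, hc]
    obtain ⟨l', w, V⟩ := c
    cases l' with
    | some l' => exact ih _ _ _ h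
    | none =>
      cases t with
      | zero =>
        have : (⟨none, w, V⟩ : M.Cfg) = ⟨none, v', W'⟩ := Option.some.inj h
        cases this
        rfl
      | succ t =>
        obtain ⟨c, hc, -⟩ := h.exists_of_succ
        simp [FinTM2.step, TM2.step] at hc

/-- Since `hN` only asks that the code of `P` sits somewhere in `N`, each subprogram can be given
its own label embedding and exit in the induction. The scratch Boolean holds the result of the
latest test, so it is arbitrary before and merely exists after. The state of `M` is initial at both
ends, which makes repeated calls possible. -/
theorem Run.reachIn {P : Prog Γ₀ M} {S S' : Stacks Γ₀ M} {t : ℕ} (h : Run P S t S') {Λ : Type}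
    (N : Λ → TM2.Stmt (Alph Γ₀ M) Λ (Bool × M.σ)) (e : P.Lbl → Λ) (exit : Λ)
    (hN : ∀ l, N (e l) = P.code e exit l) (b : Bool) :
    ∃ b', ReachIn (TM2.step N) t ⟨some (e P.entry), (b, M.initialState), S⟩
      ⟨some exit, (b', M.initialState), S'⟩ := by
  induction h generalizing Λ b with
  | push k a S =>
    refine ⟨b, ReachIn.single ?_⟩
    exact congrArg some (congrArg (TM2.stepAux · _ _) (hN ()))
  | drop k S =>
    refine ⟨b, ReachIn.single ?_⟩
    exact congrArg some (congrArg (TM2.stepAux · _ _) (hN ()))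
  | @ite_true k c P Q S t S' hc h ih =>
    obtain ⟨b', hb'⟩ := ih N (fun l => e (some (Sum.inl l))) exit (fun l => hN _) true
    refine ⟨b', ReachIn.head ?_ hb'⟩
    refine congrArg some ((congrArg (TM2.stepAux · _ _) (hN none)).trans ?_)
    change cond (c (S k).head?) _ _ = _
    simp only [hc]
    rfl
  | @ite_false k c P Q S t S' hc h ih =>
    obtain ⟨b', hb'⟩ := ih N (fun l => e (some (Sum.inr l))) exit (fun l => hN _) false
    refine ⟨b', ReachIn.head ?_ hb'⟩
    refine congrArg some ((congrArg (TM2.stepAux · _ _) (hN none)).trans ?_)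
    change cond (c (S k).head?) _ _ = _
    simp only [hc]
    rfl
  | @loop_false k c P S hc =>
    refine ⟨false, ReachIn.single ?_⟩
    refine congrArg some ((congrArg (TM2.stepAux · _ _) (hN none)).trans ?_)
    change cond (c (S k).head?) _ _ = _
    simp only [hc]
    rfl
  | @loop_true k c P S t S' t' S'' hc h h' ih ih' =>
    obtain ⟨b₁, hb₁⟩ := ih N (fun l => e (some l)) (e none) (fun l => hN _) true
    obtain ⟨b₂, hb₂⟩ := ih' N e exit hN b₁
    refine ⟨b₂, ReachIn.head ?_ (hb₁.trans hb₂)⟩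
    refine congrArg some ((congrArg (TM2.stepAux · _ _) (hN none)).trans ?_)
    change cond (c (S k).head?) _ _ = _
    simp only [hc]
    rfl
  | @seq P Q S t S' t' S'' h h' ih ih' =>
    obtain ⟨b₁, hb₁⟩ := ih N (fun l => e (Sum.inl l)) (e (Sum.inr Q.entry)) (fun l => hN _) b
    obtain ⟨b₂, hb₂⟩ := ih' N (fun l => e (Sum.inr l)) exit (fun l => hN _) b₁
    exact ⟨b₂, hb₁.trans hb₂⟩
  | call h => exact ⟨b, reachIn_embed N e exit hN _ _ _ _ _ _ _ _ h⟩

/-- Stacks that are empty except for one of them. -/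
def singleStack (k : K₀) (l : List (Γ₀ k)) : Stacks Γ₀ M :=
  Function.update (fun _ => []) (Sum.inl k) l

theorem singleStack_self (k : K₀) (l : List (Γ₀ k)) :
    (singleStack k l : Stacks Γ₀ M) (Sum.inl k) = l :=
  Function.update_self (β := fun k => List (Alph Γ₀ M k)) (Sum.inl k) l _

theorem singleStack_of_ne {k : K₀} {j : K₀ ⊕ M.K} (h : j ≠ Sum.inl k) (l : List (Γ₀ k)) :
    (singleStack k l : Stacks Γ₀ M) j = [] :=
  Function.update_of_ne (β := fun k => List (Alph Γ₀ M k)) h l _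

variable [Fintype K₀]

/-- The machine that executes a program. -/
def Prog.machine (P : Prog Γ₀ M) (k₀ k₁ : K₀) [Fintype (Γ₀ k₀)] : FinTM2 :=
  letI := M.kFin
  letI := M.σFin
  { K := K₀ ⊕ M.K
    k₀ := Sum.inl k₀
    k₁ := Sum.inl k₁
    Γ := Alph Γ₀ M
    Λ := Option P.Lbl
    main := some P.entry
    σ := Bool × M.σ
    initialState := (false, M.initialState)
    Γk₀Fin := inferInstanceAs (Fintype (Γ₀ k₀))
    m := fun l => match l with
      | none => .load (fun _ => (false, M.initialState)) .halt
      | some l => P.code some none l }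

theorem initList_machine (P : Prog Γ₀ M) (k₀ k₁ : K₀) [Fintype (Γ₀ k₀)] (l : List (Γ₀ k₀)) :
    initList (P.machine k₀ k₁) l = ⟨some (some P.entry), (false, M.initialState),
      (singleStack k₀ l : Stacks Γ₀ M)⟩ := by
  simp only [initList]
  congr 1
  funext k
  by_cases h : k = Sum.inl k₀
  · subst h
    exact (dif_pos rfl).trans (singleStack_self k₀ l).symm
  · exact (dif_neg h).trans (singleStack_of_ne h l).symm

theorem haltList_machine (P : Prog Γ₀ M) (k₀ k₁ : K₀) [Fintype (Γ₀ k₀)] (l : List (Γ₀ k₁)) :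
    haltList (P.machine k₀ k₁) l = ⟨none, (false, M.initialState),
      (singleStack k₁ l : Stacks Γ₀ M)⟩ := by
  simp only [haltList]
  congr 1
  funext k
  by_cases h : k = Sum.inl k₁
  · subst h
    exact (dif_pos rfl).trans (singleStack_self k₁ l).symm
  · exact (dif_neg h).trans (singleStack_of_ne h l).symm

theorem Run.nonempty_outputsInTime {P : Prog Γ₀ M} {k₀ k₁ : K₀} [Fintype (Γ₀ k₀)]
    {l : List (Γ₀ k₀)} {l' : List (Γ₀ k₁)} {t m : ℕ}
    (h : Run P (singleStack k₀ l) t (singleStack k₁ l')) (hm : t + 1 ≤ m) :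
    Nonempty (TM2OutputsInTime (P.machine k₀ k₁) l (some l') m) := by
  obtain ⟨b, hb⟩ := h.reachIn (P.machine k₀ k₁).m some none (fun _ => rfl) false
  -- The extra label `none` resets the scratch Boolean, because `haltList` demands the initial
  -- internal state. This is the additional step in `t + 1`.
  have h1 : ReachIn (P.machine k₀ k₁).step 1
      ⟨some none, (b, M.initialState), (singleStack k₁ l' : Stacks Γ₀ M)⟩
      (haltList (P.machine k₀ k₁) l') := by
    rw [haltList_machine]
    rfl
  refine ⟨⟨⟨t + 1, ?_⟩, hm⟩⟩
  rw [initList_machine]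
  exact ReachIn.trans (f := (P.machine k₀ k₁).step) hb h1

end Programs

/-! ### Output length is bounded by running time. -/

section OutputSize

/-- The largest number of symbols that a statement pushes. -/
def pushCount {K Λ σ : Type} {Γ : K → Type} : TM2.Stmt Γ Λ σ → ℕ
  | .push _ _ q => pushCount q + 1
  | .peek _ _ q => pushCount q
  | .pop _ _ q => pushCount q
  | .load _ q => pushCount q
  | .branch _ q q' => max (pushCount q) (pushCount q')
  | .goto _ => 0
  | .halt => 0

theorem length_stepAux_le {K Λ σ : Type} {Γ : K → Type} [DecidableEq K] (q : TM2.Stmt Γ Λ σ)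
    (v : σ) (S : ∀ k, List (Γ k)) (j : K) :
    ((TM2.stepAux q v S).stk j).length ≤ (S j).length + pushCount q := by
  induction q generalizing v S with
  | push k f q ih =>
    refine (ih _ _).trans ?_
    by_cases h : j = k
    · subst h
      simp [pushCount]
      omega
    · simp [h, pushCount]
  | peek k f q ih => exact ih _ _
  | pop k f q ih =>
    refine (ih _ _).trans ?_
    by_cases h : j = k
    · subst h
      simp [pushCount]
    · simp [h, pushCount]
  | load f q ih => exact ih _ _
  | branch f q q' ih ih' =>
    simp only [TM2.stepAux, pushCount]
    cases f v
    · exact (ih' _ _).trans (by simp)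
    · exact (ih _ _).trans (by simp)
  | goto f => simp [pushCount]
  | halt => simp [pushCount]

/-- The largest number of symbols that the machine pushes in one step. -/
def FinTM2.maxPush (M : FinTM2) : ℕ :=
  letI := M.ΛFin
  Finset.univ.sup fun l => pushCount (M.m l)

/-- This turns the time bound of the oracle machine into the bound on the size of its answers that
`PolyTime` requires. -/
theorem length_le_of_reachIn (M : FinTM2) (j : M.K) (n : ℕ) (c c' : M.Cfg)
    (h : ReachIn M.step n c c') :
    (c'.stk j).length ≤ (c.stk j).length + n * FinTM2.maxPush M := by
  induction n generalizing c with
  | zero =>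
    have : c = c' := by simpa [ReachIn] using h
    simp [this]
  | succ n ih =>
    obtain ⟨d, hd, h⟩ := h.exists_of_succ
    refine (ih d h).trans ?_
    obtain ⟨l, v, S⟩ := c
    cases l with
    | none => simp [FinTM2.step, TM2.step] at hd
    | some l =>
      replace hd : TM2.stepAux (M.m l) v S = d := Option.some.inj hd
      subst hd
      have h1 := length_stepAux_le (M.m l) v S j
      have h2 : pushCount (M.m l) ≤ FinTM2.maxPush M := by
        let := M.ΛFin
        exact Finset.le_sup (f := fun l => pushCount (M.m l)) (Finset.mem_univ l)
      rw [Nat.succ_mul]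
      change _ ≤ (S j).length + _
      omega

end OutputSize

/-! ### Monotone bounds, and data as self-delimiting codes of binary trees. -/

theorem Polynomial.monotone_eval_nat (p : Polynomial ℕ) : Monotone fun n : ℕ => p.eval n := by
  intro a b h
  simp only [Polynomial.eval_eq_sum_range]
  exact Finset.sum_le_sum fun i _ => Nat.mul_le_mul_left _ (Nat.pow_le_pow_left h i)

/-- Binary trees, the data of the programs below. -/
inductive BinTree : Type
  | leaf : BinTree
  | node (l r : BinTree) : BinTree

/-- Trees as self-delimiting strings. -/
def BinTree.code : BinTree → List (Option Bool)
  | .leaf => [some false]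
  | .node l r => some true :: (l.code ++ r.code)

/-- Types whose elements are represented by binary trees. -/
class TreeData (α : Type) where
  toTree : α → BinTree

section TreeData

variable {α β : Type} [TreeData α] [TreeData β]

/-- The string that represents an element. -/
def tcode (x : α) : List (Option Bool) := (TreeData.toTree x).code

/-- The length of the string that represents an element. -/
def tsize (x : α) : ℕ := (tcode x).length

instance : TreeData Bool := ⟨fun b => if b then .node .leaf .leaf else .leaf⟩

instance : TreeData (α × β) := ⟨fun x => .node (TreeData.toTree x.1) (TreeData.toTree x.2)⟩

/-- The tree of a list. -/
def listTree : List α → BinTree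
  | [] => .leaf
  | x :: l => .node (TreeData.toTree x) (listTree l)

instance : TreeData (List α) := ⟨listTree⟩

instance : TreeData ℕ := ⟨fun n => listTree n.bits⟩

theorem tcode_pair (x : α) (y : β) : tcode (x, y) = some true :: (tcode x ++ tcode y) := rfl

theorem tcode_cons (x : α) (l : List α) : tcode (x :: l) = some true :: (tcode x ++ tcode l) := rfl

theorem tsize_pair (x : α) (y : β) : tsize (x, y) = tsize x + tsize y + 1 := by
  simp [tsize, tcode_pair]

theorem tsize_nil : tsize ([] : List α) = 1 := rfl

theorem tsize_cons (x : α) (l : List α) : tsize (x :: l) = tsize x + tsize l + 1 := by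
  simp [tsize, tcode_cons]

theorem tsize_nat (n : ℕ) : tsize n = tsize n.bits := rfl

theorem tsize_bool_le (b : Bool) : tsize b ≤ 3 := by
  cases b <;> decide

theorem tsize_bool_pos (b : Bool) : 1 ≤ tsize b := by
  cases b <;> decide

theorem length_lt_tsize (l : List α) : l.length < tsize l := by
  induction l with
  | nil => simp [tsize_nil]
  | cons x l ih =>
    rw [tsize_cons, List.length_cons]
    omega

/-- The `+ 1` is the leaf that ends `l` and disappears in the concatenation. -/
theorem tsize_append (l l' : List α) : tsize (l ++ l') + 1 = tsize l + tsize l' := by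
  induction l with
  | nil => simp [tsize_nil, Nat.add_comm]
  | cons x l ih =>
    rw [List.cons_append, tsize_cons, tsize_cons]
    omega

end TreeData

/-! ### The concrete stacks and the calculus of running times. -/

/-- The stacks that the programs below use besides those of the oracle machine. -/
inductive Reg : Type
  | inp | out | main | aux | ctr
  deriving DecidableEq

instance : Fintype Reg := ⟨{.inp, .out, .main, .aux, .ctr}, by intro x; cases x <;> decide⟩

/-- The alphabets of input and output, and a machine that can be called as an oracle. -/
structure Setting where
  inAlph : Type
  outAlph : Type
  oracle : FinTM2

variable (C : Setting)

/-- The stack alphabets. -/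
abbrev Setting.alph : Reg → Type
  | .inp => C.inAlph
  | .out => C.outAlph
  | .main => Option Bool
  | .aux => Option Bool
  | .ctr => Option Bool

/-- Programs in a given setting. -/
abbrev Setting.Prog : Type := _root_.Prog C.alph C.oracle

/-- The contents of the stacks in a given setting. -/
abbrev Setting.Stacks : Type := _root_.Stacks C.alph C.oracle

variable {C}

/-- `P` turns `S` into `S'` in at most `n` steps. -/
def Runs (P : C.Prog) (n : ℕ) (S S' : C.Stacks) : Prop := ∃ t ≤ n, Run P S t S'

/-- The stacks with given contents of the stacks of the program proper. -/
def regStacks (i : List C.inAlph) (o : List C.outAlph) (a b c : List (Option Bool)) :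
    ∀ k, List (C.alph k)
  | .inp => i
  | .out => o
  | .main => a
  | .aux => b
  | .ctr => c

/-- The stacks with given contents while the oracle machine is idle. -/
def st (i : List C.inAlph) (o : List C.outAlph) (a b c : List (Option Bool)) : C.Stacks :=
  joinStacks (regStacks i o a b c) fun _ => []

theorem Runs.mono {P : C.Prog} {m n : ℕ} {S S' : C.Stacks} (h : Runs P m S S') (hmn : m ≤ n) :
    Runs P n S S' := by
  obtain ⟨t, ht, h⟩ := h
  exact ⟨t, ht.trans hmn, h⟩

theorem Runs.seq {P Q : C.Prog} {m n : ℕ} {S S' S'' : C.Stacks} (h : Runs P m S S')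
    (h' : Runs Q n S' S'') : Runs (.seq P Q) (m + n) S S'' := by
  obtain ⟨t, ht, h⟩ := h
  obtain ⟨t', ht', h'⟩ := h'
  exact ⟨t + t', by omega, h.seq h'⟩

theorem Runs.ite_true {k : Reg ⊕ C.oracle.K} {c} {P Q : C.Prog} {n : ℕ} {S S' : C.Stacks}
    (hc : c (S k).head? = true) (h : Runs P n S S') : Runs (.ite k c P Q) (n + 1) S S' := by
  obtain ⟨t, ht, h⟩ := h
  exact ⟨t + 1, by omega, h.ite_true hc⟩

theorem Runs.ite_false {k : Reg ⊕ C.oracle.K} {c} {P Q : C.Prog} {n : ℕ} {S S' : C.Stacks}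
    (hc : c (S k).head? = false) (h : Runs Q n S S') : Runs (.ite k c P Q) (n + 1) S S' := by
  obtain ⟨t, ht, h⟩ := h
  exact ⟨t + 1, by omega, h.ite_false hc⟩

theorem Runs.loop_false {k : Reg ⊕ C.oracle.K} {c} {P : C.Prog} {S : C.Stacks}
    (hc : c (S k).head? = false) : Runs (.loop k c P) 1 S S :=
  ⟨1, le_rfl, Run.loop_false hc⟩

theorem Runs.loop_true {k : Reg ⊕ C.oracle.K} {c} {P : C.Prog} {m n : ℕ} {S S' S'' : C.Stacks}
    (hc : c (S k).head? = true) (h : Runs P m S S') (h' : Runs (.loop k c P) n S' S'') :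
    Runs (.loop k c P) (m + n + 1) S S'' := by
  obtain ⟨t, ht, h⟩ := h
  obtain ⟨t', ht', h'⟩ := h'
  exact ⟨t + t' + 1, by omega, h.loop_true hc h'⟩

section Basic

variable (i : List C.inAlph) (o : List C.outAlph) (x : Option Bool) (a b c : List (Option Bool))

theorem runs_push_main : Runs (.push (.inl .main) x : C.Prog) 1 (st i o a b c)
    (st i o (x :: a) b c) := by
  refine ⟨1, le_rfl, ?_⟩
  convert Run.push (M := C.oracle) (Γ₀ := C.alph) (.inl .main) x (st i o a b c) using 1
  funext k
  rcases k with (_ | _ | _ | _ | _) | _ <;> rfl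

theorem runs_push_aux : Runs (.push (.inl .aux) x : C.Prog) 1 (st i o a b c)
    (st i o a (x :: b) c) := by
  refine ⟨1, le_rfl, ?_⟩
  convert Run.push (M := C.oracle) (Γ₀ := C.alph) (.inl .aux) x (st i o a b c) using 1
  funext k
  rcases k with (_ | _ | _ | _ | _) | _ <;> rfl

theorem runs_push_ctr : Runs (.push (.inl .ctr) x : C.Prog) 1 (st i o a b c)
    (st i o a b (x :: c)) := by
  refine ⟨1, le_rfl, ?_⟩
  convert Run.push (M := C.oracle) (Γ₀ := C.alph) (.inl .ctr) x (st i o a b c) using 1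
  funext k
  rcases k with (_ | _ | _ | _ | _) | _ <;> rfl

theorem runs_drop_main : Runs (.drop (.inl .main) : C.Prog) 1 (st i o (x :: a) b c)
    (st i o a b c) := by
  refine ⟨1, le_rfl, ?_⟩
  convert Run.drop (M := C.oracle) (Γ₀ := C.alph) (.inl .main) (st i o (x :: a) b c) using 1
  funext k
  rcases k with (_ | _ | _ | _ | _) | _ <;> rfl

theorem runs_drop_aux : Runs (.drop (.inl .aux) : C.Prog) 1 (st i o a (x :: b) c)
    (st i o a b c) := by
  refine ⟨1, le_rfl, ?_⟩
  convert Run.drop (M := C.oracle) (Γ₀ := C.alph) (.inl .aux) (st i o a (x :: b) c) using 1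
  funext k
  rcases k with (_ | _ | _ | _ | _) | _ <;> rfl

theorem runs_drop_ctr : Runs (.drop (.inl .ctr) : C.Prog) 1 (st i o a b (x :: c))
    (st i o a b c) := by
  refine ⟨1, le_rfl, ?_⟩
  convert Run.drop (M := C.oracle) (Γ₀ := C.alph) (.inl .ctr) (st i o a b (x :: c)) using 1
  funext k
  rcases k with (_ | _ | _ | _ | _) | _ <;> rfl

end Basic

/-! ### Moving, dropping and copying trees between stacks. -/

/-- The test for the token that starts a node. -/
def isNode (x : Option (Option Bool)) : Bool := x == some (some true)

/-- The test for a token other than the marker. -/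
def isToken (x : Option (Option Bool)) : Bool := (x == some (some true)) || (x == some (some false))

/-- Move the tree on top of the main stack, reversed, to the auxiliary stack. -/
def moveTree : C.Prog :=
  .seq (.push (.inl .aux) none) <| .seq (.push (.inl .ctr) (some false)) <|
  .seq (.push (.inl .ctr) (some true)) <| .seq
  (.loop (.inl .ctr) isNode <| .ite (.inl .main) isNode
    (.seq (.push (.inl .ctr) (some true)) <| .seq (.push (.inl .aux) (some true))
      (.drop (.inl .main)))
    (.seq (.drop (.inl .ctr)) <| .seq (.push (.inl .aux) (some false)) (.drop (.inl .main))))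
  (.drop (.inl .ctr))

/-- Remove the tree on top of the main stack. -/
def dropTree : C.Prog :=
  .seq (.push (.inl .ctr) (some false)) <| .seq (.push (.inl .ctr) (some true)) <| .seq
  (.loop (.inl .ctr) isNode <| .ite (.inl .main) isNode
    (.seq (.push (.inl .ctr) (some true)) (.drop (.inl .main)))
    (.seq (.drop (.inl .ctr)) (.drop (.inl .main))))
  (.drop (.inl .ctr))

/-- Move a block of tokens from the auxiliary stack back to the main stack. -/
def moveBack : C.Prog :=
  .seq (.loop (.inl .aux) isToken <| .seq
    (.ite (.inl .aux) isNode (.push (.inl .main) (some true)) (.push (.inl .main) (some false)))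
    (.drop (.inl .aux)))
  (.drop (.inl .aux))

/-- Move a block of tokens from the auxiliary stack to the main stack, and copy it to the third
stack. -/
def copyBack : C.Prog :=
  .seq (.push (.inl .ctr) none) <| .seq (.loop (.inl .aux) isToken <| .seq
    (.ite (.inl .aux) isNode
      (.seq (.push (.inl .main) (some true)) (.push (.inl .ctr) (some true)))
      (.seq (.push (.inl .main) (some false)) (.push (.inl .ctr) (some false))))
    (.drop (.inl .aux)))
  (.drop (.inl .aux))

/-- Move a block of tokens from the third stack to the auxiliary stack. -/
def ctrToAux : C.Prog :=
  .seq (.push (.inl .aux) none) <| .seq (.loop (.inl .ctr) isToken <| .seq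
    (.ite (.inl .ctr) isNode (.push (.inl .aux) (some true)) (.push (.inl .aux) (some false)))
    (.drop (.inl .ctr)))
  (.drop (.inl .ctr))

/-- Duplicate the tree on top of the main stack. -/
def dupTree : C.Prog := .seq moveTree <| .seq copyBack <| .seq ctrToAux moveBack

section Basic

variable (i : List C.inAlph) (o : List C.outAlph) (x : Option Bool) (a b c : List (Option Bool))

theorem BinTree.code_ne_marker (t : BinTree) : ∀ x ∈ t.code, ∃ d, x = some d := by
  induction t with
  | leaf => simp [BinTree.code]
  | node l r ihl ihr =>
    intro x hx
    simp only [BinTree.code, List.mem_cons, List.mem_append] at hx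
    rcases hx with rfl | hx | hx
    · exact ⟨_, rfl⟩
    · exact ihl x hx
    · exact ihr x hx

/-- The third stack counts in unary the trees still to be read, above a `some false` that stops the
loop. A node token replaces one expected tree by two, a leaf token uses one up. -/
theorem runs_moveTree (t : BinTree) :
    Runs (moveTree : C.Prog) (5 * t.code.length + 5) (st i o (t.code ++ a) b c)
      (st i o a (t.code.reverse ++ none :: b) c) := by
  refine (((runs_push_aux ..).seq <| (runs_push_ctr ..).seq <| (runs_push_ctr ..).seq <|
    Runs.seq ?_ (runs_drop_ctr _ _ (some false) ..)).mono (m := 1 + (1 + (1 + ((5 * t.code.length + 1) + 1))))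
      (by omega))
  -- An arbitrary rest of the loop, reaching `S` within `n` steps, is carried along, so that the two
  -- subtrees of a node can be chained.
  have key : ∀ (t : BinTree) (a b c : List (Option Bool)) (n : ℕ) (S : C.Stacks),
      Runs (.loop (.inl .ctr) isNode <| .ite (.inl .main) isNode
        (.seq (.push (.inl .ctr) (some true)) <| .seq (.push (.inl .aux) (some true))
          (.drop (.inl .main)))
        (.seq (.drop (.inl .ctr)) <| .seq (.push (.inl .aux) (some false))
          (.drop (.inl .main)))) n (st i o a (t.code.reverse ++ b) c) S →
      Runs (.loop (.inl .ctr) isNode <| .ite (.inl .main) isNode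
        (.seq (.push (.inl .ctr) (some true)) <| .seq (.push (.inl .aux) (some true))
          (.drop (.inl .main)))
        (.seq (.drop (.inl .ctr)) <| .seq (.push (.inl .aux) (some false))
          (.drop (.inl .main)))) (5 * t.code.length + n) (st i o (t.code ++ a) b (some true :: c))
            S := by
    intro t
    induction t with
    | leaf =>
      intro a b c n S h
      refine (Runs.loop_true rfl (Runs.ite_false rfl <| (runs_drop_ctr ..).seq <|
        (runs_push_aux ..).seq <| runs_drop_main ..) h).mono ?_
      simp [BinTree.code]
    | node l r ihl ihr =>
      intro a b c n S h
      have h1 := ihl (r.code ++ a) (some true :: b) (some true :: c) _ _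
        (ihr a (l.code.reverse ++ some true :: b) c n S (by simpa [BinTree.code] using h))
      rw [← List.append_assoc] at h1
      refine (Runs.loop_true rfl (Runs.ite_true rfl <| (runs_push_ctr ..).seq <|
        (runs_push_aux ..).seq <| runs_drop_main ..) h1).mono ?_
      simp [BinTree.code]
      omega
  exact key t a _ _ 1 _ (Runs.loop_false rfl)

theorem runs_dropTree (t : BinTree) :
    Runs (dropTree : C.Prog) (5 * t.code.length + 5) (st i o (t.code ++ a) b c)
      (st i o a b c) := by
  refine (((runs_push_ctr ..).seq <| (runs_push_ctr ..).seq <|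
    Runs.seq ?_ (runs_drop_ctr _ _ (some false) ..)).mono (m := (1 + (1 + ((5 * t.code.length + 1) + 1))))
      (by omega))
  have key : ∀ (t : BinTree) (a c : List (Option Bool)) (n : ℕ) (S : C.Stacks),
      Runs (.loop (.inl .ctr) isNode <| .ite (.inl .main) isNode
        (.seq (.push (.inl .ctr) (some true)) (.drop (.inl .main)))
        (.seq (.drop (.inl .ctr)) (.drop (.inl .main)))) n (st i o a b c) S →
      Runs (.loop (.inl .ctr) isNode <| .ite (.inl .main) isNode
        (.seq (.push (.inl .ctr) (some true)) (.drop (.inl .main)))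
        (.seq (.drop (.inl .ctr)) (.drop (.inl .main)))) (5 * t.code.length + n)
          (st i o (t.code ++ a) b (some true :: c)) S := by
    intro t
    induction t with
    | leaf =>
      intro a c n S h
      refine (Runs.loop_true rfl (Runs.ite_false rfl <| (runs_drop_ctr ..).seq <|
        runs_drop_main ..) h).mono ?_
      simp [BinTree.code]
    | node l r ihl ihr =>
      intro a c n S h
      have h1 := ihl (r.code ++ a) (some true :: c) _ _ (ihr a c n S h)
      rw [← List.append_assoc] at h1
      refine (Runs.loop_true rfl (Runs.ite_true rfl <| (runs_push_ctr ..).seq <|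
        runs_drop_main ..) h1).mono ?_
      simp [BinTree.code]
      omega
  exact key t a _ 1 _ (Runs.loop_false rfl)

theorem runs_moveBack (l : List (Option Bool)) (hl : ∀ x ∈ l, ∃ d, x = some d) :
    Runs (moveBack : C.Prog) (4 * l.length + 2) (st i o a (l ++ none :: b) c)
      (st i o (l.reverse ++ a) b c) := by
  refine (Runs.seq (m := 4 * l.length + 1) ?_ (runs_drop_aux _ _ none ..)).mono (by omega)
  induction l generalizing a with
  | nil => exact Runs.loop_false rfl
  | cons x l ih =>
    obtain ⟨d, rfl⟩ := hl x (by simp)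
    have h := ih (some d :: a) fun x hx => hl x (by simp [hx])
    simp only [List.reverse_cons, List.append_assoc, List.singleton_append]
    cases d
    · refine (Runs.loop_true rfl ((Runs.ite_false rfl (runs_push_main ..)).seq
        (runs_drop_aux ..)) h).mono ?_
      simp
      omega
    · refine (Runs.loop_true rfl ((Runs.ite_true rfl (runs_push_main ..)).seq
        (runs_drop_aux ..)) h).mono ?_
      simp
      omega

theorem runs_ctrToAux (l : List (Option Bool)) (hl : ∀ x ∈ l, ∃ d, x = some d) :
    Runs (ctrToAux : C.Prog) (4 * l.length + 3) (st i o a b (l ++ none :: c))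
      (st i o a (l.reverse ++ none :: b) c) := by
  refine ((runs_push_aux ..).seq <| Runs.seq (m := 4 * l.length + 1) ?_
    (runs_drop_ctr _ _ none ..)).mono (by omega)
  generalize none :: b = b'
  induction l generalizing b' with
  | nil => exact Runs.loop_false rfl
  | cons x l ih =>
    obtain ⟨d, rfl⟩ := hl x (by simp)
    have h := ih (fun x hx => hl x (by simp [hx])) (some d :: b')
    simp only [List.reverse_cons, List.append_assoc, List.singleton_append]
    cases d
    · refine (Runs.loop_true rfl ((Runs.ite_false rfl (runs_push_aux ..)).seq
        (runs_drop_ctr ..)) h).mono ?_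
      simp
      omega
    · refine (Runs.loop_true rfl ((Runs.ite_true rfl (runs_push_aux ..)).seq
        (runs_drop_ctr ..)) h).mono ?_
      simp
      omega

theorem runs_copyBack (l : List (Option Bool)) (hl : ∀ x ∈ l, ∃ d, x = some d) :
    Runs (copyBack : C.Prog) (5 * l.length + 3) (st i o a (l ++ none :: b) c)
      (st i o (l.reverse ++ a) b (l.reverse ++ none :: c)) := by
  refine ((runs_push_ctr ..).seq <| Runs.seq (m := 5 * l.length + 1) ?_
    (runs_drop_aux _ _ none ..)).mono (by omega)
  generalize none :: c = c'
  induction l generalizing a c' with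
  | nil => exact Runs.loop_false rfl
  | cons x l ih =>
    obtain ⟨d, rfl⟩ := hl x (by simp)
    have h := ih (some d :: a) (fun x hx => hl x (by simp [hx])) (some d :: c')
    simp only [List.reverse_cons, List.append_assoc, List.singleton_append]
    cases d
    · refine (Runs.loop_true rfl ((Runs.ite_false rfl ((runs_push_main ..).seq
        (runs_push_ctr ..))).seq (runs_drop_aux ..)) h).mono ?_
      simp
      omega
    · refine (Runs.loop_true rfl ((Runs.ite_true rfl ((runs_push_main ..).seq
        (runs_push_ctr ..))).seq (runs_drop_aux ..)) h).mono ?_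
      simp
      omega

/-- `copyBack` undoes the reversal of `moveTree` on two stacks at once. The copy on the third stack
then travels through the auxiliary one, where two further reversals cancel. -/
theorem runs_dupTree (t : BinTree) :
    Runs (dupTree : C.Prog) (18 * t.code.length + 13) (st i o (t.code ++ a) b c)
      (st i o (t.code ++ (t.code ++ a)) b c) := by
  have h := t.code_ne_marker
  have h' : ∀ x ∈ t.code.reverse, ∃ d, x = some d := by simpa using h
  have h1 := runs_copyBack i o a b c _ h'
  rw [List.reverse_reverse] at h1
  have h2 := runs_moveBack i o (t.code ++ a) b c _ h'
  rw [List.reverse_reverse] at h2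
  refine ((runs_moveTree ..).seq <| h1.seq <| (runs_ctrToAux _ _ _ _ _ _ h).seq h2).mono ?_
  simp
  omega

end Basic

theorem tcode_ne_marker {α : Type} [TreeData α] (x : α) : ∀ y ∈ tcode x, ∃ d, y = some d :=
  BinTree.code_ne_marker _

section Basic

variable {α : Type} [TreeData α] (x : α) (i : List C.inAlph) (o : List C.outAlph)
  (a b c : List (Option Bool))

theorem runs_moveTree_tcode : Runs (moveTree : C.Prog) (5 * tsize x + 5)
    (st i o (tcode x ++ a) b c) (st i o a ((tcode x).reverse ++ none :: b) c) :=
  runs_moveTree ..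

theorem runs_dropTree_tcode : Runs (dropTree : C.Prog) (5 * tsize x + 5)
    (st i o (tcode x ++ a) b c) (st i o a b c) :=
  runs_dropTree ..

theorem runs_dupTree_tcode : Runs (dupTree : C.Prog) (18 * tsize x + 13)
    (st i o (tcode x ++ a) b c) (st i o (tcode x ++ (tcode x ++ a)) b c) :=
  runs_dupTree ..

theorem runs_moveBack_tcode : Runs (moveBack : C.Prog) (4 * tsize x + 2)
    (st i o a ((tcode x).reverse ++ none :: b) c) (st i o (tcode x ++ a) b c) := by
  have h := runs_moveBack i o a b c (tcode x).reverse
    (fun y hy => tcode_ne_marker x y (List.mem_reverse.1 hy))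
  rwa [List.reverse_reverse, List.length_reverse] at h

end Basic

/-! ### Closure properties of the polynomial-time functions. -/

/-- Case distinction on a list. -/
def listElim {β γ : Type} (l : List β) (n : γ) (c : β → List β → γ) : γ :=
  match l with
  | [] => n
  | x :: l => c x l

/-- `f` is computed by a program of polynomial running time that replaces the argument on top of
the main stack by the value, and leaves everything else as it was. -/
@[fun_prop]
def PolyTime (C : Setting) {α β : Type} [TreeData α] [TreeData β] (f : α → β) : Prop :=
  ∃ (P : C.Prog) (p q : Polynomial ℕ), (∀ x, tsize (f x) ≤ q.eval (tsize x)) ∧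
    ∀ x i o a b c, Runs P (p.eval (tsize x)) (st i o (tcode x ++ a) b c)
      (st i o (tcode (f x) ++ a) b c)

namespace PolyTime

variable {α β γ δ : Type} [TreeData α] [TreeData β] [TreeData γ] [TreeData δ]

theorem exists_tsize_le {f : α → β} (hf : PolyTime C f) :
    ∃ q : Polynomial ℕ, ∀ x, tsize (f x) ≤ q.eval (tsize x) := by
  obtain ⟨P, p, q, hq, -⟩ := hf
  exact ⟨q, hq⟩

theorem congr {f g : α → β} (hf : PolyTime C f) (h : ∀ x, f x = g x) : PolyTime C g :=
  (funext h : f = g) ▸ hf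

theorem of_tcode_eq {f : α → β} (h : ∀ x, tcode (f x) = tcode x) : PolyTime C f := by
  -- Pushing and dropping a symbol serves as the empty program.
  refine ⟨.seq (.push (.inl .main) none) (.drop (.inl .main)), 2, .X, fun x => ?_,
    fun x i o a b c => ?_⟩
  · simp [tsize, h]
  · rw [h]
    exact ((runs_push_main ..).seq (runs_drop_main _ _ none ..)).mono (by simp)

@[fun_prop]
theorem id : PolyTime C (fun x : α => x) := of_tcode_eq fun _ => rfl

-- The time for `g` is measured on the intermediate value `f x`; this is why a size bound is part of
-- `PolyTime`.
@[fun_prop]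
theorem comp {g : β → γ} {f : α → β} (hg : PolyTime C g) (hf : PolyTime C f) :
    PolyTime C (fun x => g (f x)) := by
  obtain ⟨P, p, q, hq, hP⟩ := hf
  obtain ⟨P', p', q', hq', hP'⟩ := hg
  refine ⟨.seq P P', p + p'.comp q, q'.comp q, fun x => ?_, fun x i o a b c => ?_⟩
  · rw [Polynomial.eval_comp]
    exact (hq' _).trans (q'.monotone_eval_nat (hq x))
  · refine ((hP x i o a b c).seq (hP' (f x) i o a b c)).mono ?_
    rw [Polynomial.eval_add, Polynomial.eval_comp]
    exact Nat.add_le_add_left (p'.monotone_eval_nat (hq x)) _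

-- The argument is duplicated, and the value of `f` waits on the auxiliary stack while `g` is
-- computed. This is sound because programs leave everything below their argument and on the other
-- stacks as it was.
@[fun_prop]
theorem prodMk {f : α → β} {g : α → γ} (hf : PolyTime C f) (hg : PolyTime C g) :
    PolyTime C (fun x => (f x, g x)) := by
  obtain ⟨P, p, q, hq, hP⟩ := hf
  obtain ⟨P', p', q', hq', hP'⟩ := hg
  refine ⟨.seq dupTree <| .seq P <| .seq moveTree <| .seq P' <| .seq moveBack
    (.push (.inl .main) (some true)), (18 * .X + 13) + (p + ((5 * q + 5) + (p' + ((4 * q + 2) + 1)))),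
    q + q' + 1, fun x => ?_, fun x i o a b c => ?_⟩
  · rw [tsize_pair]
    simpa using Nat.add_le_add (hq x) (hq' x)
  · rw [tcode_pair, List.cons_append, List.append_assoc]
    refine ((runs_dupTree_tcode ..).seq <| (hP x i o (tcode x ++ a) b c).seq <|
      (runs_moveTree_tcode ..).seq <| (hP' x ..).seq <|
      (runs_moveBack_tcode ..).seq (runs_push_main ..)).mono ?_
    have := hq x
    simp
    omega

@[fun_prop]
theorem fst : PolyTime C (fun x : α × β => x.1) := by
  refine ⟨.seq (.drop (.inl .main)) <| .seq moveTree <| .seq dropTree moveBack,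
    1 + ((5 * .X + 5) + ((5 * .X + 5) + (4 * .X + 2))), .X, fun x => ?_, fun x i o a b c => ?_⟩
  · simp [tsize, tcode_pair x.1 x.2]
    omega
  · obtain ⟨x, y⟩ := x
    rw [tcode_pair, List.cons_append, List.append_assoc]
    refine ((runs_drop_main ..).seq <| (runs_moveTree_tcode ..).seq <|
      (runs_dropTree_tcode ..).seq (runs_moveBack_tcode ..)).mono ?_
    simp [tsize_pair]
    omega

@[fun_prop]
theorem snd : PolyTime C (fun x : α × β => x.2) := by
  refine ⟨.seq (.drop (.inl .main)) dropTree,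
    1 + (5 * .X + 5), .X, fun x => ?_, fun x i o a b c => ?_⟩
  · simp [tsize, tcode_pair x.1 x.2]
    omega
  · obtain ⟨x, y⟩ := x
    rw [tcode_pair, List.cons_append, List.append_assoc]
    refine ((runs_drop_main ..).seq (runs_dropTree_tcode ..)).mono ?_
    simp [tsize_pair]
    omega

@[fun_prop]
theorem const (y : β) : PolyTime C (fun _ : α => y) := by
  have key : ∀ l : List (Option Bool), ∃ P : C.Prog, ∀ i o a b c,
      Runs P (l.length + 2) (st i o a b c) (st i o (l ++ a) b c) := by
    intro l
    induction l with
    | nil =>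
      exact ⟨.seq (.push (.inl .main) none) (.drop (.inl .main)), fun i o a b c =>
        (runs_push_main ..).seq (runs_drop_main _ _ none ..)⟩
    | cons x l ih =>
      obtain ⟨P, hP⟩ := ih
      exact ⟨.seq P (.push (.inl .main) x), fun i o a b c =>
        ((hP i o a b c).seq (runs_push_main ..)).mono (by simp)⟩
  obtain ⟨P, hP⟩ := key (tcode y)
  refine ⟨.seq dropTree P, (5 * .X + 5) + .C (tsize y + 2), .C (tsize y), fun x => by simp,
    fun x i o a b c => ?_⟩
  refine ((runs_dropTree i o a b c (TreeData.toTree x)).seq (hP i o a b c)).mono ?_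
  simp [tsize, tcode]

/-- The program that branches on the Boolean on top of the main stack. -/
theorem cond' {f g : α → β} (hf : PolyTime C f) (hg : PolyTime C g) :
    PolyTime C (fun x : Bool × α => if x.1 = true then f x.2 else g x.2) := by
  obtain ⟨P, p, q, hq, hP⟩ := hf
  obtain ⟨P', p', q', hq', hP'⟩ := hg
  refine ⟨.seq (.drop (.inl .main)) <| .ite (.inl .main) isNode
    (.seq (.drop (.inl .main)) <| .seq (.drop (.inl .main)) <| .seq (.drop (.inl .main)) P)
    (.seq (.drop (.inl .main)) P'), p + p' + 5, q + q', fun x => ?_, fun x i o a b c => ?_⟩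
  · have h2 : tsize x.2 ≤ tsize x := (by omega : _ ≤ _ + _ + 1).trans_eq (tsize_pair x.1 x.2).symm
    rw [Polynomial.eval_add]
    dsimp only
    split
    · exact ((hq _).trans (q.monotone_eval_nat h2)).trans (Nat.le_add_right _ _)
    · exact ((hq' _).trans (q'.monotone_eval_nat h2)).trans (Nat.le_add_left _ _)
  · have h2 : tsize x.2 ≤ tsize x := (by omega : _ ≤ _ + _ + 1).trans_eq (tsize_pair x.1 x.2).symm
    have h3 := p.monotone_eval_nat h2
    have h4 := p'.monotone_eval_nat h2
    obtain ⟨d, x⟩ := x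
    cases d
    · refine ((runs_drop_main ..).seq <| Runs.ite_false rfl <| (runs_drop_main ..).seq
        (hP' x i o a b c)).mono ?_
      simp at h3 h4 ⊢
      omega
    · refine ((runs_drop_main ..).seq <| Runs.ite_true rfl <| (runs_drop_main ..).seq <|
        (runs_drop_main ..).seq <| (runs_drop_main ..).seq (hP x i o a b c)).mono ?_
      simp at h3 h4 ⊢
      omega

theorem ite {c : α → Bool} {f g : α → β} (hc : PolyTime C c) (hf : PolyTime C f)
    (hg : PolyTime C g) : PolyTime C (fun x => if c x = true then f x else g x) :=
  (cond' hf hg).comp (hc.prodMk id)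

@[fun_prop]
theorem ite_prop {c : α → Prop} [DecidablePred c] {f g : α → β}
    (hc : PolyTime C (fun x => decide (c x))) (hf : PolyTime C f)
    (hg : PolyTime C g) : PolyTime C (fun x => if c x then f x else g x) :=
  (ite hc hf hg).congr fun x => by simp

/-- The program that branches on the list on top of the main stack. -/
theorem listCase' {f : α → γ} {g : (β × List β) × α → γ} (hf : PolyTime C f)
    (hg : PolyTime C g) :
    PolyTime C (fun x : List β × α => listElim x.1 (f x.2) fun y l => g ((y, l), x.2)) := by
  obtain ⟨P, p, q, hq, hP⟩ := hf
  obtain ⟨P', p', q', hq', hP'⟩ := hg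
  -- Dropping the token of the outer pair exposes the first token of the list. As `y :: l` and `(y,
  -- l)` have the same code, pushing one node token then suffices to form `((y, l), x)`.
  refine ⟨.seq (.drop (.inl .main)) <| .ite (.inl .main) isNode
    (.seq (.push (.inl .main) (some true)) P')
    (.seq (.drop (.inl .main)) P), p + p' + 5, q + q', fun x => ?_, fun x i o a b c => ?_⟩
  · obtain ⟨l, x⟩ := x
    rw [Polynomial.eval_add]
    cases l with
    | nil =>
      refine ((hq x).trans (q.monotone_eval_nat ?_)).trans (Nat.le_add_right _ _)
      rw [tsize_pair]
      omega
    | cons y l =>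
      refine ((hq' _).trans (q'.monotone_eval_nat ?_)).trans (Nat.le_add_left _ _)
      simp only [tsize_pair, tsize_cons]
      omega
  · obtain ⟨l, x⟩ := x
    cases l with
    | nil =>
      refine ((runs_drop_main ..).seq <| Runs.ite_false rfl <| (runs_drop_main ..).seq
        (hP x i o a b c)).mono ?_
      have := p.monotone_eval_nat (show tsize x ≤ tsize (([] : List β), x) by
        rw [tsize_pair]; omega)
      simp at this ⊢
      omega
    | cons y l =>
      refine ((runs_drop_main ..).seq <| Runs.ite_true rfl <| (runs_push_main ..).seq
        (hP' ((y, l), x) i o a b c)).mono ?_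
      have := p'.monotone_eval_nat (show tsize ((y, l), x) ≤ tsize (y :: l, x) by
        simp only [tsize_pair, tsize_cons]; omega)
      simp at this ⊢
      omega

theorem listCase {l : α → List β} {f : α → γ} {g : α → β → List β → γ}
    (hl : PolyTime C l) (hf : PolyTime C f)
    (hg : PolyTime C (fun x : α × β × List β => g x.1 x.2.1 x.2.2)) :
    PolyTime C (fun x => listElim (l x) (f x) (g x)) :=
  (listCase' (g := fun y : (β × List β) × α => g y.2 y.1.1 y.1.2) hf
    (hg.comp (g := fun x : α × β × List β => g x.1 x.2.1 x.2.2)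
      (f := fun y : (β × List β) × α => (y.2, y.1)) (by fun_prop))).comp (hl.prodMk id)

@[fun_prop]
theorem cons {f : α → β} {g : α → List β} (hf : PolyTime C f) (hg : PolyTime C g) :
    PolyTime C (fun x => f x :: g x) :=
  (of_tcode_eq (f := fun x : β × List β => x.1 :: x.2) fun _ => rfl).comp (hf.prodMk hg)

theorem tsize_suffix_le (l₁ l₂ : List α) : tsize l₂ ≤ tsize (l₁ ++ l₂) := by
  have := tsize_append l₁ l₂
  have := length_lt_tsize l₁
  omega

/-- Between iterations the token of the pair is left off, so that the top token tells whether the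
list is empty. The bound `hq` on the states after each prefix bounds the cost of each iteration, and
the size of the list bounds their number. -/
theorem loop {F : List β × δ → List β × δ} {G : δ → β → δ} (hF : PolyTime C F)
    (hFG : ∀ x l s, F (x :: l, s) = (l, G s x)) {start : α → List β × δ}
    (hstart : PolyTime C start) (q : Polynomial ℕ)
    (hq : ∀ x l₁ l₂, (start x).1 = l₁ ++ l₂ →
      tsize (l₁.foldl G (start x).2) ≤ q.eval (tsize x)) :
    PolyTime C (fun x => (start x).1.foldl G (start x).2) := by
  obtain ⟨P, p, r, hr, hP⟩ := hF
  obtain ⟨P', p', r', hr', hP'⟩ := hstart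
  refine ⟨.seq P' <| .seq (.drop (.inl .main)) <| .seq (.loop (.inl .main) isNode <|
    .seq (.push (.inl .main) (some true)) <| .seq P (.drop (.inl .main))) (.drop (.inl .main)),
    p' + (1 + ((r' * (p.comp (r' + q + 1) + 3) + 1) + 1)), q, fun x => hq x _ [] (by simp),
    fun x i o a b c => ?_⟩
  have hlen : (start x).1.length ≤ r'.eval (tsize x) := by
    have h1 := hr' x
    rw [← Prod.mk.eta (p := start x), tsize_pair] at h1
    have h2 := length_lt_tsize (start x).1
    omega
  have hl : tsize (start x).1 ≤ r'.eval (tsize x) := by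
    have h1 := hr' x
    rw [← Prod.mk.eta (p := start x), tsize_pair] at h1
    omega
  set m := p.eval (r'.eval (tsize x) + q.eval (tsize x) + 1) with hm
  have key : ∀ l₁ l₂, (start x).1 = l₁ ++ l₂ →
      Runs (.seq (.loop (.inl .main) isNode <|
        .seq (.push (.inl .main) (some true)) <| .seq P (.drop (.inl .main))) (.drop (.inl .main)))
        ((l₂.length * (m + 3) + 1) + 1)
        (st i o (tcode l₂ ++ (tcode (l₁.foldl G (start x).2) ++ a)) b c)
        (st i o (tcode ((start x).1.foldl G (start x).2) ++ a) b c) := by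
    intro l₁ l₂ h
    refine Runs.seq (S' := st i o (some false ::
      (tcode ((start x).1.foldl G (start x).2) ++ a)) b c) ?_ (runs_drop_main ..)
    induction l₂ generalizing l₁ with
    | nil =>
      simp only [List.append_nil] at h
      subst h
      simp only [List.length_nil, Nat.zero_mul, Nat.zero_add]
      exact Runs.loop_false rfl
    | cons y l₂ ih =>
      have h1 := ih (l₁ ++ [y]) (by simpa using h)
      have h2 := hP (y :: l₂, l₁.foldl G (start x).2) i o a b c
      rw [hFG] at h2
      simp only [tcode_pair, List.cons_append, List.append_assoc] at h2
      rw [List.foldl_append] at h1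
      refine (Runs.loop_true rfl ((runs_push_main ..).seq <| h2.seq (runs_drop_main ..)) h1).mono ?_
      have h3 : tsize (y :: l₂, l₁.foldl G (start x).2) ≤
          r'.eval (tsize x) + q.eval (tsize x) + 1 := by
        rw [tsize_pair]
        have h4 := hq x _ _ h
        have h5 := tsize_suffix_le l₁ (y :: l₂)
        rw [← h] at h5
        omega
      have h6 := p.monotone_eval_nat h3
      simp only [List.length_cons, Nat.succ_mul] at h6 ⊢
      omega
  have h0 := key [] (start x).1 rfl
  have h1 := hP' x i o a b c
  rw [show tcode (start x) = some true :: (tcode (start x).1 ++ tcode (start x).2) from rfl,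
    List.cons_append, List.append_assoc] at h1
  refine (h1.seq <| (runs_drop_main ..).seq h0).mono ?_
  have h2 := Nat.mul_le_mul_right (m + 3) hlen
  rw [hm] at h2
  simp only [Polynomial.eval_add, Polynomial.eval_mul, Polynomial.eval_comp, Polynomial.eval_one,
    Polynomial.eval_ofNat, hm]
  omega

/-- A fold is computable in polynomial time if the step is, and the states that occur are of
polynomial size. -/
theorem foldl {init : α → γ} {lst : α → List β} {step : α → γ → β → γ}
    (hinit : PolyTime C init) (hlst : PolyTime C lst)
    (hstep : PolyTime C (fun x : α × γ × β => step x.1 x.2.1 x.2.2)) (q : Polynomial ℕ)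
    (hq : ∀ x l₁ l₂, lst x = l₁ ++ l₂ →
      tsize (l₁.foldl (step x) (init x)) ≤ q.eval (tsize x)) :
    PolyTime C (fun x => (lst x).foldl (step x) (init x)) := by
  -- The step of `loop` sees only the state, so `x` is made a component of it.
  have hG : ∀ (x : α) (s : γ) (l : List β),
      l.foldl (fun (s : α × γ) y => (s.1, step s.1 s.2 y)) (x, s) = (x, l.foldl (step x) s) := by
    intro x s l
    induction l generalizing s with
    | nil => rfl
    | cons y l ih => exact ih _
  have hF : PolyTime C (fun x : List β × α × γ => listElim x.1 (([] : List β), x.2)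
      fun y l => (l, (x.2.1, step x.2.1 x.2.2 y))) := by
    refine listCase' (C := C) (f := fun x : α × γ => (([] : List β), x))
      (g := fun x : (β × List β) × α × γ => (x.1.2, (x.2.1, step x.2.1 x.2.2 x.1.1)))
      (by fun_prop) (prodMk (by fun_prop) (prodMk (by fun_prop) ?_))
    exact hstep.comp (f := fun x : (β × List β) × α × γ => (x.2.1, x.2.2, x.1.1)) (by fun_prop)
  refine (comp (g := fun x : α × γ => x.2) snd (loop (start := fun x => (lst x, (x, init x)))
    (G := fun s y => (s.1, step s.1 s.2 y))
    hF (fun y l s => rfl) (hlst.prodMk (id.prodMk hinit)) (.X + q + 1) ?_)).congr ?_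
  · intro x l₁ l₂ h
    rw [hG, tsize_pair]
    simpa using hq x l₁ l₂ h
  · intro x
    rw [hG]

/-- A fold is computable in polynomial time if the step is, and adds only a bounded amount to the
size of the state. -/
theorem foldl_of_growth {init : α → γ} {lst : α → List β} {step : α → γ → β → γ}
    (hinit : PolyTime C init) (hlst : PolyTime C lst)
    (hstep : PolyTime C (fun x : α × γ × β => step x.1 x.2.1 x.2.2)) (q : Polynomial ℕ)
    (hq : ∀ x s y, tsize (step x s y) ≤ tsize s + q.eval (tsize x + tsize y)) :
    PolyTime C (fun x => (lst x).foldl (step x) (init x)) := by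
  obtain ⟨r, hr⟩ := hinit.exists_tsize_le
  obtain ⟨r', hr'⟩ := hlst.exists_tsize_le
  refine foldl hinit hlst hstep (r + r' * q.comp (.X + r')) fun x l₁ l₂ h => ?_
  have key : ∀ (l : List β) (s : γ) (m : ℕ), tsize l ≤ m →
      tsize (l.foldl (step x) s) ≤ tsize s + l.length * q.eval (tsize x + m) := by
    intro l
    induction l with
    | nil => intro s m _; simp
    | cons y l ih =>
      intro s m hm
      rw [tsize_cons] at hm
      have h1 := ih (step x s y) m (by omega)
      have h2 := hq x s y
      have h3 := q.monotone_eval_nat (show tsize x + tsize y ≤ tsize x + m by omega)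
      simp only [List.foldl_cons, List.length_cons, Nat.succ_mul] at h1 h3 ⊢
      omega
  have h1 := tsize_append l₁ l₂
  have h2 := length_lt_tsize l₂
  have h3 := hr' x
  have h4 := length_lt_tsize l₁
  rw [h] at h3
  have h5 := key l₁ (init x) (r'.eval (tsize x)) (by omega)
  have h6 := Nat.mul_le_mul_right (q.eval (tsize x + r'.eval (tsize x)))
    (show l₁.length ≤ r'.eval (tsize x) by omega)
  have h7 := hr x
  simp only [Polynomial.eval_add, Polynomial.eval_mul, Polynomial.eval_comp, Polynomial.eval_X]
  omega

end PolyTime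

/-! ### Reading input, writing output and calling the oracle. -/

/-- `F x a` are stacks with contents `x` of the stack `k` and contents `a` of the main stack, the
others being fixed. -/
structure StackView (k : Reg ⊕ C.oracle.K)
    (F : List (Alph C.alph C.oracle k) → List (Option Bool) → C.Stacks) : Prop where
  get_main : ∀ x a, F x a (.inl .main) = a
  get_stack : ∀ x a, F x a k = x
  set_main : ∀ x a (a' : List (Option Bool)), Function.update (F x a) (.inl .main) a' = F x a'
  set_stack : ∀ x a x', Function.update (F x a) k x' = F x' a

namespace StackView

variable {k : Reg ⊕ C.oracle.K}
  {F : List (Alph C.alph C.oracle k) → List (Option Bool) → C.Stacks} (hF : StackView k F)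
include hF

theorem push_main (x a) (d : Option Bool) :
    Runs (.push (.inl .main) d : C.Prog) 1 (F x a) (F x (d :: a)) := by
  refine ⟨1, le_rfl, ?_⟩
  have h := Run.push (M := C.oracle) (Γ₀ := C.alph) (.inl .main) d (F x a)
  rwa [hF.get_main, hF.set_main] at h

theorem drop_main (x a) (d : Option Bool) :
    Runs (.drop (.inl .main) : C.Prog) 1 (F x (d :: a)) (F x a) := by
  refine ⟨1, le_rfl, ?_⟩
  have h := Run.drop (M := C.oracle) (Γ₀ := C.alph) (.inl .main) (F x (d :: a))
  rwa [hF.get_main, hF.set_main] at h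

theorem push_stack (x a) (d : Alph C.alph C.oracle k) :
    Runs (.push k d : C.Prog) 1 (F x a) (F (d :: x) a) := by
  refine ⟨1, le_rfl, ?_⟩
  have h := Run.push (M := C.oracle) (Γ₀ := C.alph) k d (F x a)
  rwa [hF.get_stack, hF.set_stack] at h

theorem drop_stack (x a) (d : Alph C.alph C.oracle k) :
    Runs (.drop k : C.Prog) 1 (F (d :: x) a) (F x a) := by
  refine ⟨1, le_rfl, ?_⟩
  have h := Run.drop (M := C.oracle) (Γ₀ := C.alph) k (F (d :: x) a)
  rwa [hF.get_stack, hF.set_stack] at h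

end StackView

theorem stackView_inp (o : List C.outAlph) (b c : List (Option Bool)) :
    StackView (C := C) (.inl .inp) (fun x a => st x o a b c) where
  get_main _ _ := rfl
  get_stack _ _ := rfl
  set_main _ _ _ := by
    funext k
    rcases k with (_ | _ | _ | _ | _) | _ <;> rfl
  set_stack _ _ _ := by
    funext k
    rcases k with (_ | _ | _ | _ | _) | _ <;> rfl

theorem stackView_out (i : List C.inAlph) (b c : List (Option Bool)) :
    StackView (C := C) (.inl .out) (fun x a => st i x a b c) where
  get_main _ _ := rfl
  get_stack _ _ := rfl
  set_main _ _ _ := by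
    funext k
    rcases k with (_ | _ | _ | _ | _) | _ <;> rfl
  set_stack _ _ _ := by
    funext k
    rcases k with (_ | _ | _ | _ | _) | _ <;> rfl

theorem stackView_oracle (k : C.oracle.K) (i : List C.inAlph) (o : List C.outAlph)
    (b c : List (Option Bool)) :
    StackView (C := C) (.inr k)
      (fun x a => joinStacks (regStacks i o a b c) (Function.update (fun _ => []) k x)) where
  get_main _ _ := rfl
  get_stack x _ := Function.update_self (β := fun k => List (C.oracle.Γ k)) k x fun _ => []
  set_main _ _ _ := by
    funext k
    rcases k with (_ | _ | _ | _ | _) | _ <;> rfl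
  set_stack x a x' := by
    rw [joinStacks_update_inr, Function.update_idem]

section Transfer

variable (k : Reg ⊕ C.oracle.K)

/-- Pop a Boolean from the main stack and push the corresponding symbol. -/
def pourBool (φ : Bool → Alph C.alph C.oracle k) : C.Prog :=
  .ite (.inl .main) isNode
    (.seq (.drop (.inl .main)) <| .seq (.drop (.inl .main)) <| .seq (.drop (.inl .main))
      (.push k (φ true)))
    (.seq (.drop (.inl .main)) (.push k (φ false)))

/-- Move a list of pairs of Booleans from the main stack to the stack `k`. -/
def pour (φ : Bool → Bool → Alph C.alph C.oracle k) : C.Prog :=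
  .seq (.loop (.inl .main) isNode <| .seq (.drop (.inl .main)) <| .seq (.drop (.inl .main)) <|
    .ite (.inl .main) isNode
      (.seq (.drop (.inl .main)) <| .seq (.drop (.inl .main)) <| .seq (.drop (.inl .main)) <|
        pourBool k (φ true))
      (.seq (.drop (.inl .main)) <| pourBool k (φ false)))
  (.drop (.inl .main))

/-- Push a Boolean that depends on the top of the stack `k` to the main stack. -/
def scoopBool (κ : Alph C.alph C.oracle k → Bool) : C.Prog :=
  .ite k (fun y => y.any κ)
    (.seq (.push (.inl .main) (some false)) <| .seq (.push (.inl .main) (some false))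
      (.push (.inl .main) (some true)))
    (.push (.inl .main) (some false))

/-- Move the contents of the stack `k` to a list of pairs of Booleans on the main stack. -/
def scoop (κ : Alph C.alph C.oracle k → Bool × Bool) : C.Prog :=
  .seq (.push (.inl .main) (some false)) <| .loop k Option.isSome <|
    .seq (scoopBool k fun y => (κ y).2) <| .seq (scoopBool k fun y => (κ y).1) <|
    .seq (.push (.inl .main) (some true)) <| .seq (.drop k) (.push (.inl .main) (some true))

variable {k} {F : List (Alph C.alph C.oracle k) → List (Option Bool) → C.Stacks}

theorem runs_pourBool (hF : StackView k F) (φ : Bool → Alph C.alph C.oracle k) (d : Bool) (x a) :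
    Runs (pourBool k φ) 5 (F x (tcode d ++ a)) (F (φ d :: x) a) := by
  cases d
  · refine (Runs.ite_false ?_ <| (hF.drop_main ..).seq (hF.push_stack ..)).mono (by simp)
    rw [hF.get_main]
    rfl
  · refine (Runs.ite_true ?_ <| (hF.drop_main ..).seq <| (hF.drop_main ..).seq <|
      (hF.drop_main ..).seq (hF.push_stack ..)).mono (by simp)
    rw [hF.get_main]
    rfl

theorem runs_pour (hF : StackView k F) (φ : Bool → Bool → Alph C.alph C.oracle k)
    (l : List (Bool × Bool)) (x a) :
    Runs (pour k φ) (12 * l.length + 2) (F x (tcode l ++ a))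
      (F ((l.map fun d => φ d.1 d.2).reverse ++ x) a) := by
  refine (Runs.seq (m := 12 * l.length + 1) ?_ (hF.drop_main _ _ (some false))).mono (by simp)
  induction l generalizing x with
  | nil => exact Runs.loop_false (by rw [hF.get_main]; rfl)
  | cons d l ih =>
    have h := ih (φ d.1 d.2 :: x)
    simp only [List.map_cons, List.reverse_cons, List.append_assoc, List.singleton_append]
    obtain ⟨d, d'⟩ := d
    simp only [tcode_cons, tcode_pair, List.cons_append, List.append_assoc]
    refine (Runs.loop_true (by rw [hF.get_main]; rfl) ((hF.drop_main ..).seq <|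
      (hF.drop_main ..).seq ?_) h).mono (m := 1 + (1 + 9) + (12 * l.length + 1) + 1)
        (by simp; omega)
    cases d
    · exact ((Runs.ite_false (by rw [hF.get_main]; rfl) <| (hF.drop_main ..).seq
        (runs_pourBool hF (φ false) d' _ _))).mono (by simp)
    · exact ((Runs.ite_true (by rw [hF.get_main]; rfl) <| (hF.drop_main ..).seq <|
        (hF.drop_main ..).seq <| (hF.drop_main ..).seq
        (runs_pourBool hF (φ true) d' _ _))).mono (by simp)

theorem runs_scoopBool (hF : StackView k F) (κ : Alph C.alph C.oracle k → Bool) (y x a) :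
    Runs (scoopBool k κ) 4 (F (y :: x) a) (F (y :: x) (tcode (κ y) ++ a)) := by
  cases h : κ y
  · refine (Runs.ite_false ?_ (hF.push_main ..)).mono (by simp)
    rw [hF.get_stack]
    exact h
  · refine (Runs.ite_true ?_ <| (hF.push_main ..).seq <| (hF.push_main ..).seq
      (hF.push_main ..)).mono (by simp)
    rw [hF.get_stack]
    exact h

theorem runs_scoop (hF : StackView k F) (κ : Alph C.alph C.oracle k → Bool × Bool) (x a) :
    Runs (scoop k κ) (12 * x.length + 2) (F x a) (F [] (tcode (x.map κ).reverse ++ a)) := by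
  have key : ∀ (x : List (Alph C.alph C.oracle k)) (l : List (Bool × Bool)),
      Runs (.loop k Option.isSome <| .seq (scoopBool k fun y => (κ y).2) <|
        .seq (scoopBool k fun y => (κ y).1) <| .seq (.push (.inl .main) (some true)) <|
        .seq (.drop k) (.push (.inl .main) (some true))) (12 * x.length + 1)
        (F x (tcode l ++ a)) (F [] (tcode ((x.map κ).reverse ++ l) ++ a)) := by
    intro x
    induction x with
    | nil => exact fun l => Runs.loop_false (by rw [hF.get_stack]; rfl)
    | cons y x ih =>
      intro l
      have h := ih (κ y :: l)
      simp only [List.map_cons, List.reverse_cons, List.append_assoc, List.singleton_append]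
      refine (Runs.loop_true (by rw [hF.get_stack]; rfl) ((runs_scoopBool hF _ y x _).seq <|
        (runs_scoopBool hF _ y x _).seq <| (hF.push_main ..).seq <| (hF.drop_stack ..).seq ?_)
        h).mono (m := 4 + (4 + (1 + (1 + 1))) + (12 * x.length + 1) + 1) (by simp; omega)
      rw [tcode_cons, show tcode (κ y) = some true :: (tcode (κ y).1 ++ tcode (κ y).2) from rfl]
      simp only [List.cons_append, List.append_assoc]
      exact hF.push_main ..
  have h := key x []
  rw [List.append_nil] at h
  exact ((hF.push_main ..).seq h).mono (by omega)

end Transfer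

theorem tsize_pairs_le (l : List (Bool × Bool)) : tsize l ≤ 8 * l.length + 1 := by
  induction l with
  | nil => exact le_rfl
  | cons d l ih =>
    have h1 := tsize_bool_le d.1
    have h2 := tsize_bool_le d.2
    rw [tsize_cons, ← Prod.mk.eta (p := d), tsize_pair, List.length_cons]
    omega

theorem initList_stk (M : FinTM2) (s : List (M.Γ M.k₀)) :
    (initList M s).stk = Function.update (fun _ => []) M.k₀ s := by
  funext k
  by_cases h : k = M.k₀
  · subst h
    exact (dif_pos rfl).trans (Function.update_self M.k₀ s fun _ => []).symm
  · exact (dif_neg h).trans (Function.update_of_ne h s fun _ => []).symm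

theorem haltList_stk (M : FinTM2) (s : List (M.Γ M.k₁)) :
    (haltList M s).stk = Function.update (fun _ => []) M.k₁ s := by
  funext k
  by_cases h : k = M.k₁
  · subst h
    exact (dif_pos rfl).trans (Function.update_self M.k₁ s fun _ => []).symm
  · exact (dif_neg h).trans (Function.update_of_ne h s fun _ => []).symm

/-- Pairs of Booleans are the common format in which letters of all alphabets reach the main stack;
here the second component is idle. The reversals come from `pour` and `scoop`, which empty one stack
onto another. -/
theorem PolyTime.oracle_pairs {A B : Type} {f : List Bool → List Bool}
    (h : TM2ComputableInPolyTime (_root_.id : List Bool → List Bool)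
      (_root_.id : List Bool → List Bool) f) :
    PolyTime ⟨A, B, h.tm⟩ fun l : List (Bool × Bool) =>
      ((f (l.map Prod.fst).reverse).map fun b => (b, false)).reverse := by
  have hlen : ∀ w, (f w).length ≤ w.length + h.time.eval w.length * FinTM2.maxPush h.tm := by
    intro w
    obtain ⟨⟨t, ht⟩, htm⟩ := h.outputsFun w
    have h1 := length_le_of_reachIn h.tm h.tm.k₁ t _ _ ht
    rw [haltList_stk, initList_stk, Function.update_self] at h1
    simp only [_root_.id, List.length_map] at h1
    refine h1.trans (Nat.add_le_add ?_ (Nat.mul_le_mul_right _ htm))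
    -- If the output stack is also the input stack, it starts with the input and not empty.
    by_cases hk : h.tm.k₁ = h.tm.k₀
    · generalize h.tm.k₁ = k at hk
      subst hk
      rw [Function.update_self]
      simp
    · rw [Function.update_of_ne hk]
      simp
  set r : Polynomial ℕ := .X + h.time * .C (FinTM2.maxPush h.tm) with hr
  have hlen' : ∀ l : List (Bool × Bool), (f (l.map Prod.fst).reverse).length ≤
      r.eval (tsize l) := by
    intro l
    have h1 := hlen (l.map Prod.fst).reverse
    rw [List.length_reverse, List.length_map] at h1
    have h2 := (length_lt_tsize l).le
    have h3 := h.time.monotone_eval_nat h2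
    refine h1.trans ?_
    simp only [hr, Polynomial.eval_add, Polynomial.eval_mul, Polynomial.eval_X, Polynomial.eval_C]
    exact Nat.add_le_add h2 (Nat.mul_le_mul_right _ h3)
  refine ⟨.seq (pour (.inr h.tm.k₀) fun b _ => h.inputAlphabet.invFun b) <| .seq .call
    (scoop (.inr h.tm.k₁) fun y => (h.outputAlphabet.toFun y, false)),
    (12 * .X + 2) + (h.time + (12 * r + 2)), 8 * r + 1, fun l => ?_, fun l i o a b c => ?_⟩
  · refine (tsize_pairs_le _).trans ?_
    have := hlen' l
    simp
    omega
  · obtain ⟨⟨t, ht⟩, htm⟩ := h.outputsFun (l.map Prod.fst).reverse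
    have hcall : Runs (C := ⟨A, B, h.tm⟩) .call (h.time.eval (tsize l))
        (joinStacks (regStacks i o a b c) (Function.update (fun _ => []) h.tm.k₀
          ((l.map fun d => h.inputAlphabet.invFun d.1).reverse ++ [])))
        (joinStacks (regStacks i o a b c) (Function.update (fun _ => []) h.tm.k₁
          ((f (l.map Prod.fst).reverse).map h.outputAlphabet.invFun))) := by
      refine ⟨t, ?_, Run.call ?_⟩
      · refine htm.trans (h.time.monotone_eval_nat ?_)
        simpa using (length_lt_tsize l).le
      · rw [List.append_nil, ← haltList_stk, ← List.map_reverse,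
          show (fun d : Bool × Bool => h.inputAlphabet.invFun d.1) =
            h.inputAlphabet.invFun ∘ Prod.fst from rfl, ← List.map_map, ← initList_stk,
            List.map_reverse]
        exact ht
    have hpour := runs_pour (stackView_oracle (C := ⟨A, B, h.tm⟩) h.tm.k₀ i o b c)
      (fun b _ => h.inputAlphabet.invFun b) l [] a
    have hscoop := runs_scoop (stackView_oracle (C := ⟨A, B, h.tm⟩) h.tm.k₁ i o b c)
      (fun y => (h.outputAlphabet.toFun y, false))
      ((f (l.map Prod.fst).reverse).map h.outputAlphabet.invFun) a
    have hidle : ∀ (k : h.tm.K) (a : List (Option Bool)),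
        (joinStacks (regStacks (C := ⟨A, B, h.tm⟩) i o a b c)
          (Function.update (fun _ => []) k []) : Setting.Stacks ⟨A, B, h.tm⟩) = st i o a b c := by
      intro k a
      rw [st, Function.update_eq_self_iff.2 rfl]
    simp only [hidle] at hpour hscoop
    rw [List.map_map] at hscoop
    have hid : (fun y => (h.outputAlphabet.toFun y, false)) ∘ h.outputAlphabet.invFun =
        fun b => (b, false) := by
      funext b
      simp
    rw [hid] at hscoop
    refine (hpour.seq (hcall.seq hscoop)).mono ?_
    have h1 := hlen' l
    have h2 := length_lt_tsize l
    simp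
    omega

theorem PolyTime.nonempty_tm2ComputableInPolyTime {C : Setting} [Fintype C.inAlph] {α β : Type}
    {ea : α → List C.inAlph} {eb : β → List C.outAlph} {f : α → β}
    {g : List (Bool × Bool) → List (Bool × Bool)} (hg : PolyTime C g)
    (κ : C.inAlph → Bool × Bool) (φ : Bool → Bool → C.outAlph)
    (hf : ∀ x, ((g ((ea x).map κ).reverse).map fun d => φ d.1 d.2).reverse = eb (f x)) :
    Nonempty (TM2ComputableInPolyTime ea eb f) := by
  obtain ⟨P, p, q, hq, hP⟩ := hg
  have : Fintype (C.alph .inp) := inferInstanceAs (Fintype C.inAlph)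
  have key : ∀ x, Nonempty (TM2OutputsInTime
      ((.seq (scoop (.inl .inp) κ) (.seq P (pour (.inl .out) φ)) : C.Prog).machine .inp .out)
      (ea x) (some (eb (f x)))
      (((12 * .X + 2) + (p.comp (8 * .X + 1) + (12 * q.comp (8 * .X + 1) + 2)) + 1 :
        Polynomial ℕ).eval (ea x).length)) := by
    intro x
    have h1 := runs_scoop (stackView_inp (C := C) [] [] []) κ (ea x) []
    have h2 := hP ((ea x).map κ).reverse [] [] [] [] []
    have h3 := runs_pour (stackView_out (C := C) [] [] []) φ (g ((ea x).map κ).reverse) [] []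
    rw [hf, List.append_nil (eb (f x))] at h3
    obtain ⟨t, ht, h⟩ := h1.seq (h2.seq h3)
    have hs : ∀ l, (singleStack (M := C.oracle) (Γ₀ := C.alph) .inp l) = st l [] [] [] [] := by
      intro l
      funext k
      rcases k with (_ | _ | _ | _ | _) | _ <;> rfl
    have hs' : ∀ l, (singleStack (M := C.oracle) (Γ₀ := C.alph) .out l) = st [] l [] [] [] := by
      intro l
      funext k
      rcases k with (_ | _ | _ | _ | _) | _ <;> rfl
    refine Run.nonempty_outputsInTime (t := t) (by rw [hs, hs']; exact h) ?_
    have h4 : tsize ((ea x).map κ).reverse ≤ 8 * (ea x).length + 1 := by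
      simpa using tsize_pairs_le ((ea x).map κ).reverse
    have h5 := p.monotone_eval_nat h4
    have h6 := (hq ((ea x).map κ).reverse).trans (q.monotone_eval_nat h4)
    have h7 := length_lt_tsize (g ((ea x).map κ).reverse)
    simp at h5 h6 ⊢
    omega
  exact ⟨{
    tm := (.seq (scoop (.inl .inp) κ) (.seq P (pour (.inl .out) φ)) : C.Prog).machine .inp .out
    inputAlphabet := Equiv.refl _
    outputAlphabet := Equiv.refl _
    time := (12 * .X + 2) + (p.comp (8 * .X + 1) + (12 * q.comp (8 * .X + 1) + 2)) + 1
    outputsFun := fun x => by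
      have h := (key x).some
      have e1 : List.map (Equiv.refl (C.alph .inp)).invFun (ea x) = ea x := List.map_id _
      have e2 : List.map (Equiv.refl (C.alph .out)).invFun (eb (f x)) = eb (f x) := List.map_id _
      exact (congrArg₂ (fun l l' => TM2OutputsInTime _ l (some l') _) e1 e2).mpr h }⟩

/-! ### Binary arithmetic in polynomial time. -/

/-- The number whose binary digits, most significant first, are `l`. -/
def bitsVal (l : List Bool) : ℕ := l.foldl (fun n b => Nat.bit b n) 0

theorem bitsVal_append_singleton (l : List Bool) (b : Bool) :
    bitsVal (l ++ [b]) = Nat.bit b (bitsVal l) := by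
  simp [bitsVal]

theorem bitsVal_cons (b : Bool) (l : List Bool) :
    bitsVal (b :: l) = b.toNat * 2 ^ l.length + bitsVal l := by
  induction l using List.reverseRecOn with
  | nil => cases b <;> rfl
  | append_singleton l c ih =>
    rw [← List.cons_append, bitsVal_append_singleton, bitsVal_append_singleton, ih]
    simp only [Nat.bit_val, List.length_append, List.length_singleton, pow_succ]
    ring

theorem bitsVal_lt (l : List Bool) : bitsVal l < 2 ^ l.length := by
  induction l with
  | nil => simp [bitsVal]
  | cons b l ih =>
    rw [bitsVal_cons, List.length_cons, pow_succ]
    have : b.toNat ≤ 1 := Bool.toNat_le b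
    nlinarith

theorem bitsVal_reverse_bits (n : ℕ) : bitsVal n.bits.reverse = n := by
  induction n using Nat.binaryRec' with
  | zero => simp [bitsVal]
  | bit b n h ih => rw [Nat.bits_append_bit _ _ h, List.reverse_cons, bitsVal_append_singleton, ih]

theorem eq_zero_of_bits_eq_nil {n : ℕ} (h : n.bits = []) : n = 0 := by
  rw [← bitsVal_reverse_bits n, h]
  rfl

namespace PolyTime

variable {α β γ δ : Type} [TreeData α] [TreeData β] [TreeData γ] [TreeData δ]

theorem of_bool (f : Bool → β) {a : α → Bool} (ha : PolyTime C a) :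
    PolyTime C (fun x => f (a x)) :=
  (ite ha (const (f true)) (const (f false))).congr fun x => by cases a x <;> rfl

theorem of_bool₂ (f : Bool → Bool → β) {a b : α → Bool} (ha : PolyTime C a) (hb : PolyTime C b) :
    PolyTime C (fun x => f (a x) (b x)) :=
  (ite ha (of_bool (f true) hb) (of_bool (f false) hb)).congr fun x => by cases a x <;> rfl

theorem of_bool₃ (f : Bool → Bool → Bool → β) {a b c : α → Bool} (ha : PolyTime C a)
    (hb : PolyTime C b) (hc : PolyTime C c) : PolyTime C (fun x => f (a x) (b x) (c x)) :=
  (ite ha (of_bool₂ (f true) hb hc) (of_bool₂ (f false) hb hc)).congr fun x => by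
    cases a x <;> rfl

@[fun_prop]
theorem decide_and {p q : α → Prop} [DecidablePred p] [DecidablePred q]
    (hp : PolyTime C fun x => decide (p x)) (hq : PolyTime C fun x => decide (q x)) :
    PolyTime C fun x => decide (p x ∧ q x) :=
  (of_bool₂ and hp hq).congr fun x => by simp

@[fun_prop]
theorem decide_not {p : α → Prop} [DecidablePred p]
    (hp : PolyTime C fun x => decide (p x)) : PolyTime C fun x => decide (¬ p x) :=
  (of_bool not hp).congr fun x => by simp

@[fun_prop]
theorem decide_eq_true {f : α → Bool} (hf : PolyTime C f) :
    PolyTime C fun x => decide (f x = true) :=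
  hf.congr fun x => by simp

theorem listTail {f : α → List β} (hf : PolyTime C f) : PolyTime C fun x => (f x).tail :=
  (listCase (f := fun _ => []) (g := fun _ _ l => l) hf (by fun_prop) (by fun_prop)).congr
    fun x => by cases f x <;> rfl

theorem listReverse {f : α → List β} (hf : PolyTime C f) : PolyTime C fun x => (f x).reverse := by
  refine (foldl_of_growth (init := fun _ => []) (step := fun _ acc y => y :: acc) (by fun_prop) hf
    (by fun_prop) (.X + 1) ?_).congr fun x => ?_
  · intro x s y
    rw [tsize_cons]
    simp
    omega
  · have : ∀ l acc : List β, l.foldl (fun acc y => y :: acc) acc = l.reverse ++ acc := by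
      intro l
      induction l with
      | nil => simp
      | cons y l ih => simp [ih]
    rw [this, List.append_nil]

attribute [fun_prop] listTail listReverse

@[fun_prop]
theorem listAppend {f g : α → List β} (hf : PolyTime C f) (hg : PolyTime C g) :
    PolyTime C fun x => f x ++ g x := by
  refine (foldl_of_growth (step := fun _ acc y => y :: acc) hg hf.listReverse
    (by fun_prop) (.X + 1) ?_).congr fun x => ?_
  · intro x s y
    rw [tsize_cons]
    simp
    omega
  · simp

theorem of_bits {f : α → ℕ} (hf : PolyTime C fun x => (f x).bits) : PolyTime C f := hf

@[fun_prop]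
theorem natBits {f : α → ℕ} (hf : PolyTime C f) : PolyTime C fun x => (f x).bits := hf

-- `Nat.bit false 0` is `0` with an empty list of bits, so a digit `false` may be put in front of a
-- nonempty list only.
@[fun_prop]
theorem natBit {f : α → Bool} {g : α → ℕ} (hf : PolyTime C f) (hg : PolyTime C g) :
    PolyTime C fun x => Nat.bit (f x) (g x) := by
  refine of_bits <| (listCase (f := fun x => if f x = true then [true] else [])
    (g := fun x y l => f x :: y :: l) hg.natBits (by fun_prop) ?_).congr ?_
  · exact (hf.comp fst).cons (by fun_prop)
  · intro x
    rcases Nat.eq_zero_or_pos (g x) with h | h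
    · rw [h]
      cases f x <;> rfl
    · rw [Nat.bits_append_bit _ _ (fun h' => by omega)]
      cases h' : (g x).bits with
      | nil =>
        exact absurd (eq_zero_of_bits_eq_nil h') h.ne'
      | cons y l => rfl

@[fun_prop]
theorem natDiv2 {f : α → ℕ} (hf : PolyTime C f) : PolyTime C fun x => (f x).div2 :=
  of_bits <| hf.natBits.listTail.congr fun x => by rw [Nat.div2_bits_eq_tail]

@[fun_prop]
theorem natBodd {f : α → ℕ} (hf : PolyTime C f) : PolyTime C fun x => (f x).bodd :=
  (listCase (f := fun _ => false) (g := fun _ y _ => y) hf.natBits (by fun_prop)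
    (by fun_prop)).congr fun x => by
      rw [Nat.bodd_eq_bits_head]
      cases (f x).bits <;> rfl

@[fun_prop]
theorem natEqZero {f : α → ℕ} (hf : PolyTime C f) : PolyTime C fun x => decide (f x = 0) :=
  (listCase (f := fun _ => true) (g := fun _ _ _ => false) hf.natBits (by fun_prop)
    (by fun_prop)).congr fun x => by
      cases h : (f x).bits with
      | nil =>
        have := eq_zero_of_bits_eq_nil h
        simp [listElim, this]
      | cons y l =>
        have : f x ≠ 0 := fun h' => by simp [h'] at h
        simp [listElim, this]

end PolyTime

theorem tsize_le_of_lt_two_pow {n k : ℕ} (h : n < 2 ^ k) : tsize n ≤ 4 * k + 1 := by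
  have h1 : ∀ l : List Bool, tsize l ≤ 4 * l.length + 1 := by
    intro l
    induction l with
    | nil => exact le_rfl
    | cons b l ih =>
      have := tsize_bool_le b
      rw [tsize_cons, List.length_cons]
      omega
  have h2 := h1 n.bits
  rw [Nat.size_eq_bits_len] at h2
  have h3 := Nat.size_le.2 h
  rw [tsize_nat]
  omega

theorem lt_two_pow_tsize (n : ℕ) : n < 2 ^ tsize n := by
  refine Nat.size_le.1 ?_
  rw [← Nat.size_eq_bits_len, tsize_nat]
  exact (length_lt_tsize _).le

theorem tsize_bit_le (b : Bool) (n : ℕ) : tsize (Nat.bit b n) ≤ tsize n + tsize b + 1 := by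
  by_cases h : n = 0 → b = true
  · rw [tsize_nat, Nat.bits_append_bit _ _ h, tsize_cons, tsize_nat]
    omega
  · push Not at h
    rw [h.1]
    have h2 : b = false := by simpa using h.2
    subst h2
    decide

theorem tsize_div2_le (n : ℕ) : tsize n.div2 ≤ tsize n := by
  rw [tsize_nat, Nat.div2_bits_eq_tail, tsize_nat]
  cases n.bits with
  | nil => exact le_rfl
  | cons b l =>
    rw [tsize_cons, List.tail_cons]
    omega

/-- One step of an addition or subtraction with carry, given by its digit function. -/
def carryStep (d : Bool → Bool → Bool → Bool × Bool) (s : (ℕ × ℕ) × Bool × List Bool) :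
    (ℕ × ℕ) × Bool × List Bool :=
  ((s.1.1.div2, s.1.2.div2), (d s.1.1.bodd s.1.2.bodd s.2.1).2,
    (d s.1.1.bodd s.1.2.bodd s.2.1).1 :: s.2.2)

/-- Addition or subtraction of two numbers with carry. -/
def carryLoop (d : Bool → Bool → Bool → Bool × Bool) (a b : ℕ) : (ℕ × ℕ) × Bool × List Bool :=
  (a.bits ++ b.bits ++ [true]).foldl (fun s _ => carryStep d s) ((a, b), false, [])

/-- Sum and carry of three bits. -/
def addDigit (a b c : Bool) : Bool × Bool := (a ^^ b ^^ c, (a && b) || (a && c) || (b && c))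

/-- Difference and borrow of a bit and two bits to be subtracted. -/
def subDigit (a b c : Bool) : Bool × Bool := (a ^^ b ^^ c, (!a && b) || (!a && c) || (b && c))

theorem bodd_toNat_add_two_mul_div2 (n : ℕ) : n.bodd.toNat + 2 * n.div2 = n := by
  have := Nat.bodd_add_div2 n
  exact this

/-- Invariant: the digits already in `acc`, plus what remains to be added, shifted by their number.
The list `l` is only a clock, long enough for the sum to be used up. -/
theorem bitsVal_foldl_addDigit {β : Type} (l : List β) (a b : ℕ) (c : Bool) (acc : List Bool)
    (h : a + b + c.toNat < 2 ^ l.length) :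
    bitsVal (l.foldl (fun s _ => carryStep addDigit s) ((a, b), c, acc)).2.2 =
      2 ^ acc.length * (a + b + c.toNat) + bitsVal acc := by
  induction l generalizing a b c acc with
  | nil =>
    have : a + b + c.toNat = 0 := by simpa using h
    simp [this]
  | cons y l ih =>
    have ha := bodd_toNat_add_two_mul_div2 a
    have hb := bodd_toNat_add_two_mul_div2 b
    have hd : a.bodd.toNat + b.bodd.toNat + c.toNat =
        (addDigit a.bodd b.bodd c).1.toNat + 2 * (addDigit a.bodd b.bodd c).2.toNat := by
      cases a.bodd <;> cases b.bodd <;> cases c <;> rfl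
    rw [List.length_cons, pow_succ] at h
    rw [List.foldl_cons, carryStep, ih _ _ _ _ (by simp only; omega), bitsVal_cons,
      List.length_cons, pow_succ]
    have h2 : a + b + c.toNat = (addDigit a.bodd b.bodd c).1.toNat +
      2 * (a.div2 + b.div2 + (addDigit a.bodd b.bodd c).2.toNat) := by omega
    rw [h2]
    ring

/-- The same invariant over the integers, where a borrow left at the end stands for a power of two
to be subtracted. -/
theorem bitsVal_foldl_subDigit {β : Type} (l : List β) (a b : ℕ) (c : Bool) (acc : List Bool)
    (ha : a < 2 ^ l.length) (hb : b < 2 ^ l.length) :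
    (bitsVal (l.foldl (fun s _ => carryStep subDigit s) ((a, b), c, acc)).2.2 : ℤ) -
      2 ^ (acc.length + l.length) *
        ((l.foldl (fun s _ => carryStep subDigit s) ((a, b), c, acc)).2.1.toNat : ℤ) =
      2 ^ acc.length * ((a : ℤ) - b - c.toNat) + bitsVal acc := by
  induction l generalizing a b c acc with
  | nil =>
    have h1 : a = 0 := by simpa using ha
    have h2 : b = 0 := by simpa using hb
    simp [h1, h2]
    ring
  | cons y l ih =>
    have ha' := bodd_toNat_add_two_mul_div2 a
    have hb' := bodd_toNat_add_two_mul_div2 b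
    have hd : (a.bodd.toNat : ℤ) - b.bodd.toNat - c.toNat =
        (subDigit a.bodd b.bodd c).1.toNat - 2 * (subDigit a.bodd b.bodd c).2.toNat := by
      cases a.bodd <;> cases b.bodd <;> cases c <;> rfl
    rw [List.length_cons, pow_succ] at ha hb
    have h := ih a.div2 b.div2 (subDigit a.bodd b.bodd c).2
      ((subDigit a.bodd b.bodd c).1 :: acc) (by omega) (by omega)
    rw [List.length_cons, bitsVal_cons] at h
    rw [List.length_cons, show acc.length + (l.length + 1) = acc.length + 1 + l.length by ring]
    refine Eq.trans h ?_
    have h2 : (a : ℤ) - b - c.toNat = (subDigit a.bodd b.bodd c).1.toNat +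
      2 * ((a.div2 : ℤ) - b.div2 - (subDigit a.bodd b.bodd c).2.toNat) := by omega
    rw [h2, pow_succ]
    push_cast
    ring

theorem length_carryLoop_acc {β : Type} (d : Bool → Bool → Bool → Bool × Bool) (l : List β)
    (s : (ℕ × ℕ) × Bool × List Bool) :
    (l.foldl (fun s _ => carryStep d s) s).2.2.length = s.2.2.length + l.length := by
  induction l generalizing s with
  | nil => rfl
  | cons y l ih =>
    rw [List.foldl_cons, ih]
    simp [carryStep]
    omega

theorem add_lt_two_pow_bits (a b : ℕ) : a + b < 2 ^ (a.bits ++ b.bits ++ [true]).length := by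
  have h1 := Nat.lt_size_self a
  have h2 := Nat.lt_size_self b
  rw [← Nat.size_eq_bits_len] at h1 h2
  rw [List.length_append, List.length_append, List.length_singleton, pow_succ, pow_add]
  have h3 := Nat.one_le_two_pow (n := a.bits.length)
  have h4 := Nat.one_le_two_pow (n := b.bits.length)
  nlinarith

theorem bitsVal_carryLoop_addDigit (a b : ℕ) : bitsVal (carryLoop addDigit a b).2.2 = a + b := by
  rw [carryLoop, bitsVal_foldl_addDigit _ _ _ _ _ (add_lt_two_pow_bits a b)]
  simp [bitsVal]

/-- With `n` digits of value `v < 2 ^ n` and final borrow `c`, the invariant reads `v - 2 ^ n * c =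
a - b`. Hence `c` is the sign of the difference, and without borrow `v` is the difference. -/
theorem carryLoop_subDigit (a b : ℕ) :
    (carryLoop subDigit a b).2.1 = decide (a < b) ∧
      (b ≤ a → bitsVal (carryLoop subDigit a b).2.2 = a - b) := by
  have h := add_lt_two_pow_bits a b
  have h1 := bitsVal_foldl_subDigit (a.bits ++ b.bits ++ [true]) a b false [] (by omega) (by omega)
  have h2 := bitsVal_lt (carryLoop subDigit a b).2.2
  rw [carryLoop, length_carryLoop_acc] at h2
  rw [← carryLoop] at h1 h2
  simp only [List.length_nil, Nat.zero_add, pow_zero, one_mul] at h1 h2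
  generalize (a.bits ++ b.bits ++ [true]).length = n at *
  generalize bitsVal (carryLoop subDigit a b).2.2 = v at *
  have h3 : bitsVal [] = 0 := rfl
  rw [h3] at h1
  zify at h h2
  generalize (carryLoop subDigit a b).2.1 = c at *
  cases c with
  | false =>
    simp at h1
    have : ¬ a < b := by omega
    simp [this]
    omega
  | true =>
    simp at h1
    have : a < b := by omega
    simp [this]

namespace PolyTime

variable {α β γ δ : Type} [TreeData α] [TreeData β] [TreeData γ] [TreeData δ]

@[fun_prop]
theorem bitsVal {f : α → List Bool} (hf : PolyTime C f) : PolyTime C fun x => bitsVal (f x) := by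
  refine foldl_of_growth (init := fun _ => 0) (step := fun _ n b => Nat.bit b n) (by fun_prop) hf
    (by fun_prop) (.X + 1) fun x s y => ?_
  have := tsize_bit_le y s
  simp
  omega

theorem carryLoop (d : Bool → Bool → Bool → Bool × Bool) {f g : α → ℕ} (hf : PolyTime C f)
    (hg : PolyTime C g) : PolyTime C fun x => carryLoop d (f x) (g x) := by
  have hd : PolyTime C fun s : (ℕ × ℕ) × Bool × List Bool => d s.1.1.bodd s.1.2.bodd s.2.1 :=
    of_bool₃ d (by fun_prop) (by fun_prop) (by fun_prop)
  have hs : PolyTime C fun s : (ℕ × ℕ) × Bool × List Bool => carryStep d s :=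
    prodMk (by fun_prop) (prodMk (snd.comp hd) ((fst.comp hd).cons (by fun_prop)))
  refine foldl_of_growth (lst := fun x => (f x).bits ++ (g x).bits ++ [true])
    (init := fun x => ((f x, g x), false, [])) (step := fun _ s _ => carryStep d s)
    (by fun_prop) (by fun_prop) (hs.comp (by fun_prop)) 10 fun _ s _ => ?_
  obtain ⟨⟨a, b⟩, c, acc⟩ := s
  have h1 := tsize_div2_le a
  have h2 := tsize_div2_le b
  have h3 := tsize_bool_le (d a.bodd b.bodd c).1
  have h4 := tsize_bool_le (d a.bodd b.bodd c).2
  simp only [carryStep, tsize_pair, tsize_cons, Polynomial.eval_ofNat]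
  omega

@[fun_prop]
theorem natAdd {f g : α → ℕ} (hf : PolyTime C f) (hg : PolyTime C g) :
    PolyTime C fun x => f x + g x :=
  ((snd.comp (snd.comp (carryLoop addDigit hf hg))).bitsVal).congr fun _ =>
    bitsVal_carryLoop_addDigit _ _

@[fun_prop]
theorem natLt {f g : α → ℕ} (hf : PolyTime C f) (hg : PolyTime C g) :
    PolyTime C fun x => decide (f x < g x) :=
  (fst.comp (snd.comp (carryLoop subDigit hf hg))).congr fun _ => (carryLoop_subDigit _ _).1

@[fun_prop]
theorem natLe {f g : α → ℕ} (hf : PolyTime C f) (hg : PolyTime C g) :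
    PolyTime C fun x => decide (f x ≤ g x) :=
  (decide_not (natLt hg hf)).congr fun x => by simp

@[fun_prop]
theorem natSub {f g : α → ℕ} (hf : PolyTime C f) (hg : PolyTime C g) :
    PolyTime C fun x => f x - g x := by
  refine (ite_prop (c := fun x => f x < g x) (natLt hf hg) (const 0)
    ((snd.comp (snd.comp (carryLoop subDigit hf hg))).bitsVal)).congr fun x => ?_
  split
  · omega
  · exact (carryLoop_subDigit _ _).2 (by omega)

end PolyTime

theorem foldl_bits_mul (a : ℕ) (l : List Bool) :
    l.foldl (fun n d => n + n + if d = true then a else 0) 0 = bitsVal l * a := by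
  induction l using List.reverseRecOn with
  | nil => simp [bitsVal]
  | append_singleton l b ih =>
    rw [List.foldl_append, ih, bitsVal_append_singleton, Nat.bit_val]
    cases b <;> simp <;> ring

/-- One step of long division by `d`, with quotient and remainder so far `s`. -/
def divStep (d : ℕ) (s : ℕ × ℕ) (b : Bool) : ℕ × ℕ :=
  if 0 < d ∧ d ≤ Nat.bit b s.2 then (Nat.bit true s.1, Nat.bit b s.2 - d)
  else (Nat.bit false s.1, Nat.bit b s.2)

/-- Horner's scheme for quotient and remainder together. The guard `0 < d` in `divStep` makes the
result agree with the conventions `n / 0 = 0` and `n % 0 = n`. -/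
theorem foldl_divStep (d : ℕ) (l : List Bool) :
    l.foldl (divStep d) (0, 0) = (bitsVal l / d, bitsVal l % d) := by
  induction l using List.reverseRecOn with
  | nil => simp [bitsVal]
  | append_singleton l b ih =>
    rw [List.foldl_append, ih, bitsVal_append_singleton]
    simp only [List.foldl_cons, List.foldl_nil, divStep, Nat.bit_val]
    rcases Nat.eq_zero_or_pos d with rfl | hd
    · simp
    · have h1 := Nat.mod_lt (bitsVal l) hd
      have h2 := Nat.div_add_mod (bitsVal l) d
      have hb := Bool.toNat_le b
      generalize bitsVal l / d = q at *
      generalize bitsVal l % d = r at *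
      rw [← h2]
      split
      · next h =>
        have : (2 * (d * q + r) + b.toNat) / d = 2 * q + 1 ∧
            (2 * (d * q + r) + b.toNat) % d = 2 * r + b.toNat - d := by
          rw [Nat.div_mod_unique hd]
          refine ⟨?_, by omega⟩
          zify [h.2]
          ring
        rw [this.1, this.2]
        rfl
      · next h =>
        have : (2 * (d * q + r) + b.toNat) / d = 2 * q ∧
            (2 * (d * q + r) + b.toNat) % d = 2 * r + b.toNat := by
          rw [Nat.div_mod_unique hd]
          refine ⟨by ring, by omega⟩
        rw [this.1, this.2]
        rfl

theorem foldl_bits_pow_mod (x m : ℕ) (l : List Bool) :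
    l.foldl (fun n d => n * n * (if d = true then x else 1) % m) (1 % m) =
      x ^ bitsVal l % m := by
  induction l using List.reverseRecOn with
  | nil => simp [bitsVal]
  | append_singleton l b ih =>
    rw [List.foldl_append, ih, bitsVal_append_singleton, Nat.bit_val]
    simp only [List.foldl_cons, List.foldl_nil]
    have : x ^ (2 * bitsVal l + b.toNat) =
        x ^ bitsVal l * x ^ bitsVal l * if b = true then x else 1 := by
      rw [two_mul, pow_add, pow_add]
      cases b <;> simp
    rw [this]
    exact ((Nat.mod_modEq _ _).mul (Nat.mod_modEq _ _)).mul_right _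

/-- One step of the Euclidean algorithm. -/
def gcdStep (s : ℕ × ℕ) : ℕ × ℕ := if s.1 = 0 then s else (s.2 % s.1, s.1)

theorem gcdStep_zero (b : ℕ) : gcdStep (0, b) = (0, b) := rfl

theorem gcdStep_of_ne {a : ℕ} (ha : a ≠ 0) (b : ℕ) : gcdStep (a, b) = (b % a, a) := if_neg ha

theorem foldl_gcdStep_le {β : Type} (l : List β) (s : ℕ × ℕ) (n : ℕ) (h1 : s.1 ≤ n)
    (h2 : s.2 ≤ n) :
    (l.foldl (fun s _ => gcdStep s) s).1 ≤ n ∧ (l.foldl (fun s _ => gcdStep s) s).2 ≤ n := by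
  induction l generalizing s with
  | nil => exact ⟨h1, h2⟩
  | cons y l ih =>
    obtain ⟨a, b⟩ := s
    rw [List.foldl_cons]
    by_cases ha : a = 0
    · subst ha
      exact ih _ h1 h2
    · rw [gcdStep_of_ne ha]
      exact ih _ ((Nat.mod_le _ _).trans h2) h1

/-- For `0 < a ≤ b` one has `2 * (b % a) ≤ b`, so each step at least halves the product of the two
numbers. Once the product is 0, the smaller number is 0 and the larger is the gcd. -/
theorem foldl_gcdStep_of_le {β : Type} (l : List β) (s : ℕ × ℕ) (h : s.1 ≤ s.2)
    (hl : s.1 * s.2 < 2 ^ l.length) :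
    (l.foldl (fun s _ => gcdStep s) s).2 = Nat.gcd s.1 s.2 := by
  induction l generalizing s with
  | nil =>
    have : s.1 * s.2 = 0 := by simpa using hl
    have : s.1 = 0 := by
      rcases Nat.mul_eq_zero.1 this with h' | h' <;> omega
    simp [this]
  | cons y l ih =>
    obtain ⟨a, b⟩ := s
    simp only at h hl
    rw [List.length_cons, pow_succ] at hl
    rw [List.foldl_cons]
    by_cases h0 : a = 0
    · subst h0
      rw [gcdStep_zero, ih (0, b) h (by simp)]
    · have h1 := Nat.mod_lt b (Nat.pos_of_ne_zero h0)
      have h2 := Nat.div_add_mod b a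
      have h3 : 1 ≤ b / a := (Nat.one_le_div_iff (Nat.pos_of_ne_zero h0)).2 h
      have h4 : 2 * (b % a) ≤ b := by nlinarith
      rw [gcdStep_of_ne h0, ih (b % a, a) h1.le (by simp only; nlinarith), Nat.gcd_rec a b]

/-- The additional first step brings the two numbers into order. -/
theorem foldl_gcdStep {β : Type} (l : List β) (a b : ℕ) (hl : a * b < 2 ^ l.length) (y : β) :
    ((y :: l).foldl (fun s _ => gcdStep s) (a, b)).2 = Nat.gcd a b := by
  rw [List.foldl_cons]
  by_cases h0 : a = 0
  · subst h0
    rw [gcdStep_zero, foldl_gcdStep_of_le l (0, b) (by simp) (by simp)]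
  · have h1 := Nat.mod_lt b (Nat.pos_of_ne_zero h0)
    rw [gcdStep_of_ne h0, foldl_gcdStep_of_le l (b % a, a) h1.le, Nat.gcd_rec a b]
    refine lt_of_le_of_lt ?_ hl
    rw [Nat.mul_comm a b]
    exact Nat.mul_le_mul_right _ (Nat.mod_le _ _)

namespace PolyTime

variable {α β γ δ : Type} [TreeData α] [TreeData β] [TreeData γ] [TreeData δ]

theorem exists_lt_two_pow {f : α → ℕ} (hf : PolyTime C f) :
    ∃ q : Polynomial ℕ, ∀ x, f x < 2 ^ q.eval (tsize x) := by
  obtain ⟨q, hq⟩ := hf.exists_tsize_le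
  exact ⟨q, fun x => (lt_two_pow_tsize _).trans_le (Nat.pow_le_pow_right (by simp) (hq x))⟩

theorem length_le_of_tsize {q : Polynomial ℕ} {lst : α → List β}
    (hq : ∀ x, tsize (lst x) ≤ q.eval (tsize x)) {x : α} {l₁ l₂ : List β}
    (h : lst x = l₁ ++ l₂) : l₁.length ≤ q.eval (tsize x) := by
  have h1 := hq x
  have h2 := length_lt_tsize (lst x)
  rw [h, List.length_append] at h2
  rw [h] at h1
  omega

@[fun_prop]
theorem natMul {f g : α → ℕ} (hf : PolyTime C f) (hg : PolyTime C g) :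
    PolyTime C fun x => f x * g x := by
  obtain ⟨p, hp⟩ := hf.exists_lt_two_pow
  obtain ⟨q, hq⟩ := (hg.natBits.listReverse).exists_tsize_le
  refine (foldl (init := fun _ => 0) (lst := fun x => (g x).bits.reverse)
    (step := fun x n d => n + n + if d = true then f x else 0) (by fun_prop) (by fun_prop) ?_
    (4 * (p + q) + 1) fun x l₁ l₂ h => ?_).congr fun x => ?_
  · refine natAdd (by fun_prop) (ite_prop (by fun_prop) ?_ (by fun_prop))
    exact hf.comp (by fun_prop)
  · rw [foldl_bits_mul]
    refine (tsize_le_of_lt_two_pow (k := l₁.length + p.eval (tsize x)) ?_).trans ?_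
    · rw [pow_add]
      exact Nat.mul_lt_mul'' (bitsVal_lt l₁) (hp x)
    · have := length_le_of_tsize hq h
      simp
      omega
  · rw [foldl_bits_mul, bitsVal_reverse_bits, Nat.mul_comm]

theorem natDivMod {f g : α → ℕ} (hf : PolyTime C f) (hg : PolyTime C g) :
    PolyTime C fun x => (f x / g x, f x % g x) := by
  obtain ⟨q, hq⟩ := (hf.natBits.listReverse).exists_tsize_le
  refine (foldl (init := fun _ => (0, 0)) (lst := fun x => (f x).bits.reverse)
    (step := fun x s b => divStep (g x) s b) (by fun_prop) (by fun_prop) ?_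
    (8 * q + 3) fun x l₁ l₂ h => ?_).congr fun x => ?_
  · have hg' : PolyTime C fun x : α × (ℕ × ℕ) × Bool => g x.1 := hg.comp fst
    unfold divStep
    fun_prop
  · rw [foldl_divStep, tsize_pair]
    have h1 := tsize_le_of_lt_two_pow ((Nat.div_le_self _ (g x)).trans_lt (bitsVal_lt l₁))
    have h2 := tsize_le_of_lt_two_pow ((Nat.mod_le _ (g x)).trans_lt (bitsVal_lt l₁))
    have := length_le_of_tsize hq h
    simp
    omega
  · rw [foldl_divStep, bitsVal_reverse_bits]

@[fun_prop]
theorem natDiv {f g : α → ℕ} (hf : PolyTime C f) (hg : PolyTime C g) :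
    PolyTime C fun x => f x / g x := fst.comp (natDivMod hf hg)

@[fun_prop]
theorem natMod {f g : α → ℕ} (hf : PolyTime C f) (hg : PolyTime C g) :
    PolyTime C fun x => f x % g x := snd.comp (natDivMod hf hg)

/-- Reduction after every squaring keeps the intermediate results below `m x`. Modulo 0 nothing
would be reduced and the sizes would explode, hence `hpos`. -/
theorem natPowMod {f g m : α → ℕ} (hf : PolyTime C f) (hg : PolyTime C g) (hm : PolyTime C m)
    (hpos : ∀ x, 0 < m x) : PolyTime C fun x => f x ^ g x % m x := by
  obtain ⟨q, hq⟩ := hm.exists_lt_two_pow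
  refine (foldl (init := fun x => 1 % m x) (lst := fun x => (g x).bits.reverse)
    (step := fun x n d => n * n * (if d = true then f x else 1) % m x) (by fun_prop)
    (by fun_prop) ?_ (4 * q + 1) fun x l₁ l₂ h => ?_).congr fun x => ?_
  · have hf' : PolyTime C fun x : α × ℕ × Bool => f x.1 := hf.comp fst
    have hm' : PolyTime C fun x : α × ℕ × Bool => m x.1 := hm.comp fst
    fun_prop
  · rw [foldl_bits_pow_mod]
    refine (tsize_le_of_lt_two_pow ((Nat.mod_lt _ (hpos x)).trans (hq x))).trans ?_
    simp
  · rw [foldl_bits_pow_mod, bitsVal_reverse_bits]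

@[fun_prop]
theorem natGcd {f g : α → ℕ} (hf : PolyTime C f) (hg : PolyTime C g) :
    PolyTime C fun x => Nat.gcd (f x) (g x) := by
  obtain ⟨p, hp⟩ := hf.exists_lt_two_pow
  obtain ⟨q, hq⟩ := hg.exists_lt_two_pow
  have hs : PolyTime C gcdStep := by
    unfold gcdStep
    fun_prop
  refine (snd.comp (foldl (init := fun x => (f x, g x))
    (lst := fun x => true :: ((f x).bits ++ (g x).bits))
    (step := fun _ s _ => gcdStep s) (by fun_prop) (by fun_prop) (hs.comp (by fun_prop))
    (8 * (p + q) + 3) fun x l₁ l₂ _ => ?_)).congr fun x => ?_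
  · obtain ⟨h1, h2⟩ := foldl_gcdStep_le l₁ (f x, g x) (max (f x) (g x)) (le_max_left _ _)
      (le_max_right _ _)
    have h3 : max (f x) (g x) < 2 ^ (p.eval (tsize x) + q.eval (tsize x)) :=
      max_lt ((hp x).trans_le (Nat.pow_le_pow_right (by simp) (by simp)))
        ((hq x).trans_le (Nat.pow_le_pow_right (by simp) (by simp)))
    have h4 := tsize_le_of_lt_two_pow (h1.trans_lt h3)
    have h5 := tsize_le_of_lt_two_pow (h2.trans_lt h3)
    rw [← Prod.mk.eta (p := List.foldl _ _ _), tsize_pair]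
    simp
    omega
  · refine foldl_gcdStep _ _ _ ?_ _
    rw [List.length_append, Nat.size_eq_bits_len, Nat.size_eq_bits_len, pow_add]
    exact Nat.mul_lt_mul'' (Nat.lt_size_self _) (Nat.lt_size_self _)

-- The fold puts each new block in front of the earlier ones, hence the reversal.
@[fun_prop]
theorem listFlatMap {lst : α → List β} {f : α → β → List γ} (hl : PolyTime C lst)
    (hf : PolyTime C fun x : α × β => f x.1 x.2) :
    PolyTime C fun x => (lst x).reverse.flatMap (f x) := by
  obtain ⟨q, hq⟩ := hf.exists_tsize_le
  refine (foldl_of_growth (init := fun _ => []) (step := fun x acc y => f x y ++ acc)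
    (by fun_prop) hl ?_ (q.comp (.X + 1)) fun x s y => ?_).congr fun x => ?_
  · exact (hf.comp (f := fun x : α × List γ × β => (x.1, x.2.2)) (by fun_prop)).listAppend
      (by fun_prop)
  · have h1 := tsize_append (f x y) s
    have h2 := hq (x, y)
    rw [tsize_pair] at h2
    simp at h2 ⊢
    omega
  · have : ∀ (l : List β) acc, l.foldl (fun acc y => f x y ++ acc) acc = l.reverse.flatMap (f x) ++ acc := by
      intro l
      induction l with
      | nil => simp
      | cons y l ih => simp [ih]
    rw [this, List.append_nil]

theorem listMap {lst : α → List β} {f : α → β → γ} (hl : PolyTime C lst)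
    (hf : PolyTime C fun x : α × β => f x.1 x.2) :
    PolyTime C fun x => (lst x).map (f x) :=
  (listFlatMap (f := fun x y => [f x y]) hl.listReverse (by fun_prop)).congr fun x => by
    simp [List.map_eq_flatMap]

end PolyTime

/-! ### Square roots of one, and canonical forms of the squaring kernel. -/

/-- Let `a` be the full power in `N` of its least prime factor and `b` the cofactor, which is not 1
as `N` is no prime power. Both are odd, hence greater than 2, where `1 ≠ -1`. The element that is 1
modulo `a` and -1 modulo `b` is therefore neither 1 nor -1. -/
theorem exists_unit_sq_eq_one {N : ℕ} (hN : 1 < N) (hodd : Odd N) (hpp : ¬ IsPrimePow N) :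
    ∃ u : (ZMod N)ˣ, (u : ZMod N) ^ 2 = 1 ∧ u ≠ 1 ∧ (u : ZMod N) ≠ -1 := by
  have hp := Nat.minFac_prime hN.ne'
  set p := N.minFac with hpdef
  have hmul := Nat.ordProj_mul_ordCompl_eq_self N p
  have hcop := Nat.coprime_ordCompl hp (by omega : N ≠ 0)
  set k := N.factorization p with hk
  set b := N / p ^ k with hb
  have hk0 : k ≠ 0 := (hp.factorization_pos_of_dvd (by omega) (Nat.minFac_dvd N)).ne'
  have hcop' : Nat.Coprime (p ^ k) b := hcop.pow_left k
  have hb1 : b ≠ 1 := by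
    intro h
    rw [h, mul_one] at hmul
    exact hpp (hmul ▸ hp.isPrimePow.pow hk0)
  have ha1 : p ^ k ≠ 1 := by
    intro h
    have := Nat.one_lt_pow hk0 hp.one_lt
    omega
  rw [← hmul] at hodd
  have hao := (Nat.odd_mul.1 hodd).1
  have hbo := (Nat.odd_mul.1 hodd).2
  generalize p ^ k = a at *
  have ha3 : 2 < a := by
    rcases hao with ⟨r, hr⟩
    omega
  have hb3 : 2 < b := by
    rcases hbo with ⟨r, hr⟩
    omega
  clear_value b k p
  subst hmul
  have : Fact (2 < a) := ⟨ha3⟩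
  have : Fact (2 < b) := ⟨hb3⟩
  set e := ZMod.chineseRemainder hcop' with he
  have hsq : (e.symm (1, -1)) * (e.symm (1, -1)) = 1 := by
    rw [← map_mul]
    simp
  refine ⟨⟨e.symm (1, -1), e.symm (1, -1), hsq, hsq⟩, ?_, ?_, ?_⟩
  · rw [sq]
    exact hsq
  · intro h
    have h1 : e.symm (1, -1) = 1 := congrArg Units.val h
    rw [RingEquiv.symm_apply_eq, map_one] at h1
    exact ZMod.neg_one_ne_one (congrArg Prod.snd h1)
  · intro h
    have h1 : e.symm (1, -1) = -1 := h
    rw [RingEquiv.symm_apply_eq, map_neg, map_one] at h1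
    exact ZMod.neg_one_ne_one (congrArg Prod.fst h1).symm

section CanonicalForm

variable {N : ℕ} {f : ZMod N → ZMod N}

theorem IsCanonicalForm.eq_iff {α : Type} {R : Setoid α} {f : α → α} (hf : IsCanonicalForm R f)
    (x y : α) : f x = f y ↔ R x y := by
  have h : R = Setoid.ker f := hf.1
  rw [h]
  rfl

/-- Multiplication by a nontrivial root `u` of one is the injection. As `f (u * x) = f x`, a value
`x` or `-x` equal to `u * x` or `-(u * x)` would, after cancelling the unit `x`, force `u` to be 1
or -1. -/
theorem card_trivial_roots_le (hN : 1 < N) (hodd : Odd N) (hpp : ¬ IsPrimePow N)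
    (hf : IsCanonicalForm (Setoid.ker (fun x : ZMod N => x ^ 2)) f) :
    Nat.card {x : (ZMod N)ˣ // ¬ (f x ≠ x ∧ f x ≠ -x)} ≤
      Nat.card {x : (ZMod N)ˣ // f x ≠ x ∧ f x ≠ -x} := by
  obtain ⟨u, hu, hu1, hu2⟩ := exists_unit_sq_eq_one hN hodd hpp
  have hu1' : (u : ZMod N) ≠ 1 := fun h => hu1 (Units.ext h)
  have : NeZero N := ⟨by omega⟩
  refine Nat.card_le_card_of_injective
    (fun x => ⟨u * x.1, ?_⟩ : {x : (ZMod N)ˣ // ¬ (f x ≠ x ∧ f x ≠ -x)} →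
      {x : (ZMod N)ˣ // f x ≠ x ∧ f x ≠ -x}) ?_
  · obtain ⟨x, hx⟩ := x
    have h : f ((u * x : (ZMod N)ˣ) : ZMod N) = f x := by
      rw [hf.eq_iff]
      change ((u * x : (ZMod N)ˣ) : ZMod N) ^ 2 = (x : ZMod N) ^ 2
      rw [Units.val_mul, mul_pow, hu, one_mul]
    simp only
    rw [h, Units.val_mul]
    rw [← not_or, not_not] at hx
    have hc : ∀ v : ZMod N, v * (x : ZMod N) = x → v = 1 := fun v hv =>
      x.isUnit.mul_right_cancel (by rw [hv, one_mul])
    constructor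
    · intro h'
      rcases hx with hx | hx
      · exact hu1' (hc _ (h'.symm.trans hx))
      · refine hu2 (neg_eq_iff_eq_neg.1 (hc (-u) ?_))
        rw [neg_mul, ← h', hx, neg_neg]
    · intro h'
      rcases hx with hx | hx
      · refine hu2 (neg_eq_iff_eq_neg.1 (hc (-u) ?_))
        rw [neg_mul, ← h', hx]
      · exact hu1' (hc _ (neg_injective (h'.symm.trans hx)))
  · intro x y h
    exact Subtype.ext (mul_left_cancel (congrArg Subtype.val h))

theorem one_half_le_uniformProb (hN : 1 < N) (hodd : Odd N) (hpp : ¬ IsPrimePow N)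
    (hf : IsCanonicalForm (Setoid.ker (fun x : ZMod N => x ^ 2)) f) :
    1 / 2 ≤ uniformProb (fun x : (ZMod N)ˣ => f (x : ZMod N) ≠ (x : ZMod N) ∧
      f (x : ZMod N) ≠ -(x : ZMod N)) := by
  classical
  have : NeZero N := ⟨by omega⟩
  have h := card_trivial_roots_le hN hodd hpp hf
  have h2 : Nat.card {x : (ZMod N)ˣ // f x ≠ x ∧ f x ≠ -x} +
      Nat.card {x : (ZMod N)ˣ // ¬ (f x ≠ x ∧ f x ≠ -x)} = Nat.card (ZMod N)ˣ := by
    rw [← Nat.card_sum]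
    exact Nat.card_congr (Equiv.sumCompl fun x : (ZMod N)ˣ => f x ≠ x ∧ f x ≠ -x)
  have h3 : 0 < Nat.card (ZMod N)ˣ := Nat.card_pos
  unfold uniformProb
  rw [div_le_div_iff₀ (by norm_num) (by exact_mod_cast h3)]
  have h4 : 1 * Nat.card (ZMod N)ˣ ≤ Nat.card {x : (ZMod N)ˣ // f x ≠ x ∧ f x ≠ -x} * 2 := by
    omega
  exact_mod_cast h4

/-- The product of `x - f x` and `x + f x` is 0. A gcd of 1 would make `x - f x` a unit and give `f
x = -x`; a gcd of `N` would give `f x = x`. -/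
theorem gcd_val_sub_nontrivial (hN : 1 < N)
    (hf : IsCanonicalForm (Setoid.ker (fun x : ZMod N => x ^ 2)) f) {x : ZMod N}
    (h1 : f x ≠ x) (h2 : f x ≠ -x) :
    1 < Nat.gcd N (x - f x).val ∧ Nat.gcd N (x - f x).val < N := by
  have : NeZero N := ⟨by omega⟩
  have hsq : x ^ 2 = f x ^ 2 := hf.2 x
  have hpos : 0 < Nat.gcd N (x - f x).val := Nat.gcd_pos_of_pos_left _ (by omega)
  constructor
  · by_contra h
    have hu : IsUnit (x - f x) := by
      rw [← ZMod.natCast_zmod_val (x - f x), ZMod.isUnit_iff_coprime]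
      rw [Nat.coprime_comm, Nat.Coprime]
      omega
    have h3 : (x - f x) * (x + f x) = 0 := by linear_combination hsq
    have h4 := hu.mul_right_eq_zero.1 h3
    exact h2 (by linear_combination h4)
  · refine lt_of_le_of_ne (Nat.gcd_le_left _ (by omega)) fun h => h1 ?_
    have h3 : N ∣ (x - f x).val := Nat.gcd_eq_left_iff_dvd.1 h
    have h4 := Nat.eq_zero_of_dvd_of_lt h3 (ZMod.val_lt _)
    exact (sub_eq_zero.1 ((ZMod.val_eq_zero _).1 h4)).symm

end CanonicalForm

/-! ### Splitting a composite number with a random residue. -/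

/-- A number that properly divides `m` and is not 1 splits `m`. -/
def Splits (m d : ℕ) : Prop := 1 < d ∧ d < m

instance (m d : ℕ) : Decidable (Splits m d) := inferInstanceAs (Decidable (_ ∧ _))

/-- Two factors of `m`, found with the help of `x` and a root `y` of `x ^ 2` modulo `m`, or `m`
alone if none are found. -/
def trySplit (y : ℕ → ℕ → ℕ) (m x : ℕ) : List ℕ :=
  if Splits m (Nat.gcd m 2) then [Nat.gcd m 2, m / Nat.gcd m 2]
  else if Splits m (Nat.gcd m (x % m)) then [Nat.gcd m (x % m), m / Nat.gcd m (x % m)]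
  else if Splits m (Nat.gcd m ((x % m) ^ m % m + (m - x % m))) then
    [Nat.gcd m ((x % m) ^ m % m + (m - x % m)), m / Nat.gcd m ((x % m) ^ m % m + (m - x % m))]
  else if Splits m (Nat.gcd m (x % m + (m - y m (x % m) % m))) then
    [Nat.gcd m (x % m + (m - y m (x % m) % m)), m / Nat.gcd m (x % m + (m - y m (x % m) % m))]
  else [m]

theorem trySplit_cases (y : ℕ → ℕ → ℕ) (m x : ℕ) : trySplit y m x = [m] ∨
    ∃ a b, trySplit y m x = [a, b] ∧ a * b = m ∧ 1 < a ∧ 1 < b := by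
  have key : ∀ d, Splits m (Nat.gcd m d) → ∃ a b, [Nat.gcd m d, m / Nat.gcd m d] = [a, b] ∧
      a * b = m ∧ 1 < a ∧ 1 < b := by
    intro d hd
    have h := Nat.mul_div_cancel' (Nat.gcd_dvd_left m d)
    refine ⟨_, _, rfl, h, hd.1, ?_⟩
    by_contra h'
    have h2 := hd.2
    have h3 : m / Nat.gcd m d ≤ 1 := by omega
    have h4 := Nat.mul_le_mul_left (Nat.gcd m d) h3
    omega
  unfold trySplit
  split
  · exact Or.inr (key _ ‹_›)
  split
  · exact Or.inr (key _ ‹_›)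
  split
  · exact Or.inr (key _ ‹_›)
  split
  · exact Or.inr (key _ ‹_›)
  · exact Or.inl rfl

/-- The four attempts have separate purposes: `2` for even `m`, `x` for residues not coprime to `m`,
`x ^ m - x` for prime powers, `x - y` for the remaining `m`. Adding `m - _` in place of subtracting
avoids truncation. -/
theorem not_splits_of_trySplit_eq {y : ℕ → ℕ → ℕ} {m x : ℕ} (h : trySplit y m x = [m]) :
    ¬ Splits m (Nat.gcd m 2) ∧ ¬ Splits m (Nat.gcd m (x % m)) ∧
    ¬ Splits m (Nat.gcd m ((x % m) ^ m % m + (m - x % m))) ∧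
    ¬ Splits m (Nat.gcd m (x % m + (m - y m (x % m) % m))) := by
  unfold trySplit at h
  split at h
  · simp at h
  split at h
  · simp at h
  split at h
  · simp at h
  split at h
  · simp at h
  · exact ⟨‹_›, ‹_›, ‹_›, ‹_›⟩

/-- `y m x` is a function of `x ^ 2` modulo `m`, and a root of it. -/
def IsRootFinder (y : ℕ → ℕ → ℕ) : Prop :=
  (∀ m x, 0 < m → y m x ^ 2 ≡ x ^ 2 [MOD m]) ∧
  ∀ m x x', x ^ 2 ≡ x' ^ 2 [MOD m] → y m x = y m x'

theorem IsRootFinder.isCanonicalForm {y : ℕ → ℕ → ℕ} (hy : IsRootFinder y) {m : ℕ} (hm : 0 < m) :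
    IsCanonicalForm (Setoid.ker (fun x : ZMod m => x ^ 2)) fun x => (y m x.val : ZMod m) := by
  have : NeZero m := ⟨by omega⟩
  have h1 : ∀ x : ZMod m, (y m x.val : ZMod m) ^ 2 = x ^ 2 := by
    intro x
    have h := (ZMod.natCast_eq_natCast_iff _ _ _).2 (hy.1 m x.val hm)
    push_cast at h
    rwa [ZMod.natCast_zmod_val] at h
  refine ⟨?_, fun x => (h1 x).symm⟩
  ext x x'
  change x ^ 2 = x' ^ 2 ↔ (y m x.val : ZMod m) = (y m x'.val : ZMod m)
  constructor
  · intro h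
    rw [hy.2 m x.val x'.val]
    rw [← ZMod.natCast_eq_natCast_iff]
    push_cast
    rwa [ZMod.natCast_zmod_val, ZMod.natCast_zmod_val]
  · intro h
    rw [← h1 x, ← h1 x', h]

theorem gcd_val (m n : ℕ) : Nat.gcd m (n : ZMod m).val = Nat.gcd m n := by
  rw [ZMod.val_natCast, Nat.gcd_comm, ← Nat.gcd_rec]

/-- The prime `p` always divides `x ^ (p ^ k) - x`, so the attempt fails only if `p ^ k` divides it
too. Such fixed points of the power map modulo `p ^ k` are determined by their residue modulo `p`,
so there are at most `p` of them. -/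
theorem card_trySplit_primePow_le {p k : ℕ} (hp : p.Prime) (hk : 2 ≤ k) (y : ℕ → ℕ → ℕ) :
    ((Finset.range (p ^ k)).filter fun x => trySplit y (p ^ k) x = [p ^ k]).card ≤ p := by
  have hdvd : p ∣ p ^ k := dvd_pow_self p (by omega)
  have hpos : 0 < p ^ k := pow_pos hp.pos k
  have key : ∀ x, x < p ^ k → trySplit y (p ^ k) x = [p ^ k] → (x : ZMod (p ^ k)) ^ p ^ k = x := by
    intro x hx h
    have h3 := (not_splits_of_trySplit_eq h).2.2.1
    rw [Nat.mod_eq_of_lt hx, ← gcd_val] at h3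
    have hcast : ((x ^ p ^ k % p ^ k + (p ^ k - x) : ℕ) : ZMod (p ^ k)) =
        (x : ZMod (p ^ k)) ^ p ^ k - x := by
      rw [Nat.cast_add, Nat.cast_sub hx.le, ZMod.natCast_mod, ZMod.natCast_self]
      push_cast
      ring
    rw [gcd_val] at h3
    have hp' : p ∣ x ^ p ^ k % p ^ k + (p ^ k - x) := by
      have : Fact p.Prime := ⟨hp⟩
      rw [← ZMod.natCast_eq_zero_iff, Nat.cast_add, Nat.cast_sub hx.le,
        (ZMod.natCast_eq_zero_iff _ _).2 hdvd]
      have : ((x ^ p ^ k % p ^ k : ℕ) : ZMod p) = ((x ^ p ^ k : ℕ) : ZMod p) :=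
        (ZMod.natCast_eq_natCast_iff _ _ _).2 ((Nat.mod_modEq _ _).of_dvd hdvd)
      rw [this, Nat.cast_pow, ZMod.pow_card_pow]
      ring
    have h4 : 1 < Nat.gcd (p ^ k) (x ^ p ^ k % p ^ k + (p ^ k - x)) :=
      hp.one_lt.trans_le (Nat.le_of_dvd (Nat.gcd_pos_of_pos_left _ hpos) (Nat.dvd_gcd hdvd hp'))
    have h5 : p ^ k ≤ Nat.gcd (p ^ k) (x ^ p ^ k % p ^ k + (p ^ k - x)) := by
      by_contra h'
      exact h3 ⟨h4, by omega⟩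
    have h6 : p ^ k ∣ x ^ p ^ k % p ^ k + (p ^ k - x) :=
      Nat.gcd_eq_left_iff_dvd.1 (le_antisymm (Nat.gcd_le_left _ hpos) h5)
    rw [← ZMod.natCast_eq_zero_iff, hcast] at h6
    exact sub_eq_zero.1 h6
  have hle := Finset.card_le_card_of_injOn (fun x => x % p)
    (s := (Finset.range (p ^ k)).filter fun x => trySplit y (p ^ k) x = [p ^ k])
    (t := Finset.range p) (fun x _ => by simpa using Nat.mod_lt x hp.pos) ?_
  · simpa using hle
  · intro x hx x' hx' h
    simp only [Finset.coe_filter, Finset.mem_range, Set.mem_ofPred_eq] at hx hx'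
    have h1 : (p : ℤ) ∣ (x : ℤ) - x' := (Nat.modEq_iff_dvd.1 (show x' ≡ x [MOD p] from h.symm))
    -- Each of `k` successive `p`-th powers improves the congruence modulo `p` by a factor `p`,
    -- giving one modulo `p ^ (k + 1)`.
    have h2 := dvd_sub_pow_of_dvd_sub h1 k
    have h4 : ((p ^ k : ℕ) : ℤ) ∣ (x : ℤ) ^ p ^ k - (x' : ℤ) ^ p ^ k := by
      refine dvd_trans ?_ h2
      push_cast
      exact pow_dvd_pow _ (by omega)
    have h5 := (ZMod.intCast_zmod_eq_zero_iff_dvd _ _).2 h4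
    push_cast at h5
    have k1 := key x hx.1 hx.2
    have k2 := key x' hx'.1 hx'.2
    rw [k1, k2, sub_eq_zero] at h5
    have h6 := (ZMod.natCast_eq_natCast_iff _ _ _).1 h5
    exact Nat.ModEq.eq_of_lt_of_lt h6 hx.1 hx'.1

/-- A failing `x ≠ 0` is coprime to `m`, by the attempt with `x`, and satisfies `f x = x` or `f x =
-x`, by the attempt with `x - y`. At most half of the units do so. The residue 0, where `gcd m 0 =
m` splits nothing, accounts for the `+ 2`. -/
theorem card_trySplit_not_primePow_le {m : ℕ} (hm : 1 < m) (hodd : Odd m)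
    (hpp : ¬ IsPrimePow m) {y : ℕ → ℕ → ℕ} (hy : IsRootFinder y) :
    2 * ((Finset.range m).filter fun x => trySplit y m x = [m]).card ≤ m + 2 := by
  classical
  have : NeZero m := ⟨by omega⟩
  have hf := hy.isCanonicalForm (m := m) (by omega)
  set f : ZMod m → ZMod m := fun x => (y m x.val : ZMod m) with hfdef
  have hcard := card_trivial_roots_le hm hodd hpp hf
  have h2 : Nat.card {x : (ZMod m)ˣ // f x ≠ x ∧ f x ≠ -x} +
      Nat.card {x : (ZMod m)ˣ // ¬ (f x ≠ x ∧ f x ≠ -x)} = Nat.card (ZMod m)ˣ := by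
    rw [← Nat.card_sum]
    exact Nat.card_congr (Equiv.sumCompl fun x : (ZMod m)ˣ => f x ≠ x ∧ f x ≠ -x)
  have h3 : Nat.card (ZMod m)ˣ ≤ m := by
    rw [Nat.card_eq_fintype_card, ZMod.card_units_eq_totient]
    exact Nat.totient_le m
  have key : ∀ x, x < m → x ≠ 0 → trySplit y m x = [m] →
      ∃ u : (ZMod m)ˣ, (u : ZMod m) = x ∧ ¬ (f u ≠ u ∧ f u ≠ -u) := by
    intro x hx hx0 h
    obtain ⟨-, h2, -, h4⟩ := not_splits_of_trySplit_eq h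
    rw [Nat.mod_eq_of_lt hx] at h2 h4
    have hlt : Nat.gcd m x < m := (Nat.gcd_le_right m (by omega)).trans_lt hx
    have hcop : Nat.Coprime x m := by
      rw [Nat.coprime_comm, Nat.Coprime]
      have : 0 < Nat.gcd m x := Nat.gcd_pos_of_pos_left _ (by omega)
      by_contra h'
      exact h2 ⟨by omega, hlt⟩
    refine ⟨ZMod.unitOfCoprime x hcop, ZMod.coe_unitOfCoprime x hcop, fun hb => h4 ?_⟩
    rw [ZMod.coe_unitOfCoprime] at hb
    have h5 := gcd_val_sub_nontrivial hm hf hb.1 hb.2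
    have h6 : (x : ZMod m) - f x = ((x + (m - y m x % m) : ℕ) : ZMod m) := by
      rw [Nat.cast_add, Nat.cast_sub (Nat.mod_lt _ (by omega)).le, ZMod.natCast_mod,
        ZMod.natCast_self, hfdef]
      simp only [ZMod.val_natCast, Nat.mod_eq_of_lt hx]
      ring
    change 1 < Nat.gcd m ((x : ZMod m) - f x).val ∧ Nat.gcd m ((x : ZMod m) - f x).val < m at h5
    rw [h6, gcd_val] at h5
    exact h5
  have hle : (((Finset.range m).filter fun x => trySplit y m x = [m]).erase 0).card ≤
      Nat.card {x : (ZMod m)ˣ // ¬ (f x ≠ x ∧ f x ≠ -x)} := by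
    rw [Nat.card_eq_fintype_card, Fintype.card_subtype]
    refine Finset.card_le_card_of_surjOn (fun u : (ZMod m)ˣ => (u : ZMod m).val) ?_
    intro x hx
    simp only [Finset.coe_erase, Finset.coe_filter, Finset.mem_range, Set.mem_sdiff,
      Set.mem_ofPred_eq, Set.mem_singleton_iff] at hx
    obtain ⟨u, hu, hu'⟩ := key x hx.1.1 hx.2 hx.1.2
    refine ⟨u, by simpa using hu', ?_⟩
    simp only [hu, ZMod.val_natCast, Nat.mod_eq_of_lt hx.1.1]
  have h5 := Finset.pred_card_le_card_erase (a := 0)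
    (s := (Finset.range m).filter fun x => trySplit y m x = [m])
  omega

theorem four_mul_card_trySplit_le {m : ℕ} (hm : 1 < m) (hnp : ¬ m.Prime) {y : ℕ → ℕ → ℕ}
    (hy : IsRootFinder y) :
    4 * ((Finset.range m).filter fun x => trySplit y m x = [m]).card ≤ 3 * m := by
  -- From `m = 4` on, the proportion 3/4 absorbs the `+ 2` of the bound `m + 2`.
  have h4 : 4 ≤ m := by
    by_contra h
    interval_cases m
    · exact hnp Nat.prime_two
    · exact hnp Nat.prime_three
  by_cases heven : Even m
  · rw [Finset.filter_false_of_mem]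
    · simp
    · intro x _ h
      have h1 := (not_splits_of_trySplit_eq h).1
      rw [Nat.gcd_eq_right heven.two_dvd] at h1
      exact h1 ⟨by omega, by omega⟩
  · have hodd : Odd m := Nat.not_even_iff_odd.1 heven
    by_cases hpp : IsPrimePow m
    · obtain ⟨p, k, hp, hk, rfl⟩ := (isPrimePow_nat_iff _).1 hpp
      have hk2 : 2 ≤ k := by
        by_contra h
        have : k = 1 := by omega
        subst this
        exact hnp (by simpa using hp)
      have h1 := card_trySplit_primePow_le hp hk2 y
      have h2 : p * p ≤ p ^ k := by
        rw [← sq]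
        exact Nat.pow_le_pow_right hp.pos hk2
      have h3 := hp.two_le
      nlinarith
    · have := card_trySplit_not_primePow_le hm hodd hpp hy
      omega

/-! ### Squaring on encoded pairs, and the root finder it yields. -/

/-- One step of the decoding of pairs of numbers. -/
def pairStep (s : (Bool × Bool) × ℕ × ℕ) (b : Bool) : (Bool × Bool) × ℕ × ℕ :=
  if s.1.2 = true then (s.1, s.2.1, Nat.bit b s.2.2)
  else if s.1.1 = true then ((false, false), Nat.bit b s.2.1, s.2.2)
  else if b = true then ((true, false), s.2)
  else ((false, true), s.2)

/-- The pair of numbers represented by a string. -/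
def decodePair (w : List Bool) : ℕ × ℕ := (w.foldl pairStep ((false, false), 0, 0)).2

/-- A string that represents a pair of numbers: the digits of the first number, each one marked by
`true`, then `false` and the digits of the second number. -/
def encodePair (m x : ℕ) : List Bool :=
  m.bits.foldl (fun acc b => true :: b :: acc) (false :: x.bits.reverse)

theorem decodePair_encodePair (m x : ℕ) : decodePair (encodePair m x) = (m, x) := by
  have h1 : ∀ (l acc : List Bool), l.foldl (fun acc b => true :: b :: acc) acc =
      l.reverse.flatMap (fun b => [true, b]) ++ acc := by
    intro l
    induction l with
    | nil => simp
    | cons b l ih => simp [ih]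
  have h2 : ∀ (l acc : List Bool) (n : ℕ),
      (l.flatMap (fun b => [true, b]) ++ acc).foldl pairStep ((false, false), n, 0) =
      acc.foldl pairStep ((false, false), l.foldl (fun n b => Nat.bit b n) n, 0) := by
    intro l acc
    induction l with
    | nil => simp
    | cons b l ih =>
      intro n
      simpa [pairStep] using ih (Nat.bit b n)
  have h3 : ∀ (l : List Bool) (n : ℕ),
      l.foldl pairStep ((false, true), m, n) =
      ((false, true), m, l.foldl (fun n b => Nat.bit b n) n) := by
    intro l
    induction l with
    | nil => simp
    | cons b l ih =>
      intro n
      simpa [pairStep] using ih (Nat.bit b n)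
  have hm := bitsVal_reverse_bits m
  have hx := bitsVal_reverse_bits x
  unfold bitsVal at hm hx
  rw [decodePair, encodePair, h1, h2, hm, List.foldl_cons,
    show pairStep ((false, false), m, 0) false = ((false, true), m, 0) from rfl, h3, hx]

/-- Square the second of two numbers modulo the first. -/
def squarePair (w : List Bool) : List Bool :=
  encodePair (decodePair w).1 ((decodePair w).2 * (decodePair w).2 % (decodePair w).1)

theorem squarePair_encodePair (m x : ℕ) :
    squarePair (encodePair m x) = encodePair m (x * x % m) := by
  rw [squarePair, decodePair_encodePair]

/-- The root of `x ^ 2` modulo `m` that is given by a canonical form of the kernel of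
`squarePair`. -/
def rootOf (F : List Bool → List Bool) (m x : ℕ) : ℕ := (decodePair (F (encodePair m x))).2

/-- The string returned by `F` need not be a value of `encodePair`. Its image under `squarePair` is
nevertheless `encodePair m (x * x % m)`, and decoding this shows that the string decodes to modulus
`m` and a root. -/
theorem isRootFinder_rootOf {F : List Bool → List Bool}
    (hF : IsCanonicalForm (Setoid.ker squarePair) F) : IsRootFinder (rootOf F) := by
  constructor
  · intro m x _
    have h : squarePair (encodePair m x) = squarePair (F (encodePair m x)) := hF.2 _
    rw [squarePair_encodePair] at h
    have h2 := congrArg decodePair h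
    rw [squarePair, decodePair_encodePair, decodePair_encodePair, Prod.mk.injEq] at h2
    rw [← h2.1] at h2
    rw [sq, sq]
    exact h2.2.symm
  · intro m x x' h
    have h2 : F (encodePair m x) = F (encodePair m x') := by
      rw [hF.eq_iff]
      change squarePair _ = squarePair _
      rw [squarePair_encodePair, squarePair_encodePair]
      rw [sq, sq] at h
      rw [show x * x % m = x' * x' % m from h]
    rw [rootOf, h2, rootOf]

namespace PolyTime

variable {α β γ δ : Type} [TreeData α] [TreeData β] [TreeData γ] [TreeData δ]

@[fun_prop]
theorem decodePair {f : α → List Bool} (hf : PolyTime C f) :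
    PolyTime C fun x => decodePair (f x) := by
  have hs : PolyTime C fun x : ((Bool × Bool) × ℕ × ℕ) × Bool => pairStep x.1 x.2 := by
    unfold pairStep
    fun_prop
  refine snd.comp (foldl_of_growth (init := fun _ => ((false, false), 0, 0))
    (step := fun _ s b => pairStep s b) (by fun_prop) hf
    (hs.comp (f := fun x : α × ((Bool × Bool) × ℕ × ℕ) × Bool => x.2) (by fun_prop)) (.X + 7)
    fun x s b => ?_)
  obtain ⟨⟨c, d⟩, m, n⟩ := s
  have h1 := tsize_bit_le b m
  have h2 := tsize_bit_le b n
  have h3 := tsize_bool_pos c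
  have h4 := tsize_bool_pos d
  have h5 : tsize true = 3 := rfl
  have h6 : tsize false = 1 := rfl
  simp only [Polynomial.eval_add, Polynomial.eval_X, Polynomial.eval_ofNat, pairStep]
  split_ifs <;> simp only [tsize_pair, h5, h6] <;> omega

@[fun_prop]
theorem encodePair {f g : α → ℕ} (hf : PolyTime C f) (hg : PolyTime C g) :
    PolyTime C fun x => encodePair (f x) (g x) := by
  refine foldl_of_growth (init := fun x => false :: (g x).bits.reverse)
    (step := fun _ acc b => true :: b :: acc) (by fun_prop) hf.natBits (by fun_prop) (.X + 5)
    fun x s b => ?_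
  have h5 : tsize true = 3 := rfl
  simp only [tsize_cons, h5, Polynomial.eval_add, Polynomial.eval_X, Polynomial.eval_ofNat]
  omega

theorem squarePair : PolyTime C squarePair := by
  unfold _root_.squarePair
  fun_prop

theorem oracle {A B : Type} {F : List Bool → List Bool}
    (h : TM2ComputableInPolyTime (_root_.id : List Bool → List Bool)
      (_root_.id : List Bool → List Bool) F) : PolyTime ⟨A, B, h.tm⟩ F := by
  have h1 : PolyTime ⟨A, B, h.tm⟩ fun w : List Bool => (w.map fun b => (b, false)).reverse :=
    listReverse (listMap (f := fun _ b => (b, false)) id (by fun_prop))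
  refine (listMap (f := fun (_ : List Bool) (d : Bool × Bool) => d.1)
    (listReverse ((oracle_pairs h).comp h1)) (by fun_prop)).congr fun w => ?_
  simp [Function.comp_def]

theorem inFP {f : List Bool → List Bool} {M : FinTM2} (hf : PolyTime ⟨Bool, Bool, M⟩ f) :
    InFP f := by
  have h0 : PolyTime ⟨Bool, Bool, M⟩ fun l : List (Bool × Bool) => l.map Prod.fst :=
    listMap (f := fun (_ : List (Bool × Bool)) (d : Bool × Bool) => d.1) id (by fun_prop)
  have h1 : PolyTime ⟨Bool, Bool, M⟩ fun l : List (Bool × Bool) =>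
      ((f (l.map Prod.fst).reverse).map fun b => (b, false)).reverse :=
    listReverse (listMap (f := fun _ b => (b, false)) (hf.comp (listReverse
      h0)) (by fun_prop))
  have : Fintype (Setting.mk Bool Bool M).inAlph := inferInstanceAs (Fintype Bool)
  refine h1.nonempty_tm2ComputableInPolyTime (fun b => (b, false)) (fun b _ => b) fun w => ?_
  simp [Function.comp_def]

@[fun_prop]
theorem decide_splits {f g : α → ℕ} (hf : PolyTime C f) (hg : PolyTime C g) :
    PolyTime C fun x => decide (Splits (f x) (g x)) :=
  (show PolyTime C fun x => decide (1 < g x ∧ g x < f x) by fun_prop).congr fun x => by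
    rfl

theorem powModSelf {f g : α → ℕ} (hf : PolyTime C f) (hg : PolyTime C g) :
    PolyTime C fun x => f x ^ g x % g x := by
  -- The modulus is made positive for `natPowMod`. At `g x = 0` the true value is `f x ^ 0 % 0 = 1`.
  have h : PolyTime C fun x => f x ^ g x % (if g x = 0 then 1 else g x) :=
    natPowMod hf hg (by fun_prop) fun x => by split <;> omega
  refine (ite_prop (c := fun x => g x = 0) (by fun_prop) (const 1) h).congr fun x => ?_
  split
  · next h0 => simp [h0]
  · rfl

theorem trySplit {y : ℕ → ℕ → ℕ} (hy : PolyTime C fun x : ℕ × ℕ => y x.1 x.2) :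
    PolyTime C fun x : ℕ × ℕ => trySplit y x.1 x.2 := by
  have h1 : PolyTime C fun x : ℕ × ℕ => (x.2 % x.1) ^ x.1 % x.1 :=
    powModSelf (by fun_prop) (by fun_prop)
  have h2 : PolyTime C fun x : ℕ × ℕ => y x.1 (x.2 % x.1) :=
    hy.comp (f := fun x : ℕ × ℕ => (x.1, x.2 % x.1)) (by fun_prop)
  unfold _root_.trySplit
  fun_prop

end PolyTime

/-! ### The factoring algorithm and the size of its states. -/

/-- Try to split all numbers of a list. -/
def splitAll (y : ℕ → ℕ → ℕ) (L : List ℕ) (x : ℕ) : List ℕ :=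
  L.reverse.flatMap fun m => trySplit y m x

/-- Process a coin toss: the state consists of the factors found so far, the number formed by the
tosses since the last attempt to split, and a list that counts those still missing. -/
def coinStep (y : ℕ → ℕ → ℕ) (full : List Bool) (s : List ℕ × ℕ × List Bool) (b : Bool) :
    List ℕ × ℕ × List Bool :=
  listElim s.2.2.tail (splitAll y s.1 (Nat.bit b s.2.1), 0, full)
    fun _ _ => (s.1, Nat.bit b s.2.1, s.2.2.tail)

/-- A list of length `|N| + 3`. -/
def counter (N : ℕ) : List Bool := true :: true :: true :: N.bits

/-- The initial state of the factorization of `N`. -/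
def coinStart (N : ℕ) : List ℕ × ℕ × List Bool := (if N ≤ 1 then [] else [N], 0, counter N)

/-- Factor `N` with the coin tosses `r`. -/
def factorRun (y : ℕ → ℕ → ℕ) (N : ℕ) (r : List Bool) : List ℕ :=
  (r.foldl (coinStep y (counter N)) (coinStart N)).1

/-- The toss that meets a counter of length one triggers the splitting, so a block as long as the
counter amounts to one round with the number that it spells. -/
theorem foldl_coinStep_block (y : ℕ → ℕ → ℕ) (full : List Bool) (L : List ℕ)
    (w cnt : List Bool) (x : ℕ) (hw : w ≠ []) (h : w.length = cnt.length) :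
    w.foldl (coinStep y full) (L, x, cnt) =
      (splitAll y L (w.foldl (fun n b => Nat.bit b n) x), 0, full) := by
  induction w generalizing x cnt with
  | nil => exact absurd rfl hw
  | cons b w ih =>
    cases cnt with
    | nil => simp at h
    | cons c cnt =>
      simp only [List.length_cons, Nat.add_right_cancel_iff] at h
      cases cnt with
      | nil =>
        have : w = [] := List.length_eq_zero_iff.1 h
        subst this
        rfl
      | cons c' cnt =>
        exact ih (c' :: cnt) (Nat.bit b x) (fun h' => by simp [h'] at h) h

/-- The factors found so far form a factorization of `N` into factors greater than 1. -/
def IsFactorList (N : ℕ) (L : List ℕ) : Prop := (∀ m ∈ L, 1 < m) ∧ L.prod = N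

theorem IsFactorList.splitAll {N : ℕ} {L : List ℕ} (h : IsFactorList N L) (y : ℕ → ℕ → ℕ)
    (x : ℕ) : IsFactorList N (splitAll y L x) := by
  have key : ∀ L : List ℕ, (∀ m ∈ L, 1 < m) →
      IsFactorList L.prod (L.flatMap fun m => trySplit y m x) := by
    intro L
    induction L with
    | nil => exact fun _ => ⟨by simp, rfl⟩
    | cons m L ih =>
      intro hL
      have h1 := ih fun m hm => hL m (List.mem_cons_of_mem _ hm)
      have h2 : IsFactorList m (trySplit y m x) := by
        rcases trySplit_cases y m x with h | ⟨a, b, h, hab, ha, hb⟩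
        · rw [h]
          exact ⟨by simpa using hL m (by simp), by simp⟩
        · rw [h]
          refine ⟨by simp [ha, hb], by simp [hab]⟩
      rw [List.flatMap_cons, List.prod_cons]
      refine ⟨fun k hk => ?_, by rw [List.prod_append, h2.2, h1.2]⟩
      rcases List.mem_append.1 hk with hk | hk
      · exact h2.1 k hk
      · exact h1.1 k hk
  have h1 := key L.reverse fun m hm => h.1 m (List.mem_reverse.1 hm)
  rwa [List.prod_reverse, h.2] at h1

/-- Binary logarithms of the factors add up to at most that of the product, so splitting cannot
inflate the list. A factor `m` contributes at most `4 * (log m + 1) + 2`, which is at most `10 * log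
m` as `log m ≥ 1`. -/
theorem tsize_factorList_le {L : List ℕ} (hL : ∀ m ∈ L, 1 < m) :
    tsize L ≤ 10 * Nat.log 2 L.prod + 1 := by
  induction L with
  | nil => simp [tsize_nil]
  | cons m L ih =>
    have hm := hL m (by simp)
    have h1 := ih fun m hm => hL m (List.mem_cons_of_mem _ hm)
    have hpos : L.prod ≠ 0 := by
      rw [Ne, List.prod_eq_zero_iff]
      exact fun h0 => absurd (hL 0 (List.mem_cons_of_mem _ h0)) (by omega)
    have h2 := tsize_le_of_lt_two_pow (Nat.lt_pow_succ_log_self (by simp : 1 < 2) m)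
    have h3 : 1 ≤ Nat.log 2 m := Nat.log_pos (by simp) hm
    have h4 : Nat.log 2 m + Nat.log 2 L.prod ≤ Nat.log 2 (m * L.prod) := by
      refine Nat.le_log_of_pow_le (by simp) ?_
      rw [pow_add]
      exact Nat.mul_le_mul (Nat.pow_log_le_self 2 (by omega)) (Nat.pow_log_le_self 2 hpos)
    rw [tsize_cons, List.prod_cons]
    simp only [Nat.succ_eq_add_one] at h2
    omega

theorem foldl_coinStep_bound {y : ℕ → ℕ → ℕ} {N : ℕ} {full : List Bool} (r : List Bool)
    (s : List ℕ × ℕ × List Bool) (k : ℕ) (h1 : IsFactorList N s.1) (h2 : s.2.1 < 2 ^ k)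
    (h3 : tsize s.2.2 ≤ tsize full) :
    IsFactorList N (r.foldl (coinStep y full) s).1 ∧
      (r.foldl (coinStep y full) s).2.1 < 2 ^ (k + r.length) ∧
      tsize (r.foldl (coinStep y full) s).2.2 ≤ tsize full := by
  induction r generalizing s k with
  | nil => exact ⟨h1, h2, h3⟩
  | cons b r ih =>
    obtain ⟨L, x, cnt⟩ := s
    rw [List.foldl_cons, List.length_cons, Nat.add_comm r.length, ← Nat.add_assoc]
    unfold coinStep
    simp only at h1 h2 h3
    cases h : cnt.tail with
    | nil => exact ih _ (k + 1) (h1.splitAll _ _) (by simp [listElim]) le_rfl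
    | cons c cnt' =>
      refine ih _ (k + 1) h1 ?_ ?_
      · simp only [listElim, Nat.bit_val, pow_succ]
        have := Bool.toNat_le b
        omega
      · refine le_trans ?_ h3
        simp only [listElim, ← h]
        cases cnt with
        | nil => exact le_rfl
        | cons d cnt =>
          rw [List.tail_cons, tsize_cons]
          omega

/-- Polynomial time is claimed for all natural numbers. For `N = 0` the run starts with the empty
list, of product 1. -/
theorem isFactorList_coinStart (N : ℕ) : IsFactorList (max N 1) (coinStart N).1 := by
  unfold coinStart
  dsimp only
  split
  · exact ⟨by simp, by simp; omega⟩
  · exact ⟨by simp; omega, by simp; omega⟩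

theorem tsize_prod {α β : Type} [TreeData α] [TreeData β] (x : α × β) :
    tsize x = tsize x.1 + tsize x.2 + 1 := tsize_pair x.1 x.2

theorem tsize_coinState_le {y : ℕ → ℕ → ℕ} (N : ℕ) (r : List Bool) :
    tsize (r.foldl (coinStep y (counter N)) (coinStart N)) ≤
      10 * tsize N + 4 * r.length + tsize (counter N) + 14 := by
  obtain ⟨h1, h2, h3⟩ := foldl_coinStep_bound (y := y) (full := counter N) r (coinStart N) 0
    (isFactorList_coinStart N) (by simp [coinStart]) le_rfl
  have h4 := tsize_factorList_le h1.1
  rw [h1.2] at h4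
  have h5 := tsize_le_of_lt_two_pow h2
  have h7 : Nat.log 2 (max N 1) ≤ tsize N := by
    refine (Nat.log_lt_of_lt_pow (by omega) (max_lt (lt_two_pow_tsize N) ?_)).le
    refine Nat.one_lt_pow ?_ (by simp)
    have := length_lt_tsize N.bits
    rw [tsize_nat]
    omega
  rw [tsize_prod, tsize_prod (Prod.snd _)]
  omega

namespace PolyTime

variable {α β γ δ : Type} [TreeData α] [TreeData β] [TreeData γ] [TreeData δ]

theorem coinStep {y : ℕ → ℕ → ℕ} (hy : PolyTime C fun x : ℕ × ℕ => y x.1 x.2) :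
    PolyTime C fun x : List Bool × (List ℕ × ℕ × List Bool) × Bool => coinStep y x.1 x.2.1 x.2.2 := by
  have h1 : PolyTime C fun x : (List Bool × (List ℕ × ℕ × List Bool) × Bool) × ℕ =>
      _root_.trySplit y x.2 (Nat.bit x.1.2.2 x.1.2.1.2.1) :=
    (trySplit hy).comp (f := fun x : (List Bool × (List ℕ × ℕ × List Bool) × Bool) × ℕ =>
      (x.2, Nat.bit x.1.2.2 x.1.2.1.2.1)) (by fun_prop)
  have h2 : PolyTime C fun x : List Bool × (List ℕ × ℕ × List Bool) × Bool =>
      splitAll y x.2.1.1 (Nat.bit x.2.2 x.2.1.2.1) :=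
    listFlatMap (f := fun (x : List Bool × (List ℕ × ℕ × List Bool) × Bool) m =>
      _root_.trySplit y m (Nat.bit x.2.2 x.2.1.2.1)) (by fun_prop) h1
  exact listCase (f := fun x : List Bool × (List ℕ × ℕ × List Bool) × Bool =>
      (splitAll y x.2.1.1 (Nat.bit x.2.2 x.2.1.2.1), 0, x.1))
    (g := fun x _ _ => (x.2.1.1, Nat.bit x.2.2 x.2.1.2.1, x.2.1.2.2.tail))
    (by fun_prop) (h2.prodMk (by fun_prop)) (by fun_prop)

theorem factorRun {y : ℕ → ℕ → ℕ} (hy : PolyTime C fun x : ℕ × ℕ => y x.1 x.2) :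
    PolyTime C fun x : ℕ × List Bool => factorRun y x.1 x.2 := by
  have hc : PolyTime C fun x : ℕ × List Bool => counter x.1 := by
    unfold counter
    fun_prop
  have hs : PolyTime C fun x : ℕ × List Bool => coinStart x.1 := by
    unfold coinStart
    exact prodMk (by fun_prop) (prodMk (by fun_prop) hc)
  obtain ⟨q, hq⟩ := hc.exists_tsize_le
  have hstep : PolyTime C fun x : (ℕ × List Bool) × (List ℕ × ℕ × List Bool) × Bool =>
      _root_.coinStep y (counter x.1.1) x.2.1 x.2.2 :=
    (coinStep hy).comp (f := fun x : (ℕ × List Bool) × (List ℕ × ℕ × List Bool) × Bool =>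
      (counter x.1.1, x.2)) (prodMk (hc.comp fst) (by fun_prop))
  refine fst.comp (foldl (lst := fun x : ℕ × List Bool => x.2)
    (step := fun x => _root_.coinStep y (counter x.1)) hs (by fun_prop) hstep
    (14 * .X + q + 14) fun x l₁ l₂ h => ?_)
  refine (tsize_coinState_le x.1 l₁).trans ?_
  have h6 := hq x
  have h8 : l₁.length ≤ tsize x.2 := by
    have := length_lt_tsize x.2
    rw [h, List.length_append] at this
    rw [h]
    omega
  have h9 := tsize_prod x
  simp only [Polynomial.eval_add, Polynomial.eval_mul, Polynomial.eval_X, Polynomial.eval_ofNat]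
  omega

end PolyTime

/-! ### Input and output formats of the factoring machine. -/

theorem encodePosNum_eq_bits (n : PosNum) : Computability.encodePosNum n = (n : ℕ).bits := by
  induction n with
  | one => simp [Computability.encodePosNum]
  | bit0 n ih =>
    rw [Computability.encodePosNum, ih, PosNum.cast_bit0, ← two_mul,
      Nat.bit0_bits _ (PosNum.cast_pos n).ne']
  | bit1 n ih => rw [Computability.encodePosNum, ih, PosNum.cast_bit1, ← two_mul, Nat.bit1_bits]

theorem encodeNat_eq_bits (n : ℕ) : Computability.encodeNat n = n.bits := by
  unfold Computability.encodeNat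
  conv_rhs => rw [← Num.to_of_nat n]
  cases (n : Num) with
  | zero => simp [Computability.encodeNum]
  | pos p => exact encodePosNum_eq_bits p

/-- Read a number whose digits are marked by `false` and a string whose letters are marked by
`true` from the reversed input. -/
def decodeInput (l : List (Bool × Bool)) : ℕ × List Bool :=
  l.foldl (fun s d => if d.2 = true then (s.1, d.1 :: s.2) else (Nat.bit d.1 s.1, s.2)) (0, [])

theorem decodeInput_reverse (n : ℕ) (r : List Bool) :
    decodeInput (n.bits.map (fun b => (b, false)) ++ r.map fun b => (b, true)).reverse =
      (n, r) := by
  have h1 : ∀ (l : List Bool) (s : ℕ × List Bool), (l.map fun b => (b, true)).foldl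
      (fun s d => if d.2 = true then (s.1, d.1 :: s.2) else (Nat.bit d.1 s.1, s.2)) s =
      (s.1, l.reverse ++ s.2) := by
    intro l
    induction l with
    | nil => simp
    | cons b l ih =>
      intro s
      simp [ih]
  have h2 : ∀ (l : List Bool) (s : ℕ × List Bool), (l.map fun b => (b, false)).foldl
      (fun s d => if d.2 = true then (s.1, d.1 :: s.2) else (Nat.bit d.1 s.1, s.2)) s =
      (l.foldl (fun n b => Nat.bit b n) s.1, s.2) := by
    intro l
    induction l with
    | nil => simp
    | cons b l ih =>
      intro s
      simp [ih]
  have h3 := bitsVal_reverse_bits n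
  unfold bitsVal at h3
  rw [decodeInput, List.reverse_append, ← List.map_reverse, ← List.map_reverse, List.foldl_append,
    h1, h2, h3, List.reverse_reverse, List.append_nil]

namespace PolyTime

variable {C : Setting} {α β γ δ : Type} [TreeData α] [TreeData β] [TreeData γ] [TreeData δ]

@[fun_prop]
theorem decodeInput {f : α → List (Bool × Bool)} (hf : PolyTime C f) :
    PolyTime C fun x => decodeInput (f x) := by
  refine foldl_of_growth (init := fun _ => (0, [])) (step := fun _ s d =>
    if d.2 = true then (s.1, d.1 :: s.2) else (Nat.bit d.1 s.1, s.2)) (by fun_prop) hf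
      (by fun_prop) (.X + 1) fun x s d => ?_
  obtain ⟨n, l⟩ := s
  obtain ⟨b, c⟩ := d
  have h1 := tsize_bit_le b n
  simp only [Polynomial.eval_add, Polynomial.eval_X, Polynomial.eval_one]
  split_ifs <;> simp only [tsize_pair, tsize_cons] <;> omega

end PolyTime

theorem nonempty_tm2ComputableInPolyTime_factorRun {F : List Bool → List Bool} (hF : InFP F) :
    Nonempty (TM2ComputableInPolyTime (encodeWithCoins encodePosNat) encodeNatList
      fun x : ℕ+ × List Bool => factorRun (rootOf F) x.1 x.2) := by
  obtain ⟨h⟩ := hF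
  let C : Setting := ⟨Bool ⊕ Bool, Option Bool, h.tm⟩
  have : Fintype C.inAlph := inferInstanceAs (Fintype (Bool ⊕ Bool))
  have hy : PolyTime C fun x : ℕ × ℕ => rootOf F x.1 x.2 := by
    have h1 : PolyTime C fun x : ℕ × ℕ => encodePair x.1 x.2 := by fun_prop
    exact PolyTime.snd.comp (((PolyTime.oracle h).comp h1).decodePair)
  have hr : PolyTime C fun l : List (Bool × Bool) =>
      factorRun (rootOf F) (decodeInput l).1 (decodeInput l).2 :=
    (PolyTime.factorRun hy).comp (f := fun l : List (Bool × Bool) => decodeInput l) (by fun_prop)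
  have ho : PolyTime C fun n : ℕ => n.bits.map (fun b => (b, true)) ++ [(false, false)] :=
    (PolyTime.listMap (f := fun (_ : ℕ) (b : Bool) => (b, true)) (by fun_prop)
      (by fun_prop)).listAppend (by fun_prop)
  have hg : PolyTime C fun l : List (Bool × Bool) =>
      ((factorRun (rootOf F) (decodeInput l).1 (decodeInput l).2).reverse.reverse.flatMap
        fun n => n.bits.map (fun b => (b, true)) ++ [(false, false)]).reverse :=
    (PolyTime.listFlatMap (f := fun (_ : List (Bool × Bool)) (n : ℕ) =>
      n.bits.map (fun b => (b, true)) ++ [(false, false)]) hr.listReverse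
        (ho.comp PolyTime.snd)).listReverse
  -- The second Boolean of a pair tells coins from digits of `N` in the input, and digits from
  -- separators in the output.
  refine hg.nonempty_tm2ComputableInPolyTime
    (Sum.elim (fun b => (b, false)) fun b => (b, true)) (fun b c => if c then some b else none)
    fun x => ?_
  obtain ⟨n, r⟩ := x
  have h1 : (encodeWithCoins encodePosNat (n, r)).map
      (Sum.elim (fun b => (b, false)) fun b => (b, true)) =
      (n : ℕ).bits.map (fun b => (b, false)) ++ r.map fun b => (b, true) := by
    simp [encodeWithCoins, encodePosNat, encodeNat_eq_bits]
  rw [h1, decodeInput_reverse, List.reverse_reverse, List.map_reverse, List.reverse_reverse,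
    List.map_flatMap, encodeNatList]
  simp [encodeNat_eq_bits, Function.comp_def]

theorem exists_rootFinder_of_classCF_eq_classKer (h : ClassCF = ClassKer) :
    ∃ F, InFP F ∧ IsRootFinder (rootOf F) := by
  have h1 : Setoid.ker squarePair ∈ ClassKer :=
    -- `squarePair` calls no oracle, so any machine can fill that place.
    ⟨squarePair, (PolyTime.squarePair (C := ⟨Bool, Bool, idComputer Bool⟩)).inFP, rfl⟩
  rw [← h] at h1
  obtain ⟨F, hF, hF'⟩ := h1
  exact ⟨F, hF, isRootFinder_rootOf hF'⟩

/-! ### The probability of success. -/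

/-- The sum of the values of a function on all bit strings of a given length. -/
def coinSum : ℕ → (List Bool → ℚ) → ℚ
  | 0, F => F []
  | n + 1, F => coinSum n (fun w => F (true :: w)) + coinSum n (fun w => F (false :: w))

theorem sum_ofFn_eq_coinSum (n : ℕ) (F : List Bool → ℚ) :
    ∑ r : Fin n → Bool, F (List.ofFn r) = coinSum n F := by
  induction n generalizing F with
  | zero => simp [coinSum]
  | succ n ih =>
    rw [← (Fin.consEquiv fun _ => Bool).sum_comp, Fintype.sum_prod_type, Fintype.sum_bool, coinSum,
      ← ih, ← ih]
    simp [Fin.consEquiv, List.ofFn_succ]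

theorem coinSum_add (m n : ℕ) (F : List Bool → ℚ) :
    coinSum (m + n) F = coinSum m fun v => coinSum n fun w => F (v ++ w) := by
  induction m generalizing F with
  | zero => simp [coinSum]
  | succ m ih => rw [Nat.succ_add, coinSum, coinSum, ih, ih]; rfl

theorem coinSum_le_coinSum {n : ℕ} {F G : List Bool → ℚ} (h : ∀ w, w.length = n → F w ≤ G w) :
    coinSum n F ≤ coinSum n G := by
  induction n generalizing F G with
  | zero => exact h [] rfl
  | succ n ih =>
    exact add_le_add (ih fun w hw => h _ (by simp [hw])) (ih fun w hw => h _ (by simp [hw]))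

theorem coinSum_mul_left (n : ℕ) (c : ℚ) (F : List Bool → ℚ) :
    coinSum n (fun w => c * F w) = c * coinSum n F := by
  induction n generalizing F with
  | zero => rfl
  | succ n ih => rw [coinSum, coinSum, ih, ih, mul_add]

/-- As `n` tosses vary, the number that they append to `a` in binary takes each value from `2 ^ n *
a` to `2 ^ n * a + 2 ^ n - 1` once: a block of coins is a uniform number. -/
theorem coinSum_foldl_bit (n a : ℕ) (F : ℕ → ℚ) :
    coinSum n (fun w => F (w.foldl (fun n b => Nat.bit b n) a)) =
      ∑ x ∈ Finset.range (2 ^ n), F (2 ^ n * a + x) := by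
  induction n generalizing a with
  | zero => simp [coinSum]
  | succ n ih =>
    simp only [coinSum, List.foldl_cons, ih]
    rw [pow_succ, mul_two, Finset.sum_range_add, add_comm]
    congr 1 <;> refine Finset.sum_congr rfl fun x _ => congrArg F ?_ <;>
      simp only [Nat.bit_val, Bool.toNat_true, Bool.toNat_false] <;> ring

/-- The total number of splittings that are still missing in a list of factors. -/
def splitDefect (L : List ℕ) : ℚ := (L.map fun m => (ArithmeticFunction.cardFactors m : ℚ) - 1).sum

theorem splitDefect_append (L L' : List ℕ) :
    splitDefect (L ++ L') = splitDefect L + splitDefect L' := by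
  simp [splitDefect]

theorem splitDefect_singleton (m : ℕ) :
    splitDefect [m] = (ArithmeticFunction.cardFactors m : ℚ) - 1 := by
  simp [splitDefect]

theorem one_le_cardFactors {m : ℕ} (hm : 1 < m) :
    (1 : ℚ) ≤ ArithmeticFunction.cardFactors m := by
  exact_mod_cast ArithmeticFunction.cardFactors_pos_iff_one_lt.2 hm

theorem splitDefect_nonneg {L : List ℕ} (hL : ∀ m ∈ L, 1 < m) : 0 ≤ splitDefect L := by
  refine List.sum_nonneg fun x hx => ?_
  obtain ⟨m, hm, rfl⟩ := List.mem_map.1 hx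
  exact sub_nonneg.2 (one_le_cardFactors (hL m hm))

theorem one_le_splitDefect {L : List ℕ} (hL : ∀ m ∈ L, 1 < m) (h : ¬ ∀ m ∈ L, m.Prime) :
    1 ≤ splitDefect L := by
  push Not at h
  obtain ⟨m, hm, hmp⟩ := h
  obtain ⟨L₁, L₂, rfl⟩ := List.append_of_mem hm
  have h1 := splitDefect_nonneg fun k hk => hL k (List.mem_append_left _ hk)
  have h2 := splitDefect_nonneg fun k hk =>
    hL k (List.mem_append_right _ (List.mem_cons_of_mem _ hk))
  have h3 : 2 ≤ ArithmeticFunction.cardFactors m := by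
    have h4 := ArithmeticFunction.cardFactors_pos_iff_one_lt.2 (hL m hm)
    have h5 := mt ArithmeticFunction.cardFactors_eq_one_iff_prime.1 hmp
    omega
  have h4 : (2 : ℚ) ≤ ArithmeticFunction.cardFactors m := by exact_mod_cast h3
  rw [splitDefect_append, show m :: L₂ = [m] ++ L₂ from rfl, splitDefect_append,
    splitDefect_singleton]
  linarith

theorem cardFactors_le_of_lt_two_pow {m k : ℕ} (hm : m ≠ 0) (h : m < 2 ^ k) :
    ArithmeticFunction.cardFactors m ≤ k := by
  have h1 : 2 ^ ArithmeticFunction.cardFactors m ≤ m := by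
    rw [ArithmeticFunction.cardFactors_apply]
    conv_rhs => rw [← Nat.prod_primeFactorsList hm]
    exact List.pow_card_le_prod _ _ fun p hp => (Nat.prime_of_mem_primeFactorsList hp).two_le
  exact ((Nat.pow_lt_pow_iff_right (by simp)).1 (h1.trans_lt h)).le

theorem trySplit_mod (y : ℕ → ℕ → ℕ) (m x : ℕ) : trySplit y m (x % m) = trySplit y m x := by
  unfold trySplit
  rw [Nat.mod_mod]

theorem card_filter_range_trySplit_le (y : ℕ → ℕ → ℕ) (m n : ℕ) (hm : 0 < m) :
    ((Finset.range n).filter fun x => trySplit y m x = [m]).card ≤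
      (n / m + 1) * ((Finset.range m).filter fun x => trySplit y m x = [m]).card := by
  rw [← Finset.card_range (n / m + 1), ← Finset.card_product]
  refine Finset.card_le_card_of_injOn (fun x => (x / m, x % m)) (fun x hx => ?_) ?_
  · simp only [Finset.coe_filter, Finset.mem_range, Set.mem_ofPred_eq] at hx
    simp only [Finset.coe_product, Set.mem_prod, Finset.mem_coe, Finset.mem_range,
      Finset.mem_filter]
    exact ⟨Nat.lt_succ_of_le (Nat.div_le_div_right hx.1.le), Nat.mod_lt _ hm,
      (trySplit_mod y m x).trans hx.2⟩
  · intro a _ b _ h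
    rw [Prod.mk.injEq] at h
    rw [← Nat.div_add_mod a m, h.1, h.2, Nat.div_add_mod]

/-- Failure has period `m`, which need not divide `n`. The incomplete last period counts as a full
one, at most `n / 8`, and `3 / 4 * (9 / 8) ≤ 7 / 8`. -/
theorem eight_mul_card_trySplit_le {y : ℕ → ℕ → ℕ} (hy : IsRootFinder y) {m n : ℕ} (hm : 1 < m)
    (hmp : ¬ m.Prime) (hn : 8 * m ≤ n) :
    8 * ((Finset.range n).filter fun x => trySplit y m x = [m]).card ≤ 7 * n := by
  have h1 := card_filter_range_trySplit_le y m n (by omega)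
  have h2 := Nat.mul_le_mul_left (n / m + 1) (four_mul_card_trySplit_le hm hmp hy)
  have h3 : (n / m + 1) * (3 * m) ≤ 3 * n + 3 * m := by
    have := Nat.div_mul_le_self n m
    nlinarith
  have h4 := Nat.mul_le_mul_left 4 h1
  have h5 : 4 * ((n / m + 1) * ((Finset.range m).filter fun x => trySplit y m x = [m]).card) =
    (n / m + 1) * (4 * ((Finset.range m).filter fun x => trySplit y m x = [m]).card) := by ring
  omega

theorem splitDefect_trySplit {y : ℕ → ℕ → ℕ} {m x : ℕ} (hx : trySplit y m x ≠ [m]) :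
    splitDefect (trySplit y m x) = splitDefect [m] - 1 := by
  obtain h | ⟨a, b, h, hab, ha, hb⟩ := trySplit_cases y m x
  · exact absurd h hx
  · rw [h, ← hab, show [a, b] = [a] ++ [b] from rfl, splitDefect_append, splitDefect_singleton,
      splitDefect_singleton, splitDefect_singleton,
      ArithmeticFunction.cardFactors_mul (by omega) (by omega)]
    push_cast
    ring

/-- A prime has defect 0 and is never split. For composite `m` the defect `D` drops by 1 for at
least an eighth of the `x`, and `D ≤ k`, so its mean is at most `D - 1 / 8 ≤ (1 - 1 / (8 * k)) * D`.
Sums replace means, hence the factor `2 ^ (k + 3)`. -/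
theorem sum_splitDefect_trySplit_le {y : ℕ → ℕ → ℕ} (hy : IsRootFinder y) {k m : ℕ} (hm : 1 < m)
    (hk : m < 2 ^ k) :
    ∑ x ∈ Finset.range (2 ^ (k + 3)), splitDefect (trySplit y m x) ≤
      2 ^ (k + 3) * (1 - 1 / (8 * k)) * splitDefect [m] := by
  have hk0 : (0 : ℚ) < k := by
    rcases k with _ | k
    · omega
    · positivity
  by_cases hmp : m.Prime
  · have h0 : splitDefect [m] = 0 := by
      rw [splitDefect_singleton, ArithmeticFunction.cardFactors_eq_one_iff_prime.2 hmp]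
      simp
    rw [h0, mul_zero]
    refine (Finset.sum_eq_zero fun x _ => ?_).le
    obtain h | ⟨a, b, -, hab, ha, hb⟩ := trySplit_cases y m x
    · rw [h, h0]
    · exact absurd hmp (hab ▸ Nat.not_prime_mul (by omega) (by omega))
  · have h1 : ∀ x, splitDefect (trySplit y m x) =
        (splitDefect [m] - 1) + if trySplit y m x = [m] then 1 else 0 := by
      intro x
      split_ifs with h
      · rw [h]
        ring
      · rw [splitDefect_trySplit h, add_zero]
    have h2 : (8 : ℚ) * ((Finset.range (2 ^ (k + 3))).filter fun x => trySplit y m x = [m]).card ≤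
        7 * 2 ^ (k + 3) := by
      exact_mod_cast eight_mul_card_trySplit_le hy hm hmp (n := 2 ^ (k + 3)) (by rw [pow_add]; omega)
    have h3 : splitDefect [m] ≤ k := by
      rw [splitDefect_singleton]
      have : (ArithmeticFunction.cardFactors m : ℚ) ≤ k := by
        exact_mod_cast cardFactors_le_of_lt_two_pow (by omega) hk
      linarith
    have h4 : 1 / (8 * (k : ℚ)) * splitDefect [m] ≤ 1 / 8 := by
      rw [one_div_mul_eq_div, div_le_iff₀ (by positivity)]
      linarith
    simp only [h1]
    rw [Finset.sum_add_distrib, Finset.sum_const, Finset.sum_boole, Finset.card_range, nsmul_eq_mul]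
    push_cast
    have h5 := mul_le_mul_of_nonneg_left h4 (by positivity : (0 : ℚ) ≤ 2 ^ (k + 3))
    linarith

theorem sum_splitDefect_splitAll_le {y : ℕ → ℕ → ℕ} (hy : IsRootFinder y) {k : ℕ} {L : List ℕ}
    (hL : ∀ m ∈ L, 1 < m) (hk : ∀ m ∈ L, m < 2 ^ k) :
    ∑ x ∈ Finset.range (2 ^ (k + 3)), splitDefect (splitAll y L x) ≤
      2 ^ (k + 3) * (1 - 1 / (8 * k)) * splitDefect L := by
  have key : ∀ L : List ℕ, (∀ m ∈ L, 1 < m) → (∀ m ∈ L, m < 2 ^ k) →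
      ∑ x ∈ Finset.range (2 ^ (k + 3)), splitDefect (L.flatMap fun m => trySplit y m x) ≤
      2 ^ (k + 3) * (1 - 1 / (8 * k)) * splitDefect L := by
    intro L
    induction L with
    | nil => simp [splitDefect]
    | cons m L ih =>
      intro h1 h2
      rw [← List.singleton_append, splitDefect_append, mul_add]
      simp only [List.flatMap_append, splitDefect_append, List.flatMap_singleton,
        Finset.sum_add_distrib]
      exact add_le_add (sum_splitDefect_trySplit_le hy (h1 m (by simp)) (h2 m (by simp)))
        (ih (fun m hm => h1 m (by simp [hm])) fun m hm => h2 m (by simp [hm]))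
  have h := key L.reverse (by simpa using hL) (by simpa using hk)
  rwa [show splitDefect L.reverse = splitDefect L by
    rw [splitDefect, List.map_reverse, List.sum_reverse, splitDefect]] at h

/-- For a fixed first block, the induction hypothesis bounds the remaining rounds by a multiple of
the defect after that block. Summing over the block gives one more factor. -/
theorem coinSum_splitDefect_foldl_le {y : ℕ → ℕ → ℕ} (hy : IsRootFinder y) {k N : ℕ}
    {full : List Bool} (hN : 0 < N) (hk : N < 2 ^ k) (hfull : full.length = k + 3) (T : ℕ)
    {L : List ℕ} (hL : IsFactorList N L) :
    coinSum (T * (k + 3)) (fun r => splitDefect (r.foldl (coinStep y full) (L, 0, full)).1) ≤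
      (2 ^ (k + 3) * (1 - 1 / (8 * k))) ^ T * splitDefect L := by
  have hk0 : 0 < k := by
    rcases k with _ | k <;> omega
  have hq : (0 : ℚ) ≤ 2 ^ (k + 3) * (1 - 1 / (8 * k)) := by
    refine mul_nonneg (by positivity) (sub_nonneg.2 ?_)
    rw [div_le_one (by positivity)]
    have : (1 : ℚ) ≤ k := by exact_mod_cast hk0
    linarith
  induction T generalizing L with
  | zero => simp [coinSum]
  | succ T ih =>
    rw [Nat.succ_mul, Nat.add_comm, coinSum_add]
    simp only [List.foldl_append]
    calc _ ≤ coinSum (k + 3) (fun w => (2 ^ (k + 3) * (1 - 1 / (8 * k))) ^ T *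
          splitDefect (splitAll y L (w.foldl (fun n b => Nat.bit b n) 0))) := by
          refine coinSum_le_coinSum fun w hw => ?_
          rw [foldl_coinStep_block y full L w full 0 (fun h => by simp [h] at hw) (hw.trans hfull.symm)]
          exact ih (hL.splitAll y _)
      _ ≤ _ := by
          rw [coinSum_mul_left, coinSum_foldl_bit (k + 3) 0 fun x => splitDefect (splitAll y L x),
            pow_succ _ T, mul_assoc _ _ (splitDefect L)]
          refine mul_le_mul_of_nonneg_left ?_ (pow_nonneg hq T)
          simp only [mul_zero, zero_add]
          refine sum_splitDefect_splitAll_le hy hL.1 fun m hm => ?_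
          exact (Nat.le_of_dvd hN (hL.2 ▸ List.dvd_prod hm)).trans_lt hk

/-- Let `u = 1 / (8 * k)` and `n = 32 * k ^ 2`, so that `n * u = 4 * k`. Bernoulli's inequality
gives `(1 + u) ^ n ≥ 1 + 4 * k`, and `(1 - u) ^ n * (1 + u) ^ n ≤ 1`. Hence the left side is at most
`k / (1 + 4 * k)`. -/
theorem pow_mul_le_one_third {k : ℕ} (hk : 0 < k) :
    (1 - 1 / (8 * k) : ℚ) ^ (32 * k ^ 2) * k ≤ 1 / 3 := by
  have hk' : (1 : ℚ) ≤ k := by exact_mod_cast hk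
  set u : ℚ := 1 / (8 * k) with hu
  have hu0 : 0 ≤ u := by positivity
  have hu1 : u ≤ 1 := by
    rw [hu, div_le_one (by positivity)]
    linarith
  have h1 := one_add_mul_le_pow (by linarith : (-2 : ℚ) ≤ u) (32 * k ^ 2)
  have h2 : ((32 * k ^ 2 : ℕ) : ℚ) * u = 4 * k := by
    rw [hu]
    push_cast
    field_simp
    norm_num
  rw [h2] at h1
  have h3 : (1 - u) ^ (32 * k ^ 2) * (1 + u) ^ (32 * k ^ 2) ≤ 1 := by
    rw [← mul_pow]
    refine pow_le_one₀ (mul_nonneg (by linarith) (by linarith)) ?_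
    nlinarith
  have h4 := pow_nonneg (by linarith : 0 ≤ 1 - u) (32 * k ^ 2)
  have h5 := mul_le_mul_of_nonneg_left h1 h4
  nlinarith

/-- Markov's inequality: `1 - F` is at most the indicator of `E`. -/
theorem one_sub_le_uniformProb {n : ℕ} {E : (Fin n → Bool) → Prop} {F : List Bool → ℚ} {c : ℚ}
    (h0 : ∀ r : Fin n → Bool, 0 ≤ F (List.ofFn r)) (h1 : ∀ r, ¬ E r → 1 ≤ F (List.ofFn r))
    (h : coinSum n F ≤ 2 ^ n * c) : 1 - c ≤ uniformProb E := by
  classical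
  have h2 : ∑ r : Fin n → Bool, (1 - F (List.ofFn r)) ≤ ∑ r, if E r then 1 else 0 := by
    refine Finset.sum_le_sum fun r _ => ?_
    have := h0 r
    have := h1 r
    split_ifs with hr
    · linarith
    · linarith [h1 r hr]
  rw [Finset.sum_sub_distrib, sum_ofFn_eq_coinSum, Finset.sum_boole] at h2
  unfold uniformProb
  rw [Nat.card_eq_fintype_card, Nat.card_eq_fintype_card, Fintype.card_subtype, le_div_iff₀
    (by simp)]
  simp at h2 ⊢
  linarith

theorem two_thirds_le_uniformProb_factorRun {y : ℕ → ℕ → ℕ} (hy : IsRootFinder y) (N : ℕ+) (n : ℕ)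
    (hn : n = 32 * (N : ℕ).bits.length ^ 2 * ((N : ℕ).bits.length + 3)) :
    2 / 3 ≤ uniformProb fun r : Fin n → Bool =>
      IsPrimeFactorization N (factorRun y N (List.ofFn r)) := by
  subst hn
  set k := (N : ℕ).bits.length with hk
  have hN : (N : ℕ) < 2 ^ k := by
    have := bitsVal_lt (N : ℕ).bits.reverse
    rwa [bitsVal_reverse_bits, List.length_reverse] at this
  have hk0 : 0 < k := by
    have := N.pos
    rcases k with _ | k <;> omega
  have hstart : IsFactorList N (coinStart N).1 := by
    simpa [Nat.max_eq_left N.pos] using isFactorList_coinStart (N : ℕ)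
  have hrun : ∀ r, IsFactorList N (factorRun y N r) := fun r =>
    (foldl_coinStep_bound r (coinStart N) 0 hstart (by simp [coinStart]) le_rfl).1
  have h1 := coinSum_splitDefect_foldl_le hy N.pos hN (full := counter N)
    (by simp [counter, hk]) (32 * k ^ 2) hstart
  have h2 : splitDefect (coinStart N).1 ≤ k := by
    unfold coinStart
    dsimp only
    split_ifs
    · simp [splitDefect]
    · rw [splitDefect_singleton]
      have : (ArithmeticFunction.cardFactors (N : ℕ) : ℚ) ≤ k := by
        exact_mod_cast cardFactors_le_of_lt_two_pow N.pos.ne' hN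
      linarith
  have hq : (0 : ℚ) ≤ 1 - 1 / (8 * k) := by
    rw [sub_nonneg, div_le_one (by positivity)]
    have : (1 : ℚ) ≤ k := by exact_mod_cast hk0
    linarith
  refine le_trans (by norm_num : (2 / 3 : ℚ) ≤ 1 - 1 / 3)
    (one_sub_le_uniformProb (F := fun r => splitDefect (factorRun y N r))
      (fun r => splitDefect_nonneg (hrun _).1) (fun r hr => ?_) ?_)
  · exact one_le_splitDefect (hrun _).1 fun h => hr ⟨h, (hrun _).2⟩
  · refine h1.trans ?_
    rw [mul_pow, ← pow_mul, mul_assoc, mul_comm (k + 3)]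
    refine mul_le_mul_of_nonneg_left (le_trans ?_ (pow_mul_le_one_third hk0)) (by positivity)
    exact mul_le_mul_of_nonneg_left h2 (pow_nonneg hq _)

theorem factoringInProbPolyTime_of_classCF_eq_classKer (h : ClassCF = ClassKer) :
    FactoringInProbPolyTime := by
  obtain ⟨F, hF, hy⟩ := exists_rootFinder_of_classCF_eq_classKer h
  refine ⟨32 * .X ^ 2 * (.X + 3), _, nonempty_tm2ComputableInPolyTime_factorRun hF, fun N => ?_⟩
  refine two_thirds_le_uniformProb_factorRun hy N _ ?_
  simp [encodePosNat, encodeNat_eq_bits]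

theorem mainTheorem5 :
    (ClassCF = ClassKer → FactoringInProbPolyTime) ∧
    ∀ N : ℕ, 1 < N → Odd N → ¬ IsPrimePow N →
      ∀ f : ZMod N → ZMod N, IsCanonicalForm (Setoid.ker (fun x : ZMod N => x ^ 2)) f →
        1 / 2 ≤ uniformProb
          (fun x : (ZMod N)ˣ => f (x : ZMod N) ≠ (x : ZMod N) ∧ f (x : ZMod N) ≠ -(x : ZMod N)) ∧
        ∀ x : ZMod N, f x ≠ x → f x ≠ -x →
          1 < Nat.gcd N (x - f x).val ∧ Nat.gcd N (x - f x).val < N :=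
  ⟨factoringInProbPolyTime_of_classCF_eq_classKer, fun _ hN hodd hpp _ hf =>
    ⟨one_half_le_uniformProb hN hodd hpp hf, fun _ h1 h2 => gcd_val_sub_nontrivial hN hf h1 h2⟩⟩
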